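/- **Hexagonal systems.** A hexagonal system $(\mathbb J,\mathbb F,\#)$ consists of a commutative field $\mathbb F$, an $\mathbb F$-vector space $\mathbb J$, a map $\#:\mathbb J\to\mathbb J$ (the adjoint), a norm $\mathsf N:\mathbb J\to\mathbb F$, a symmetric bilinear form $\mathsf T:\mathbb J\times\mathbb J\to\mathbb F$, a symmetric bilinear map $\times:\mathbb J\times\mathbb J\to\mathbb J$ and an element $1\in\mathbb J\setminus\{0\}$ such that for all $a,b,c\in\mathbb J$, $t\in\mathbb F$: $(ta)^\#=t^2a^\#$, $\mathsf N(ta)=t^3\mathsf N(a)$, $\mathsf T(a,b\times c)=\mathsf T(a\times b,c)$, $(a+b)^\#=a^\#+a\times b+b^\#$, $\mathsf N(a+b)=\mathsf N(a)+\mathsf T(a^\#,b)+\mathsf T(a,b^\#)+\mathsf N(b)$, $\mathsf T(a,a^\#)=3\mathsf N(a)$, $a^{\#\#}=\mathsf N(a)a$, $a^\#\times(a\times b)=\mathsf N(a)b+\mathsf T(a^\#,b)a$, $a^\#\times b^\#+(a\times b)^\#=\mathsf T(a^\#,b)b+\mathsf T(a,b^\#)a$, $1^\#=1$, $a=\mathsf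 T(a,1)1-1\times a$, and $\mathsf N(a)=0$ only if $a=0$. Write $\mathsf T(a)=\mathsf T(a,1)$, $a^{-1}=\mathsf N(a)^{-1}a^\#$ for $a\neq0$, and identify $t\in\mathbb F$ with $t1\in\mathbb J$. An automorphism of the system is a vector space automorphism $h:a\mapsto a^h$ of $\mathbb J$ with $(a^\#)^h=(a^h)^\#$; write $z^{-h}=(z^{-1})^h$. **Hexagons.** Let $\Gamma$ be a Moufang hexagon (a thick generalised hexagon satisfying the Moufang condition) with full collineation group $G$ acting from the left, and suppose that $\Gamma$ has hexagonal system $(\mathbb J,\mathbb F,\#)$. This means that an ordinary hexagon $A=(A_j)_{j\in\mathbb Z/12}$ of points and lines, consecutive ones incident, $A_7$ a point, and isomorphisms $x_i$ from the additive group of $\mathbb J$ ($i$ odd) or $\mathbb F$ ($i$ even) onto $U_i$, $1\le i\le 6$, are fixed, where $U_i\le G$ is the root group of the root $(A_i,A_{i+1},\dots,A_{i+6})$, such that, with $[g,k]=g^{-1}k^{-1}gk$, $$[x_1(a),x_3(b)]=x_2(\mathsf T(a,b)),\quad [x_3(a),x_5(b)]=x_4(\mathsf T(a,b)),\quad [x_2(t),x_6(u)]=x_4(tu),$$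 $$[x_1(a),x_5(b)]=x_2(-\mathsf T(a^\#,b))\,x_3(a\times b)\,x_4(\mathsf T(a,b^\#)),$$ $$[x_1(a),x_6(t)]=x_2(-t\mathsf N(a))\,x_3(ta^\#)\,x_4(t^2\mathsf N(a))\,x_5(-ta),$$ and $[U_i,U_j]=1$ for all other $1\le i<j\le 6$. Let $s_1=x_7(1)x_1(1)x_7(1)$, where $x_7(1)$ is the unique element $v$ of the root group $U_7$ of $(A_7,\dots,A_{13}=A_1)$ such that $v\,x_1(1)\,v$ maps $A_j$ to $A_{2-j}$ for all $j$. An automorphism $h$ of the hexagonal system is also regarded as the unique element $h\in G$ that fixes every $A_j$ and satisfies $hx_i(c)h^{-1}=x_i(c^h)$ for $i$ odd and $hx_i(c)h^{-1}=x_i(c)$ for $i$ even, $1\le i\le 6$. An ovoid of $\Gamma$ is a set of mutually opposite points (points at distance $6$ in the incidence graph) such that every point and every line is at distance at most $3$ from some element of the set. A collineation is point-domestic if it maps no point to an opposite point. **Theorem.** Let $\theta\neq1$ be a point-domestic collineation of $\Gamma$ that fixes every point of some ovoid $O$. Then there is an automorphism $h$ of the hexagonal system $(\mathbb J,\mathbb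 F,\#)$ such that $\theta$ is conjugate in $G$ to $h\,x_1(1)\,s_1$ and 1. $h^3=1$, and $\theta$ has order $3$; 2. $\mathsf T(a)=a+a^h+a^{h^2}$ and $\mathsf T(a^\#)=\mathsf T(a,a^h)$ for all $a\in\mathbb J$; 3. the equation $z=1-z^{-h}$ has no solution $z\in\mathbb J\setminus\{0\}$. -/

import Mathlib

universe u v w z

/-! ### Point-line geometries and generalised hexagons -/

/-- A point-line geometry with point set `P` and line set `L`. -/
structure PointLineGeometry (P : Type u) (L : Type v) where
  /-- Incidence of a point with a line. -/
  inc : P → L → Prop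

namespace PointLineGeometry

variable {P : Type u} {L : Type v} (Γ : PointLineGeometry P L)

/-- The incidence graph: its vertices are the elements (points and lines) of the geometry. -/
def incidenceGraph : SimpleGraph (P ⊕ L) where
  Adj
    | .inl p, .inr l => Γ.inc p l
    | .inr l, .inl p => Γ.inc p l
    | _, _ => False
  symm := ⟨fun x y h => by rcases x with p | l <;> rcases y with q | m <;> exact h⟩
  loopless := ⟨fun x h => by rcases x with p | l <;> exact h⟩

/-- `c` runs once around an ordinary `k`-gon of the geometry (`k` points and `k` lines,
alternating), for `k ≥ 2`. -/
def IsOrdinaryGon (k : ℕ) (c : ZMod (2 * k) → P ⊕ L) : Prop :=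
  Function.Injective c ∧ ∀ i, Γ.incidenceGraph.Adj (c i) (c (i + 1))

/-- A labelled apartment: an ordinary hexagon, its elements labelled cyclically modulo `12`. -/
def IsApartment (A : ZMod 12 → P ⊕ L) : Prop :=
  Γ.IsOrdinaryGon 6 A

/-- Generalised hexagons. -/
structure IsGeneralisedHexagon : Prop where
  nonempty : Nonempty (P ⊕ L)
  no_small_gon : ∀ k : ℕ, 2 ≤ k → k ≤ 5 → ∀ c : ZMod (2 * k) → P ⊕ L, ¬ Γ.IsOrdinaryGon k c
  exists_apartment : ∀ x y : P ⊕ L,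
    ∃ A : ZMod 12 → P ⊕ L, Γ.IsApartment A ∧ x ∈ Set.range A ∧ y ∈ Set.range A

/-- Every line has at least three points, and every point is on at least three lines. -/
def IsThick : Prop :=
  (∀ l : L, 3 ≤ {p : P | Γ.inc p l}.encard) ∧ ∀ p : P, 3 ≤ {l : L | Γ.inc p l}.encard

/-- Two elements are opposite if their distance in the incidence graph is `6`. -/
def Opposite (x y : P ⊕ L) : Prop :=
  Γ.incidenceGraph.dist x y = 6

/-- An ovoid: mutually opposite points such that every element is at distance at most `3`
from one of them. -/
def IsOvoid (O : Set P) : Prop :=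
  (∀ p ∈ O, ∀ q ∈ O, p ≠ q → Γ.Opposite (.inl p) (.inl q)) ∧
    ∀ x : P ⊕ L, ∃ p ∈ O, Γ.incidenceGraph.dist x (.inl p) ≤ 3

/-! ### Collineations, root groups and the Moufang condition -/

/-- The full collineation group, as pairs of a permutation of the points and a permutation of
the lines; multiplication is composition. -/
def collineationGroup : Subgroup (Equiv.Perm P × Equiv.Perm L) where
  carrier := {g | ∀ p l, Γ.inc (g.1 p) (g.2 l) ↔ Γ.inc p l}
  one_mem' := fun _ _ => Iff.rfl
  mul_mem' := fun {g h} hg hh p l => (hg (h.1 p) (h.2 l)).trans (hh p l)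
  inv_mem' := fun {g} hg p l => by
    have := hg (g.1⁻¹ p) (g.2⁻¹ l)
    simpa using this.symm

/-- Collineations of `Γ`. -/
abbrev Collineation : Type (max u v) := Γ.collineationGroup

/-- The action of the collineations on the elements of the geometry. -/
instance : MulAction Γ.Collineation (P ⊕ L) where
  smul g := Sum.map g.1.1 g.1.2
  one_smul x := by rcases x with p | l <;> rfl
  mul_smul g h x := by rcases x with p | l <;> rfl

/-- `θ` maps no point to an opposite point. -/
def IsPointDomestic (θ : Γ.Collineation) : Prop :=
  ∀ p : P, ¬ Γ.Opposite (.inl p) (θ • .inl p)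

/-- The root group of the root `(A i, A (i + 1), …, A (i + 6))` of the apartment `A`: all
collineations that fix every element incident with one of the five interior elements
`A (i + 1), …, A (i + 5)`. -/
def rootGroup (A : ZMod 12 → P ⊕ L) (i : ZMod 12) : Subgroup Γ.Collineation :=
  fixingSubgroup Γ.Collineation
    {x : P ⊕ L | ∃ j : ℕ, 1 ≤ j ∧ j ≤ 5 ∧ Γ.incidenceGraph.Adj (A (i + (j : ZMod 12))) x}

/-- Moufang hexagons: thick generalised hexagons in which the root group of each root
`(x₀, …, x₆)` is transitive on the elements incident with `x₀` and different from `x₁`. -/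
structure IsMoufangHexagon : Prop where
  hexagon : Γ.IsGeneralisedHexagon
  thick : Γ.IsThick
  moufang : ∀ (A : ZMod 12 → P ⊕ L), Γ.IsApartment A → ∀ (i : ZMod 12) (x y : P ⊕ L),
    Γ.incidenceGraph.Adj (A i) x → x ≠ A (i + 1) →
    Γ.incidenceGraph.Adj (A i) y → y ≠ A (i + 1) →
    ∃ g ∈ Γ.rootGroup A i, g • x = y

end PointLineGeometry

/-! ### Hexagonal systems -/

/-- Hexagonal systems `(J, F, #)`, with the norm, the trace form, the cross product and the
identity that `#` determines. -/
structure HexagonalSystem (F : Type w) (J : Type z) [Field F] [AddCommGroup J] [Module F J] where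
  /-- The adjoint `#`. -/
  adj : J → J
  /-- The norm `N`. -/
  norm : J → F
  /-- The trace form `T(·,·)`. -/
  tr : J →ₗ[F] J →ₗ[F] F
  /-- The product `×`. -/
  cross : J →ₗ[F] J →ₗ[F] J
  /-- The identity `1`. -/
  one : J
  one_ne_zero : one ≠ 0
  tr_symm : ∀ a b, tr a b = tr b a
  cross_symm : ∀ a b, cross a b = cross b a
  adj_smul : ∀ (t : F) a, adj (t • a) = t ^ 2 • adj a
  norm_smul : ∀ (t : F) a, norm (t • a) = t ^ 3 * norm a
  tr_cross : ∀ a b c, tr a (cross b c) = tr (cross a b) c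
  adj_add : ∀ a b, adj (a + b) = adj a + cross a b + adj b
  norm_add : ∀ a b, norm (a + b) = norm a + tr (adj a) b + tr a (adj b) + norm b
  tr_adj : ∀ a, tr a (adj a) = 3 * norm a
  adj_adj : ∀ a, adj (adj a) = norm a • a
  adj_cross : ∀ a b, cross (adj a) (cross a b) = norm a • b + tr (adj a) b • a
  adj_cross_adj : ∀ a b,
    cross (adj a) (adj b) + adj (cross a b) = tr (adj a) b • b + tr a (adj b) • a
  adj_one : adj one = one
  one_cross : ∀ a, a = tr a one • one - cross one a
  norm_eq_zero : ∀ a, norm a = 0 ↔ a = 0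

namespace HexagonalSystem

variable {F : Type w} {J : Type z} [Field F] [AddCommGroup J] [Module F J]
  (S : HexagonalSystem F J)

/-- The trace `T(a) = T(a, 1)`. -/
def trace (a : J) : F := S.tr a S.one

/-- The inverse `a⁻¹ = N(a)⁻¹ a^#` of a nonzero element. -/
def inv (a : J) : J := (S.norm a)⁻¹ • S.adj a

/-- Automorphisms: vector space automorphisms that commute with the adjoint. -/
def IsAutomorphism (h : J ≃ₗ[F] J) : Prop :=
  ∀ a, h (S.adj a) = S.adj (h a)

end HexagonalSystem

/-! ### The hexagonal system of a Moufang hexagon -/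

/-- The commutator `[g, h] = g⁻¹ h⁻¹ g h`. -/
def groupComm {G : Type*} [Group G] (g h : G) : G := g⁻¹ * h⁻¹ * g * h

/-- `x` is an isomorphism from the additive group `M` onto the subgroup `U`. -/
def IsParametrisation {G M : Type*} [Group G] [AddCommGroup M] (x : M → G) (U : Subgroup G) :
    Prop :=
  (∀ a b, x (a + b) = x a * x b) ∧ Function.Injective x ∧ Set.range x = (U : Set G)

/-- What it means that the Moufang hexagon `Γ` has the hexagonal system `S`: there are a labelled
apartment `A` (with base point `A 7` and base line `A 6`) and isomorphisms `x₁, …, x₆` from `J`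
(odd index) and `F` (even index) onto the root groups `U₁, …, U₆` of the roots
`(A i, …, A (i + 6))` that satisfy the commutator relations of `S`. -/
structure HexagonCoordinates {P : Type u} {L : Type v} (Γ : PointLineGeometry P L)
    {F : Type w} {J : Type z} [Field F] [AddCommGroup J] [Module F J]
    (S : HexagonalSystem F J) where
  A : ZMod 12 → P ⊕ L
  isApartment : Γ.IsApartment A
  isPoint : ∃ p : P, A 7 = .inl p
  x₁ : J → Γ.Collineation
  x₂ : F → Γ.Collineation
  x₃ : J → Γ.Collineation
  x₄ : F → Γ.Collineation
  x₅ : J → Γ.Collineation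
  x₆ : F → Γ.Collineation
  param₁ : IsParametrisation x₁ (Γ.rootGroup A 1)
  param₂ : IsParametrisation x₂ (Γ.rootGroup A 2)
  param₃ : IsParametrisation x₃ (Γ.rootGroup A 3)
  param₄ : IsParametrisation x₄ (Γ.rootGroup A 4)
  param₅ : IsParametrisation x₅ (Γ.rootGroup A 5)
  param₆ : IsParametrisation x₆ (Γ.rootGroup A 6)
  comm₁₂ : ∀ a t, groupComm (x₁ a) (x₂ t) = 1
  comm₁₃ : ∀ a b, groupComm (x₁ a) (x₃ b) = x₂ (S.tr a b)
  comm₁₄ : ∀ a t, groupComm (x₁ a) (x₄ t) = 1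
  comm₁₅ : ∀ a b, groupComm (x₁ a) (x₅ b) =
    x₂ (-S.tr (S.adj a) b) * x₃ (S.cross a b) * x₄ (S.tr a (S.adj b))
  comm₁₆ : ∀ a t, groupComm (x₁ a) (x₆ t) =
    x₂ (-(t * S.norm a)) * x₃ (t • S.adj a) * x₄ (t ^ 2 * S.norm a) * x₅ (-(t • a))
  comm₂₃ : ∀ t a, groupComm (x₂ t) (x₃ a) = 1
  comm₂₄ : ∀ t u, groupComm (x₂ t) (x₄ u) = 1
  comm₂₅ : ∀ t a, groupComm (x₂ t) (x₅ a) = 1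
  comm₂₆ : ∀ t u, groupComm (x₂ t) (x₆ u) = x₄ (t * u)
  comm₃₄ : ∀ a t, groupComm (x₃ a) (x₄ t) = 1
  comm₃₅ : ∀ a b, groupComm (x₃ a) (x₅ b) = x₄ (S.tr a b)
  comm₃₆ : ∀ a t, groupComm (x₃ a) (x₆ t) = 1
  comm₄₅ : ∀ t a, groupComm (x₄ t) (x₅ a) = 1
  comm₄₆ : ∀ t u, groupComm (x₄ t) (x₆ u) = 1
  comm₅₆ : ∀ a t, groupComm (x₅ a) (x₆ t) = 1

namespace HexagonCoordinates

variable {P : Type u} {L : Type v} {Γ : PointLineGeometry P L}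
  {F : Type w} {J : Type z} [Field F] [AddCommGroup J] [Module F J]
  {S : HexagonalSystem F J} (X : HexagonCoordinates Γ S)

/-- `s` is the element `s₁ = x₇(1) x₁(1) x₇(1)`. Here `x₇(1)` is the element `v` of the root group
`U₇` opposite to `U₁` for which `v x₁(1) v` stabilises the apartment `A`, inducing on it the
reflection that fixes the base point `A 7` and interchanges `A 6` and `A 8`. There is only one
such `v`, because `U₇` acts freely on the lines through `A 7` other than `A 8`. -/
def IsS₁ (s : Γ.Collineation) : Prop :=
  (∃ v ∈ Γ.rootGroup X.A 7, s = v * X.x₁ S.one * v) ∧ ∀ j, s • X.A j = X.A (2 - j)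

/-- `η` is the collineation that the automorphism `h` of `S` induces: it fixes the apartment `A`
elementwise and `η xᵢ(c) η⁻¹ = xᵢ(c^h)`, where `h` acts on `J` and trivially on `F`. There is only
one such collineation, because every element of `Γ` is the image of some `A j` under a product of
elements `xᵢ(c)`, `1 ≤ i ≤ 6`. -/
structure IsInducedBy (η : Γ.Collineation) (h : J ≃ₗ[F] J) : Prop where
  fix : ∀ j, η • X.A j = X.A j
  conj₁ : ∀ a, η * X.x₁ a * η⁻¹ = X.x₁ (h a)
  conj₂ : ∀ t, η * X.x₂ t * η⁻¹ = X.x₂ t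
  conj₃ : ∀ a, η * X.x₃ a * η⁻¹ = X.x₃ (h a)
  conj₄ : ∀ t, η * X.x₄ t * η⁻¹ = X.x₄ t
  conj₅ : ∀ a, η * X.x₅ a * η⁻¹ = X.x₅ (h a)
  conj₆ : ∀ t, η * X.x₆ t * η⁻¹ = X.x₆ t

end HexagonCoordinates

/-! The proof reads θ off its action on the lines through one point of O and then normalises the
outcome. A collineation that fixes O pointwise and also some line through a point of O is trivial,
because fixed elements propagate along tangent lines until a root and all its interior neighbours
are fixed (`eq_one_of_fixes_ovoid`, `eq_one_of_root`). Hence θ fixes no line through a point of O. A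
path joining two points of O and its image under θ therefore close up to an apartment, and after
conjugation A 7 and A 1 lie in O while θ maps A 8 to A 6 (`exists_isNormalised`).

Now θ s₁⁻¹ fixes A 6, A 7 and A 1, so θ = g x₁(c) s₁ with g fixing the apartment elementwise.
Domesticity, tested on the points x₄(r) A 1, shows that g centralises U₄; hence g is described by
two linear maps φ, ψ and a scalar l (`exists_isTorus`). Each point x₆(u) x₅(b) A 3 is collinear with
a point of O, which θ fixes. Comparing coordinates gives the equations of `IsFolding`, such as N(c)
= l, lφ(c) = c^# and a + lψ(φ(a)) = ψ(c × a). For z ≠ 0, θ maps x₁(z) A 8 to x₁(φ(c − z⁻¹)) A 8; no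
z ≠ 0 is fixed by this map, and θ permutes A 8, A 6, x₁(c⁻¹) A 8 cyclically, so θ³ = 1.

What remains is to reach c = 1, for which a collineation must fix the apartment and carry x₁(1) A 8
to x₁(c⁻¹) A 8. It exists because a folding forces dim J ≤ 3 (`finrank_le`): σ = lψφ satisfies σ³ =
1, the sum 1 + σ + σ² is a trace form times c, and k² − k + 1 has no root in F. In such a small
dimension a nonzero d is a scalar or J behaves like the cubic algebra F[d], and multiplication by d
is a norm similarity taking 1 to d (`exists_isIsotopy`). The similarity is induced by a
collineation, since two coordinate systems on one apartment always differ by a collineation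
(`exists_collineation_of_coordinates`). For c = 1 one gets l = 1 and ψ = φ; this map is the
automorphism h, and the folding equations become the assertions about h. -/

namespace PointLineGeometry

variable {P : Type u} {L : Type v} {Γ : PointLineGeometry P L}

/-- The colouring of the incidence graph by the type (point or line) of an element. -/
def typeColoring (Γ : PointLineGeometry P L) : Γ.incidenceGraph.Coloring Bool :=
  SimpleGraph.Coloring.mk Sum.isLeft (by
    rintro (p | l) (q | m) h <;> first | exact h.elim | simp)

theorem isLeft_ne_of_adj {x y : P ⊕ L} (h : Γ.incidenceGraph.Adj x y) : x.isLeft ≠ y.isLeft :=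
  Γ.typeColoring.valid h

/-! ### Distances, projections and circuits in a generalised hexagon. -/

namespace IsGeneralisedHexagon

variable (hΓ : Γ.IsGeneralisedHexagon)
include hΓ

theorem connected : Γ.incidenceGraph.Connected := by
  have := hΓ.nonempty
  refine ⟨fun x y => ?_⟩
  obtain ⟨A, hA, ⟨i, rfl⟩, ⟨j, rfl⟩⟩ := hΓ.exists_apartment x y
  have key : ∀ n : ℕ, Γ.incidenceGraph.Reachable (A i) (A (i + n)) := by
    intro n
    induction n with
    | zero => simp
    | succ n ih =>
      refine ih.trans ?_
      have := (hA.2 (i + n)).reachable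
      simpa [add_assoc] using this
  have := key (j - i).val
  simpa using this

theorem dist_le_six (x y : P ⊕ L) : Γ.incidenceGraph.dist x y ≤ 6 := by
  obtain ⟨A, hA, ⟨i, rfl⟩, ⟨j, rfl⟩⟩ := hΓ.exists_apartment x y
  have key : ∀ (n : ℕ) (i : ZMod 12), Γ.incidenceGraph.dist (A i) (A (i + n)) ≤ n := by
    intro n i
    induction n with
    | zero => simp
    | succ n ih =>
      have h1 := (hA.2 (i + n))
      rw [← SimpleGraph.dist_eq_one_iff_adj] at h1
      have := hΓ.connected.dist_triangle (u := A i) (v := A (i + n)) (w := A (i + n + 1))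
      push_cast
      rw [← add_assoc]
      omega
  have h1 := key (j - i).val i
  have h2 := key (i - j).val j
  have h3 : (j - i).val ≤ 6 ∨ (i - j).val ≤ 6 := by
    clear h1 h2 key
    revert i j
    decide
  rw [SimpleGraph.dist_comm] at h2
  simp only [ZMod.natCast_val, ZMod.cast_id', id_eq, add_sub_cancel] at h1 h2
  omega

/-- The graph is bipartite, so a cycle has even length 2k, and a shorter one would be an ordinary
k-gon with 2 ≤ k ≤ 5. -/
theorem twelve_le_length_of_isCycle {x : P ⊕ L} {c : Γ.incidenceGraph.Walk x x} (hc : c.IsCycle) :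
    12 ≤ c.length := by
  by_contra hlt
  have heven : Even c.length := (Γ.typeColoring.even_length_iff_congr c).2 Iff.rfl
  obtain ⟨k, hk⟩ := heven
  have h3 := hc.three_le_length
  have hk2 : 2 ≤ k := by omega
  have : NeZero (2 * k) := ⟨by omega⟩
  refine hΓ.no_small_gon k hk2 (by omega) (fun i => c.getVert i.val) ⟨?_, ?_⟩
  · intro i j hij
    have hi := ZMod.val_lt i
    have hj := ZMod.val_lt j
    exact ZMod.val_injective _ (hc.getVert_injOn' (by simp; omega) (by simp; omega) hij)
  · intro i
    have hi := ZMod.val_lt i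
    have hadj := c.adj_getVert_succ (i := i.val) (by omega)
    by_cases h : i.val + 1 = 2 * k
    · have h0 : i + 1 = 0 := by
        have : ((i.val + 1 : ℕ) : ZMod (2 * k)) = 0 := by rw [h]; simp
        simpa using this
      have hl : i.val + 1 = c.length := by omega
      rw [hl, SimpleGraph.Walk.getVert_length] at hadj
      simpa [h0] using hadj
    · have h1 : (1 : ZMod (2 * k)).val = 1 := ZMod.val_one'' (by omega)
      have h2 : (i + 1).val = i.val + 1 := by
        rw [ZMod.val_add_of_lt (by omega), h1]
      simpa only [h2] using hadj

/-- Adjacent vertices of a bipartite graph have distances to `y` of different parity, so the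
triangle inequality leaves a difference of exactly one. -/
theorem dist_of_adj {x z : P ⊕ L} (h : Γ.incidenceGraph.Adj x z) (y : P ⊕ L) :
    Γ.incidenceGraph.dist z y = Γ.incidenceGraph.dist x y + 1 ∨ Γ.incidenceGraph.dist x y = Γ.incidenceGraph.dist z y + 1 := by
  have h1 := SimpleGraph.dist_eq_one_iff_adj.2 h
  have h2 := hΓ.connected.dist_triangle (u := x) (v := z) (w := y)
  have h3 := hΓ.connected.dist_triangle (u := z) (v := x) (w := y)
  rw [SimpleGraph.dist_comm (u := z) (v := x)] at h3
  have hne : Γ.incidenceGraph.dist x y ≠ Γ.incidenceGraph.dist z y := by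
    intro he
    obtain ⟨p, hp⟩ := hΓ.connected.exists_walk_length_eq_dist x y
    obtain ⟨q, hq⟩ := hΓ.connected.exists_walk_length_eq_dist z y
    have e1 := Γ.typeColoring.even_length_iff_congr p
    have e2 := Γ.typeColoring.even_length_iff_congr q
    rw [hp] at e1
    rw [hq, ← he] at e2
    have := isLeft_ne_of_adj h
    change _ ↔ (x.isLeft = true ↔ y.isLeft = true) at e1
    change _ ↔ (z.isLeft = true ↔ y.isLeft = true) at e2
    rw [e1] at e2
    apply this
    rw [Bool.eq_iff_iff]
    tauto
  omega

/-- Projection is unique: an element at distance at most `5` from `x` determines the neighbour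
of `x` that is closest to it. -/
theorem proj_unique {x y z z' : P ⊕ L} (hz : Γ.incidenceGraph.Adj x z) (hz' : Γ.incidenceGraph.Adj x z')
    (h5 : Γ.incidenceGraph.dist x y ≤ 5) (hd : Γ.incidenceGraph.dist x y = Γ.incidenceGraph.dist z y + 1)
    (hd' : Γ.incidenceGraph.dist x y = Γ.incidenceGraph.dist z' y + 1) : z = z' := by
  by_contra hne
  obtain ⟨p, hp⟩ := hΓ.connected.exists_walk_length_eq_dist z y
  obtain ⟨q, hq⟩ := hΓ.connected.exists_walk_length_eq_dist z' y
  have hp' : (SimpleGraph.Walk.cons hz p).IsPath :=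
    SimpleGraph.Walk.isPath_of_length_eq_dist _ (by simp [hp, hd])
  have hq' : (SimpleGraph.Walk.cons hz' q).IsPath :=
    SimpleGraph.Walk.isPath_of_length_eq_dist _ (by simp [hq, hd'])
  have hne' : SimpleGraph.Walk.cons hz p ≠ SimpleGraph.Walk.cons hz' q := by
    intro h
    simp only [SimpleGraph.Walk.cons.injEq] at h
    exact hne h.1
  -- Two different geodesics from `x` to `y` contain a cycle of length at most 5 + 5 < 12.
  obtain ⟨w, -, -, c, hc, hlen⟩ := hp'.exists_isCycle_length_le_add_of_ne hq' hne'
  have := hΓ.twelve_le_length_of_isCycle hc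
  simp only [SimpleGraph.Walk.length_cons] at hlen
  omega

/-- Only the projection is closer to `y`; every other neighbour is one step farther away. This is
what makes paths without backtracking geodesic up to length 6. -/
theorem dist_step {x y z w : P ⊕ L} (hz : Γ.incidenceGraph.Adj x z) (hw : Γ.incidenceGraph.Adj x w)
    (hne : w ≠ z) (h5 : Γ.incidenceGraph.dist x y ≤ 5) (hd : Γ.incidenceGraph.dist x y = Γ.incidenceGraph.dist z y + 1) :
    Γ.incidenceGraph.dist w y = Γ.incidenceGraph.dist x y + 1 := by
  rcases hΓ.dist_of_adj hw y with h | h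
  · exact h
  · exact absurd (hΓ.proj_unique hw hz h5 h hd) hne

theorem exists_proj {x y : P ⊕ L} (hne : x ≠ y) :
    ∃ z, Γ.incidenceGraph.Adj x z ∧ Γ.incidenceGraph.dist x y = Γ.incidenceGraph.dist z y + 1 := by
  obtain ⟨p, hp⟩ := hΓ.connected.exists_walk_length_eq_dist x y
  cases p with
  | nil => exact absurd rfl hne
  | cons h q =>
    refine ⟨_, h, ?_⟩
    have := SimpleGraph.dist_le q
    simp only [SimpleGraph.Walk.length_cons] at hp
    rcases hΓ.dist_of_adj h y with h1 | h1 <;> omega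

theorem dist_eq_five {x y z : P ⊕ L} (h : Γ.incidenceGraph.Adj x z) (h6 : Γ.incidenceGraph.dist x y = 6) :
    Γ.incidenceGraph.dist z y = 5 := by
  have := hΓ.dist_le_six z y
  rcases hΓ.dist_of_adj h y with h1 | h1 <;> omega

/-- A closed circuit of length `12` that does not backtrack: successive distances. -/
theorem dist_circuit {A : ZMod 12 → P ⊕ L} (hadj : ∀ i, Γ.incidenceGraph.Adj (A i) (A (i + 1)))
    (hne : ∀ i, A (i + 2) ≠ A i) (i : ZMod 12) (k : ℕ) (hk : k ≤ 6) :
    Γ.incidenceGraph.dist (A i) (A (i + k)) = k := by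
  -- The induction carries two consecutive distances, because `dist_step` has to know which
  -- neighbour is the projection.
  suffices ∀ k : ℕ, k ≤ 5 → Γ.incidenceGraph.dist (A i) (A (i + k)) = k ∧
      Γ.incidenceGraph.dist (A i) (A (i + (k + 1 : ℕ))) = k + 1 by
    rcases k with _ | k
    · exact (this 0 (by omega)).1
    · exact (this k (by omega)).2
  intro k hk
  induction k with
  | zero =>
    refine ⟨by simp, ?_⟩
    simpa using SimpleGraph.dist_eq_one_iff_adj.2 (hadj i)
  | succ k ih =>
    obtain ⟨h1, h2⟩ := ih (by omega)
    have e1 := hadj (i + k)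
    have e2 := hadj (i + k + 1)
    have e3 := hne (i + k)
    have c1 : i + ((k + 1 : ℕ) : ZMod 12) = i + k + 1 := by push_cast; ring
    have c2 : i + ((k + 1 + 1 : ℕ) : ZMod 12) = i + k + 2 := by push_cast; ring
    rw [c1] at h2
    rw [c1, c2]
    refine ⟨h2, ?_⟩
    rw [show i + (k : ZMod 12) + 1 + 1 = i + k + 2 by ring] at e2
    rw [SimpleGraph.dist_comm] at h1 h2 ⊢
    have := hΓ.dist_step e1.symm e2 e3 (y := A i) (by omega) (by omega)
    omega

/-- Of the two arcs between a pair of indices one has length k ≤ 6, and `dist_circuit` turns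
equality of the entries into k = 0. -/
theorem isApartment_of_circuit {A : ZMod 12 → P ⊕ L}
    (hadj : ∀ i, Γ.incidenceGraph.Adj (A i) (A (i + 1))) (hne : ∀ i, A (i + 2) ≠ A i) :
    Γ.IsApartment A := by
  refine ⟨fun i j hij => ?_, hadj⟩
  have key := hΓ.dist_circuit hadj hne
  have h1 := key i (j - i).val
  have h2 := key j (i - j).val
  simp only [ZMod.natCast_val, ZMod.cast_id', id_eq, add_sub_cancel] at h1 h2
  rw [hij, SimpleGraph.dist_self] at h1 h2
  revert h1 h2
  clear hij hadj hne key
  revert i j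
  decide

end IsGeneralisedHexagon

namespace IsApartment

variable {A B : ZMod 12 → P ⊕ L}

theorem ne_add_two (hA : Γ.IsApartment A) (i : ZMod 12) : A (i + 2) ≠ A i := by
  intro h
  have := hA.1 h
  revert this
  clear h
  revert i
  decide

theorem dist_add (hA : Γ.IsApartment A) (hΓ : Γ.IsGeneralisedHexagon) (i : ZMod 12) (k : ℕ)
    (hk : k ≤ 6) : Γ.incidenceGraph.dist (A i) (A (i + k)) = k :=
  hΓ.dist_circuit hA.2 hA.ne_add_two i k hk

theorem dist_eq (hA : Γ.IsApartment A) (hΓ : Γ.IsGeneralisedHexagon) (i j : ZMod 12) :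
    Γ.incidenceGraph.dist (A i) (A j) = min (j - i).val (i - j).val := by
  have h1 := hA.dist_add hΓ i (j - i).val
  have h2 := hA.dist_add hΓ j (i - j).val
  simp only [ZMod.natCast_val, ZMod.cast_id', id_eq, add_sub_cancel] at h1 h2
  rw [SimpleGraph.dist_comm] at h2
  have h3 : ∀ i j : ZMod 12, ((j - i).val ≤ 6 ∧ (j - i).val ≤ (i - j).val) ∨
    ((i - j).val ≤ 6 ∧ (i - j).val ≤ (j - i).val) := by decide
  rcases h3 i j with h | h
  · rw [h1 h.1, min_eq_left h.2]
  · rw [h2 h.1, min_eq_right h.2]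

theorem shift (hA : Γ.IsApartment A) (k : ZMod 12) : Γ.IsApartment fun i => A (i + k) := by
  refine ⟨fun i j h => add_right_cancel (hA.1 h), fun i => ?_⟩
  have := hA.2 (i + k)
  rwa [show i + k + 1 = i + 1 + k by ring] at this

theorem reflect (hA : Γ.IsApartment A) (k : ZMod 12) : Γ.IsApartment fun i => A (k - i) := by
  refine ⟨fun i j h => sub_right_injective (hA.1 h), fun i => ?_⟩
  have := hA.2 (k - (i + 1))
  rw [show k - (i + 1) + 1 = k - i by ring] at this
  exact this.symm

/-- Two apartments that share two elements at distance at most `5` share the path joining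
them. -/
theorem eq_between (hA : Γ.IsApartment A) (hB : Γ.IsApartment B) (hΓ : Γ.IsGeneralisedHexagon)
    {i : ZMod 12} {n : ℕ} (hn : n ≤ 5) (h0 : A i = B i) (h1 : A (i + n) = B (i + n)) :
    ∀ k ≤ n, A (i + k) = B (i + k) := by
  induction n generalizing i with
  | zero =>
    intro k hk
    obtain rfl : k = 0 := by omega
    simpa using h0
  | succ n ih =>
    have c : i + ((n + 1 : ℕ) : ZMod 12) = i + 1 + n := by push_cast; ring
    have a0 := hA.dist_add hΓ i (n + 1) (by omega)
    have b0 := hB.dist_add hΓ i (n + 1) (by omega)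
    have a1 := hA.dist_add hΓ (i + 1) n (by omega)
    have b1 := hB.dist_add hΓ (i + 1) n (by omega)
    have hB2 := hB.2 i
    rw [c] at a0 b0 h1
    rw [← h0, ← h1] at b0
    rw [← h1] at b1
    rw [← h0] at hB2
    have e : A (i + 1) = B (i + 1) :=
      hΓ.proj_unique (y := A (i + 1 + n)) (hA.2 i) hB2 (by omega) (by omega) (by omega)
    intro k hk
    rcases k with _ | k
    · simpa using h0
    · have := ih (by omega) e h1 k (by omega)
      rwa [show i + ((k + 1 : ℕ) : ZMod 12) = i + 1 + k by push_cast; ring]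

end IsApartment

end PointLineGeometry

/-! ### Collineations acting on the incidence graph, and extension of paths to apartments. -/

namespace PointLineGeometry

variable {P : Type u} {L : Type v} {Γ : PointLineGeometry P L}

theorem smul_adj (g : Γ.Collineation) {x y : P ⊕ L} :
    Γ.incidenceGraph.Adj (g • x) (g • y) ↔ Γ.incidenceGraph.Adj x y := by
  rcases x with p | l <;> rcases y with q | m
  · exact Iff.rfl
  · exact g.2 p m
  · exact g.2 q l
  · exact Iff.rfl

theorem isLeft_smul (g : Γ.Collineation) (x : P ⊕ L) : (g • x).isLeft = x.isLeft := by
  rcases x with p | l <;> rfl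

theorem collineation_ext {g h : Γ.Collineation} (H : ∀ x : P ⊕ L, g • x = h • x) : g = h := by
  apply Subtype.ext
  apply Prod.ext
  · ext p
    exact Sum.inl_injective (H (.inl p))
  · ext l
    exact Sum.inr_injective (H (.inr l))

/-- A collineation as a homomorphism of the incidence graph. -/
def Collineation.toHom (g : Γ.Collineation) : Γ.incidenceGraph →g Γ.incidenceGraph where
  toFun x := g • x
  map_rel' h := (smul_adj g).2 h

theorem smul_dist (hΓ : Γ.IsGeneralisedHexagon) (g : Γ.Collineation) (x y : P ⊕ L) :
    Γ.incidenceGraph.dist (g • x) (g • y) = Γ.incidenceGraph.dist x y := by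
  have key : ∀ (g : Γ.Collineation) (x y : P ⊕ L),
      Γ.incidenceGraph.dist (g • x) (g • y) ≤ Γ.incidenceGraph.dist x y := by
    intro g x y
    obtain ⟨p, hp⟩ := hΓ.connected.exists_walk_length_eq_dist x y
    rw [← hp, ← SimpleGraph.Walk.length_map (Collineation.toHom g) p]
    exact SimpleGraph.dist_le _
  refine le_antisymm (key g x y) ?_
  simpa using key g⁻¹ (g • x) (g • y)

theorem IsApartment.smul {A : ZMod 12 → P ⊕ L} (hA : Γ.IsApartment A) (g : Γ.Collineation) :
    Γ.IsApartment fun i => g • A i :=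
  ⟨fun _ _ h => hA.1 (smul_left_cancel g h), fun i => (smul_adj g).2 (hA.2 i)⟩

namespace IsGeneralisedHexagon

variable (hΓ : Γ.IsGeneralisedHexagon)
include hΓ

theorem dist_path {c : ℕ → P ⊕ L} {N : ℕ}
    (hadj : ∀ n < N, Γ.incidenceGraph.Adj (c n) (c (n + 1)))
    (hne : ∀ n, n + 2 ≤ N → c (n + 2) ≠ c n) (i k : ℕ) (hN : i + k ≤ N) (hk : k ≤ 6) :
    Γ.incidenceGraph.dist (c (i + k)) (c i) = k := by
  induction k using Nat.strong_induction_on with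
  | _ k ih =>
    rcases k with _ | _ | k
    · simp
    · exact SimpleGraph.dist_eq_one_iff_adj.2 (hadj i (by omega)).symm
    · have h1 := ih k (by omega) (by omega) (by omega)
      have h2 := ih (k + 1) (by omega) (by omega) (by omega)
      have e1 := hadj (i + k) (by omega)
      have e2 := hadj (i + k + 1) (by omega)
      have e3 := hne (i + k) (by omega)
      have := hΓ.dist_step e1.symm e2 e3 (y := c i) (by rw [← add_assoc] at h2; omega)
        (by rw [← add_assoc] at h2; omega)
      rw [← add_assoc] at h2
      change Γ.incidenceGraph.dist (c (i + k + 1 + 1)) (c i) = k + 2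
      omega

/-- The end `c 7` is at distance 5 from `c 0`, so a geodesic back to `c 0` closes the path to a
circuit of length 12. -/
theorem exists_isApartment_of_path {c : ℕ → P ⊕ L}
    (hadj : ∀ n < 7, Γ.incidenceGraph.Adj (c n) (c (n + 1)))
    (hne : ∀ n, n + 2 ≤ 7 → c (n + 2) ≠ c n) :
    ∃ A : ZMod 12 → P ⊕ L, Γ.IsApartment A ∧ ∀ n : ℕ, n ≤ 7 → A n = c n := by
  have h6 := hΓ.dist_path hadj hne 0 6 (by omega) le_rfl
  have h16 := hΓ.dist_path hadj hne 1 6 (by omega) le_rfl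
  have h7 := hΓ.dist_eq_five (hadj 6 (by omega)) h6
  norm_num at h6 h7 h16
  have pr : ∀ {x : P ⊕ L} {n : ℕ}, Γ.incidenceGraph.dist x (c 0) = n + 1 →
      ∃ z, Γ.incidenceGraph.Adj x z ∧ Γ.incidenceGraph.dist z (c 0) = n := by
    intro x n hx
    have hne : x ≠ c 0 := by
      rintro rfl
      simp at hx
    obtain ⟨z, hz, hd⟩ := hΓ.exists_proj hne
    exact ⟨z, hz, by omega⟩
  obtain ⟨e8, a8, d8⟩ := pr h7
  obtain ⟨e9, a9, d9⟩ := pr d8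
  obtain ⟨e10, a10, d10⟩ := pr d9
  obtain ⟨e11, a11, d11⟩ := pr d10
  have a0 := SimpleGraph.dist_eq_one_iff_adj.1 d11
  have ne : ∀ {x y z : P ⊕ L}, Γ.incidenceGraph.dist x z ≠ Γ.incidenceGraph.dist y z → x ≠ y := by
    rintro x y z h rfl
    exact h rfl
  have f8 := hΓ.dist_of_adj a8 (c 7)
  have f9 := hΓ.dist_of_adj a9 (c 7)
  have f10 := hΓ.dist_of_adj a10 (c 7)
  have f11 := hΓ.dist_of_adj a11 (c 7)
  rw [SimpleGraph.dist_self] at f8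
  refine ⟨![c 0, c 1, c 2, c 3, c 4, c 5, c 6, c 7, e8, e9, e10, e11],
    hΓ.isApartment_of_circuit ?_ ?_, ?_⟩
  · intro i
    fin_cases i
    exacts [hadj 0 (by omega), hadj 1 (by omega), hadj 2 (by omega), hadj 3 (by omega),
      hadj 4 (by omega), hadj 5 (by omega), hadj 6 (by omega), a8, a9, a10, a11, a0]
  · intro i
    have g8 : e8 ≠ c 6 := ne (z := c 0) (by omega)
    have g9 : e9 ≠ c 7 := ne (z := c 0) (by omega)
    have g10 : e10 ≠ e8 := ne (z := c 0) (by omega)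
    have g11 : e11 ≠ e9 := ne (z := c 0) (by omega)
    have g0 : c 0 ≠ e10 := ne (z := c 0) (by rw [SimpleGraph.dist_self]; omega)
    -- Here the distance to `c 0` does not separate the two; `c 1` is opposite `c 7`, whereas `e11`
    -- is within distance 4 of it.
    have g1 : c 1 ≠ e11 := ne (z := c 7) (by
      rw [SimpleGraph.dist_comm, h16]; omega)
    fin_cases i
    exacts [hne 0 (by omega), hne 1 (by omega), hne 2 (by omega), hne 3 (by omega),
      hne 4 (by omega), hne 5 (by omega), g8, g9, g10, g11, g0, g1]
  · intro n hn
    interval_cases n <;> rfl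

/-- Bending an apartment at one end of a root. -/
theorem exists_isApartment_bend {A : ZMod 12 → P ⊕ L} (hA : Γ.IsApartment A) (i : ZMod 12)
    {x : P ⊕ L} (hx : Γ.incidenceGraph.Adj (A i) x) (hne : x ≠ A (i + 1)) :
    ∃ B : ZMod 12 → P ⊕ L, Γ.IsApartment B ∧ B (i - 1) = x ∧ ∀ k : ℕ, k ≤ 6 →
      B (i + k) = A (i + k) := by
  obtain ⟨B, hB, h⟩ := hΓ.exists_isApartment_of_path
    (c := fun n => if n = 0 then x else A (i - 1 + n)) (by
      intro n _
      rcases n with _ | n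
      · simpa using hx.symm
      · have := hA.2 (i - 1 + ((n + 1 : ℕ) : ZMod 12))
        rw [add_assoc, ← Nat.cast_succ] at this
        exact this) (by
      intro n _
      rcases n with _ | n
      · have e : i - 1 + 2 = i + 1 := by ring
        simpa [e] using hne.symm
      · have := hA.ne_add_two (i - 1 + ((n + 1 : ℕ) : ZMod 12))
        rw [show i - 1 + ((n + 1 : ℕ) : ZMod 12) + 2 = i - 1 + ((n + 1 + 2 : ℕ) : ZMod 12) by
          push_cast; ring] at this
        exact this)
  refine ⟨fun j => B (j + (1 - i)), hB.shift _, ?_, ?_⟩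
  · simpa using h 0 (by omega)
  · intro k hk
    have := h (k + 1) (by omega)
    simp only [Nat.add_eq_zero_iff, one_ne_zero, and_false, if_false] at this
    push_cast at this
    rw [show i - 1 + ((k : ZMod 12) + 1) = i + k by ring] at this
    rw [← this]
    ring_nf

end IsGeneralisedHexagon

/-! ### Rigidity -/

/-- All neighbours of `x` are fixed by `g`. -/
def FixesNeighbours (g : Γ.Collineation) (x : P ⊕ L) : Prop :=
  ∀ y, Γ.incidenceGraph.Adj x y → g • y = y

theorem smul_proj (hΓ : Γ.IsGeneralisedHexagon) {g : Γ.Collineation} {x y z : P ⊕ L}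
    (hx : g • x = x) (hy : g • y = y) (hz : Γ.incidenceGraph.Adj x z)
    (h5 : Γ.incidenceGraph.dist x y ≤ 5)
    (hd : Γ.incidenceGraph.dist x y = Γ.incidenceGraph.dist z y + 1) : g • z = z := by
  refine hΓ.proj_unique (y := y) ?_ hz h5 ?_ hd
  · have := (smul_adj g).2 hz
    rwa [hx] at this
  · rw [hd, ← smul_dist hΓ g z y, hy]

/-- Each neighbour of `y` is the projection onto `y` of some neighbour of the opposite element `x`,
and projection commutes with `g`. -/
theorem FixesNeighbours.of_opposite (hΓ : Γ.IsGeneralisedHexagon) {g : Γ.Collineation}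
    {x y : P ⊕ L} (hx : FixesNeighbours g x) (hy : g • y = y)
    (h6 : Γ.incidenceGraph.dist x y = 6) : FixesNeighbours g y := by
  intro z hz
  have h5 : Γ.incidenceGraph.dist z x = 5 :=
    hΓ.dist_eq_five hz (by rwa [SimpleGraph.dist_comm])
  obtain ⟨w, hw, hd⟩ := hΓ.exists_proj (x := x) (y := z) (by
    rintro rfl
    simp at h5)
  have h5' := hΓ.dist_eq_five hw h6
  rw [SimpleGraph.dist_comm] at h5' h5
  rw [SimpleGraph.dist_comm (u := w)] at hd
  exact smul_proj hΓ hy (hx w hw) hz (by omega) (by omega)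

theorem IsApartment.smul_eq_between {A : ZMod 12 → P ⊕ L} (hA : Γ.IsApartment A)
    (hΓ : Γ.IsGeneralisedHexagon) {g : Γ.Collineation} {i : ZMod 12} {n : ℕ} (hn : n ≤ 5)
    (h0 : g • A i = A i) (h1 : g • A (i + n) = A (i + n)) :
    ∀ k ≤ n, g • A (i + k) = A (i + k) :=
  (hA.smul g).eq_between hA hΓ hn h0 h1

theorem forall_zmod12 {p : ZMod 12 → Prop} (i : ZMod 12) (h : ∀ k : ℕ, k < 12 → p (i + k)) :
    ∀ j, p j := by
  intro j
  have := h (j - i).val (ZMod.val_lt _)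
  simpa using this

theorem exists_mem_ne_ne {α : Type*} {s : Set α} (hs : 3 ≤ s.encard) (a b : α) :
    ∃ c ∈ s, c ≠ a ∧ c ≠ b := by
  by_contra! hcon
  have hsub : s ⊆ {a, b} := fun c hc => by
    by_cases h : c = a
    · exact Or.inl h
    · exact Or.inr (hcon c hc h)
  have h1 := hs.trans (Set.encard_le_encard hsub)
  have h2 := h1.trans (Set.encard_insert_le {b} a)
  rw [Set.encard_singleton] at h2
  exact absurd h2 (by decide)

theorem IsThick.exists_adj_ne_ne (ht : Γ.IsThick) (x y y' : P ⊕ L) :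
    ∃ z, Γ.incidenceGraph.Adj x z ∧ z ≠ y ∧ z ≠ y' := by
  refine exists_mem_ne_ne (s := {z | Γ.incidenceGraph.Adj x z}) ?_ y y'
  rcases x with p | l
  · rw [show {z | Γ.incidenceGraph.Adj (.inl p) z} = Sum.inr '' {l : L | Γ.inc p l} from ?_,
      Sum.inr_injective.encard_image]
    · exact ht.2 p
    · ext (q | m)
      · simp [incidenceGraph]
      · simp [incidenceGraph]
  · rw [show {z | Γ.incidenceGraph.Adj (.inr l) z} = Sum.inl '' {p : P | Γ.inc p l} from ?_,
      Sum.inl_injective.encard_image]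
    · exact ht.1 l
    · ext (q | m)
      · simp [incidenceGraph]
      · simp [incidenceGraph]

/-- The element opposite `A i` in `A` is not available yet, so the apartment is bent at `A (i + 1)`
towards a third neighbour `x`. In the bent apartment `B`, the element `B (i + 8)` is fixed, being on
the path from `A (i + 7)` to `x`. It is opposite both `A (i + 2)` and `A i`, so fixing of neighbours
passes from the first to the second through it. -/
theorem fixesNeighbours_of_root_end (hΓ : Γ.IsGeneralisedHexagon) (ht : Γ.IsThick)
    {A : ZMod 12 → P ⊕ L} (hA : Γ.IsApartment A) {g : Γ.Collineation}
    (hg : ∀ j, g • A j = A j) (i : ZMod 12)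
    (h : ∀ k : ℕ, 1 ≤ k → k ≤ 5 → FixesNeighbours g (A (i + k))) :
    FixesNeighbours g (A i) := by
  obtain ⟨x, hx, hx1, hx2⟩ := ht.exists_adj_ne_ne (A (i + 1)) (A i) (A (i + 1 + 1))
  obtain ⟨B, hB, hBx, hBA⟩ := hΓ.exists_isApartment_bend hA (i + 1) hx hx2
  rw [add_sub_cancel_right] at hBx
  have hx0 : g • x = x := h 1 le_rfl (by omega) x (by simpa using hx)
  have e7 : B (i + 7) = A (i + 7) := by
    have := hBA 6 le_rfl
    norm_num [add_assoc] at this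
    exact this
  have e2 : B (i + 2) = A (i + 2) := by
    have := hBA 1 (by omega)
    norm_num [add_assoc] at this
    exact this
  have e1 : B (i + 1) = A (i + 1) := by simpa using hBA 0 (by omega)
  have hfix := hB.smul_eq_between hΓ (g := g) (i := i + 7) (n := 5) le_rfl (by rw [e7, hg]) (by
    rw [add_assoc, show (7 : ZMod 12) + (5 : ℕ) = 0 by decide, add_zero, hBx, hx0]) 1 (by omega)
  rw [add_assoc, show (7 : ZMod 12) + (1 : ℕ) = 8 by decide] at hfix
  have hS : FixesNeighbours g (B (i + 8)) := by
    refine FixesNeighbours.of_opposite hΓ (x := B (i + 2)) ?_ hfix ?_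
    · rw [e2]
      exact h 2 (by omega) (by omega)
    · rw [hB.dist_eq hΓ]
      ring_nf
      decide
  refine FixesNeighbours.of_opposite hΓ hS (hg i) ?_
  rw [SimpleGraph.dist_comm]
  have d1 : Γ.incidenceGraph.dist (A (i + 1)) (B (i + 8)) = 5 := by
    rw [← e1, hB.dist_eq hΓ]
    ring_nf
    decide
  have d0 : Γ.incidenceGraph.dist x (B (i + 8)) = 4 := by
    rw [← hBx, hB.dist_eq hΓ]
    ring_nf
    decide
  have := hΓ.dist_step hx (hA.2 i).symm hx1.symm (y := B (i + 8)) (by omega) (by omega)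
  omega

theorem fixesNeighbours_of_root (hΓ : Γ.IsGeneralisedHexagon) (ht : Γ.IsThick)
    {A : ZMod 12 → P ⊕ L} (hA : Γ.IsApartment A) {g : Γ.Collineation}
    (hg : ∀ j, g • A j = A j) (i : ZMod 12)
    (h : ∀ k : ℕ, 1 ≤ k → k ≤ 5 → FixesNeighbours g (A (i + k))) :
    ∀ j, FixesNeighbours g (A j) := by
  have h0 := fixesNeighbours_of_root_end hΓ ht hA hg i h
  have h6 : FixesNeighbours g (A (i + 6)) := by
    have := fixesNeighbours_of_root_end hΓ ht (hA.reflect (2 * i + 6)) (fun j => hg _) i (by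
      intro k hk1 hk5
      have := h (6 - k) (by omega) (by omega)
      rw [Nat.cast_sub (by omega)] at this
      convert this using 2
      push_cast
      ring)
    convert this using 2
    ring
  have hlow : ∀ k : ℕ, k ≤ 6 → FixesNeighbours g (A (i + k)) := by
    intro k hk
    rcases Nat.eq_zero_or_pos k with rfl | hk0
    · simpa using h0
    · rcases hk.eq_or_lt with rfl | hk6
      · exact_mod_cast h6
      · exact h k hk0 (by omega)
  refine forall_zmod12 i fun k hk => ?_
  by_cases hk6 : k ≤ 6
  · exact hlow k hk6
  · refine (hlow (k - 6) (by omega)).of_opposite hΓ (hg _) ?_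
    have := hA.dist_add hΓ (i + (k - 6 : ℕ)) 6 le_rfl
    rwa [add_assoc, ← Nat.cast_add, Nat.sub_add_cancel (by omega)] at this

/-- A collineation that fixes an apartment and all elements incident with one of the interior
elements of one of its roots is trivial. -/
theorem eq_one_of_root (hΓ : Γ.IsGeneralisedHexagon) (ht : Γ.IsThick)
    {A : ZMod 12 → P ⊕ L} (hA : Γ.IsApartment A) {g : Γ.Collineation}
    (hg : ∀ j, g • A j = A j) (i : ZMod 12)
    (h : ∀ k : ℕ, 1 ≤ k → k ≤ 5 → FixesNeighbours g (A (i + k))) : g = 1 := by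
  -- Having all neighbours fixed spreads along a path from `A 0`: each step bends the current
  -- apartment towards the next element, and the root shared by the two apartments makes the new one
  -- inherit the property.
  have key : ∀ x : P ⊕ L, ∃ B : ZMod 12 → P ⊕ L, Γ.IsApartment B ∧ (∀ j, g • B j = B j) ∧
      (∀ j, FixesNeighbours g (B j)) ∧ x ∈ Set.range B := by
    intro x
    obtain ⟨y, hy⟩ : ∃ y, y = A 0 := ⟨_, rfl⟩
    obtain ⟨p⟩ := hΓ.connected.preconnected x y
    induction p with
    | nil => exact ⟨A, hA, hg, fixesNeighbours_of_root hΓ ht hA hg i h, 0, hy.symm⟩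
    | cons hxy _ ih =>
      obtain ⟨B, hB, hgB, hSB, j, rfl⟩ := ih hy
      rename_i x _ _
      by_cases hx : x = B (j + 1)
      · exact ⟨B, hB, hgB, hSB, j + 1, hx.symm⟩
      · obtain ⟨C, hC, hCx, hCB⟩ := hΓ.exists_isApartment_bend hB j hxy.symm hx
        have hgx : g • x = x := hSB j x hxy.symm
        have h6 : g • C (j + 6) = C (j + 6) := by
          have := hCB 6 le_rfl
          norm_num at this
          rw [this, hgB]
        have hgC : ∀ j, g • C j = C j := by
          refine forall_zmod12 j fun k hk => ?_
          by_cases hk6 : k ≤ 6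
          · rw [hCB k hk6, hgB]
          · have := hC.smul_eq_between hΓ (g := g) (i := j + 6) (n := 5) le_rfl h6 (by
              rw [show j + 6 + ((5 : ℕ) : ZMod 12) = j - 1 by
                rw [add_assoc, sub_eq_add_neg]; congr 1, hCx, hgx]) (k - 6) (by omega)
            rwa [Nat.cast_sub (by omega), show j + 6 + ((k : ZMod 12) - (6 : ℕ)) = j + k by
              push_cast; ring] at this
        refine ⟨C, hC, hgC, fixesNeighbours_of_root hΓ ht hC hgC j ?_, j - 1, hCx⟩
        intro k _ hk5
        rw [hCB k (by omega)]
        exact hSB _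
  refine collineation_ext fun x => ?_
  obtain ⟨B, -, hgB, -, j, rfl⟩ := key x
  rw [hgB, one_smul]

end PointLineGeometry

namespace PointLineGeometry

variable {P : Type u} {L : Type v} {Γ : PointLineGeometry P L}

/-! ### Root groups -/

section rootGroup

variable {A : ZMod 12 → P ⊕ L} {i : ZMod 12} {g : Γ.Collineation}

theorem mem_rootGroup : g ∈ Γ.rootGroup A i ↔
    ∀ k : ℕ, 1 ≤ k → k ≤ 5 → FixesNeighbours g (A (i + k)) := by
  rw [rootGroup, mem_fixingSubgroup_iff]
  constructor
  · intro h k h1 h5 y hy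
    exact h y ⟨k, h1, h5, hy⟩
  · rintro h y ⟨k, h1, h5, hy⟩
    exact h k h1 h5 y hy

theorem smul_of_mem_rootGroup_of_adj (hg : g ∈ Γ.rootGroup A i) (j : ZMod 12)
    (hj : 1 ≤ (j - i).val ∧ (j - i).val ≤ 5) {y : P ⊕ L}
    (hy : Γ.incidenceGraph.Adj (A j) y) : g • y = y := by
  have := mem_rootGroup.1 hg (j - i).val hj.1 hj.2 y
  simp only [ZMod.natCast_val, ZMod.cast_id', id_eq, add_sub_cancel] at this
  exact this hy

theorem smul_of_mem_rootGroup (hA : Γ.IsApartment A) (hg : g ∈ Γ.rootGroup A i) (j : ZMod 12)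
    (hj : (j - i).val ≤ 6) : g • A j = A j := by
  have h : ∀ i j : ZMod 12, (j - i).val ≤ 6 → (1 ≤ (j + 1 - i).val ∧ (j + 1 - i).val ≤ 5) ∨
      (1 ≤ (j - 1 - i).val ∧ (j - 1 - i).val ≤ 5) := by decide
  rcases h i j hj with h | h
  · exact smul_of_mem_rootGroup_of_adj hg _ h (hA.2 j).symm
  · have := hA.2 (j - 1)
    rw [sub_add_cancel] at this
    exact smul_of_mem_rootGroup_of_adj hg _ h this

theorem eq_one_of_mem_rootGroup (hΓ : Γ.IsGeneralisedHexagon) (ht : Γ.IsThick)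
    (hA : Γ.IsApartment A) (hg : g ∈ Γ.rootGroup A i) (h : g • A (i - 1) = A (i - 1)) :
    g = 1 := by
  refine eq_one_of_root hΓ ht hA (forall_zmod12 i fun k hk => ?_) i (mem_rootGroup.1 hg)
  by_cases hk6 : k ≤ 6
  · refine smul_of_mem_rootGroup hA hg _ ?_
    rw [add_sub_cancel_left, ZMod.val_natCast]
    omega
  · have h6 : g • A (i + 6) = A (i + 6) := smul_of_mem_rootGroup hA hg _ (by
      rw [add_sub_cancel_left]; decide)
    have := hA.smul_eq_between hΓ (g := g) (i := i + 6) (n := 5) le_rfl h6 (by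
      rw [show i + 6 + ((5 : ℕ) : ZMod 12) = i - 1 by
        rw [add_assoc, sub_eq_add_neg]; congr 1, h]) (k - 6) (by omega)
    rwa [Nat.cast_sub (by omega), show i + 6 + ((k : ZMod 12) - (6 : ℕ)) = i + k by
      push_cast; ring] at this

/-- Reading a root backwards does not change its interior. Statements about the initial end of a
root thereby also hold at its final end. -/
theorem rootGroup_reflect (A : ZMod 12 → P ⊕ L) (i : ZMod 12) :
    Γ.rootGroup (fun j => A (2 * i + 6 - j)) i = Γ.rootGroup A i := by
  have key : ∀ (A : ZMod 12 → P ⊕ L),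
      Γ.rootGroup A i ≤ Γ.rootGroup (fun j => A (2 * i + 6 - j)) i := by
    intro A g hg
    rw [mem_rootGroup] at hg ⊢
    intro k h1 h5
    have := hg (6 - k) (by omega) (by omega)
    rw [Nat.cast_sub (by omega)] at this
    convert this using 2
    push_cast
    ring
  refine le_antisymm ?_ (key A)
  have := key fun j => A (2 * i + 6 - j)
  simpa using this

theorem eq_one_of_mem_rootGroup' (hΓ : Γ.IsGeneralisedHexagon) (ht : Γ.IsThick)
    (hA : Γ.IsApartment A) (hg : g ∈ Γ.rootGroup A i) (h : g • A (i + 7) = A (i + 7)) :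
    g = 1 := by
  rw [← rootGroup_reflect] at hg
  refine eq_one_of_mem_rootGroup hΓ ht (hA.reflect (2 * i + 6)) hg ?_
  rwa [show 2 * i + 6 - (i - 1) = i + 7 by ring]

/-- Only the sets of interior elements are matched, not their order, so that `n` may also reverse
the root. -/
theorem conj_mem_rootGroup {B : ZMod 12 → P ⊕ L} {j : ZMod 12} {n : Γ.Collineation}
    (hg : g ∈ Γ.rootGroup A i)
    (h : ∀ k : ℕ, 1 ≤ k → k ≤ 5 → ∃ k' : ℕ, 1 ≤ k' ∧ k' ≤ 5 ∧ B (j + k) = n • A (i + k')) :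
    n * g * n⁻¹ ∈ Γ.rootGroup B j := by
  rw [mem_rootGroup] at hg ⊢
  intro k h1 h5 y hy
  obtain ⟨k', h1', h5', e⟩ := h k h1 h5
  rw [e] at hy
  have := hg k' h1' h5' (n⁻¹ • y) (by rw [← smul_adj n]; simpa using hy)
  rw [mul_smul, mul_smul, this, smul_inv_smul]

end rootGroup

/-! ### Transitivity of the collineation group. -/

namespace IsMoufangHexagon

variable (hΓ : Γ.IsMoufangHexagon) {A B : ZMod 12 → P ⊕ L}
include hΓ

theorem moufang' (hA : Γ.IsApartment A) (i : ZMod 12) {x y : P ⊕ L}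
    (hx : Γ.incidenceGraph.Adj (A (i + 6)) x) (hx' : x ≠ A (i + 5))
    (hy : Γ.incidenceGraph.Adj (A (i + 6)) y) (hy' : y ≠ A (i + 5)) :
    ∃ g ∈ Γ.rootGroup A i, g • x = y := by
  have h6 : 2 * i + 6 - i = i + 6 := by ring
  have h5 : 2 * i + 6 - (i + 1) = i + 5 := by ring
  have := hΓ.moufang _ (hA.reflect (2 * i + 6)) i x y (by rwa [h6]) (by rwa [h5])
    (by rwa [h6]) (by rwa [h5])
  rwa [rootGroup_reflect] at this

/-- The collineation group is transitive on the apartments through a flag. -/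
theorem exists_smul_eq_of_flag (hA : Γ.IsApartment A) (hB : Γ.IsApartment B)
    (h6 : A 6 = B 6) (h7 : A 7 = B 7) : ∃ g : Γ.Collineation, ∀ j, g • A j = B j := by
  -- The agreement grows by one element at a time: the root group whose root ends at the last agreed
  -- element fixes what has been achieved and moves the next element into place. From `A 13 = A 1`
  -- back to `A 6` the remaining path has length 5 and is forced.
  have key : ∀ n : ℕ, n ≤ 6 → ∃ g : Γ.Collineation, ∀ k : ℕ, k ≤ n + 1 →
      g • A (6 + k) = B (6 + k) := by
    intro n
    induction n with
    | zero =>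
      intro _
      refine ⟨1, fun k hk => ?_⟩
      interval_cases k
      · simpa using h6
      · norm_num
        exact h7
    | succ n ih =>
      intro hn
      obtain ⟨g, hg⟩ := ih (by omega)
      have hC := hA.smul g
      have e1 : (n + 1 : ZMod 12) + 6 = 6 + ((n + 1 : ℕ) : ZMod 12) := by push_cast; ring
      have e0 : (n + 1 : ZMod 12) + 5 = 6 + (n : ZMod 12) := by ring
      have e2 : 6 + ((n + 1 : ℕ) : ZMod 12) + 1 = 6 + ((n + 2 : ℕ) : ZMod 12) := by push_cast; ring
      have e2' : 6 + ((n : ℕ) : ZMod 12) + 2 = 6 + ((n + 2 : ℕ) : ZMod 12) := by push_cast; ring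
      have hx := hC.2 (6 + ((n + 1 : ℕ) : ZMod 12))
      have hx' := hC.ne_add_two (6 + n)
      have hy := hB.2 (6 + ((n + 1 : ℕ) : ZMod 12))
      have hy' := hB.ne_add_two (6 + n)
      rw [e2] at hx hy
      rw [e2'] at hx' hy'
      rw [← hg (n + 1) le_rfl] at hy
      rw [← hg n (by omega)] at hy'
      obtain ⟨u, hu, hxy⟩ := hΓ.moufang' hC (n + 1 : ZMod 12) (by rw [e1]; exact hx)
        (by rw [e0]; exact hx') (by rw [e1]; exact hy) (by rw [e0]; exact hy')
      refine ⟨u * g, fun k hk => ?_⟩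
      rw [mul_smul]
      rcases Nat.lt_or_ge k (n + 2) with hk' | hk'
      · rw [← hg k (by omega)]
        refine smul_of_mem_rootGroup hC hu (6 + k) ?_
        have : (6 + k - (n + 1) : ZMod 12) = ((5 + k - n : ℕ) : ZMod 12) := by
          rw [Nat.cast_sub (by omega)]
          push_cast
          ring
        rw [this, ZMod.val_natCast]
        omega
      · obtain rfl : k = n + 2 := by omega
        exact hxy
  obtain ⟨g, hg⟩ := key 6 le_rfl
  refine ⟨g, forall_zmod12 6 fun k hk => ?_⟩
  by_cases hk7 : k ≤ 7
  · exact hg k (by omega)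
  · have h0 := hg 7 le_rfl
    have h1 := hg 0 (by omega)
    have := (hA.smul g).eq_between hB hΓ.hexagon (i := 6 + (7 : ℕ)) (n := 5) le_rfl h0 (by
      rw [show (6 : ZMod 12) + (7 : ℕ) + (5 : ℕ) = 6 + (0 : ℕ) by decide]
      exact h1) (k - 7) (by omega)
    rwa [Nat.cast_sub (by omega), show (6 : ZMod 12) + (7 : ℕ) + ((k : ZMod 12) - (7 : ℕ)) = 6 + k
      by ring] at this

theorem exists_isApartment_of_adj {x y : P ⊕ L} (h : Γ.incidenceGraph.Adj x y) :
    ∃ A : ZMod 12 → P ⊕ L, Γ.IsApartment A ∧ A 0 = x ∧ A 1 = y := by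
  have ext : ∀ x y : P ⊕ L, ∃ z, Γ.incidenceGraph.Adj y z ∧ z ≠ x := fun x y => by
    obtain ⟨z, h1, h2, -⟩ := hΓ.thick.exists_adj_ne_ne y x x
    exact ⟨z, h1, h2⟩
  choose f hf1 hf2 using ext
  -- The successive edges of an infinite walk without backtracking that starts with the given edge.
  let c : ℕ → (P ⊕ L) × (P ⊕ L) := fun n => (fun p => (p.2, f p.1 p.2))^[n] (x, y)
  have hc : ∀ n, c (n + 1) = ((c n).2, f (c n).1 (c n).2) := fun n =>
    Function.iterate_succ_apply' _ _ _
  have hadj : ∀ n, Γ.incidenceGraph.Adj (c n).1 (c n).2 := by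
    intro n
    induction n with
    | zero => exact h
    | succ n ih => rw [hc]; exact hf1 _ _
  obtain ⟨A, hA, hAc⟩ := hΓ.hexagon.exists_isApartment_of_path (c := fun n => (c n).1)
    (fun n _ => by simpa [hc] using hadj n)
    (fun n _ => by simpa [hc] using hf2 _ _)
  refine ⟨A, hA, by simpa [c] using hAc 0 (by omega), ?_⟩
  have := hAc 1 (by omega)
  simpa [hc, c] using this

/-- A third neighbour `w` of `x` exists by thickness, and the root group of a root starting with `x,
w` can move `y` to `y'`. -/
theorem exists_smul_eq_of_adj {x y y' : P ⊕ L} (hy : Γ.incidenceGraph.Adj x y)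
    (hy' : Γ.incidenceGraph.Adj x y') : ∃ g : Γ.Collineation, g • x = x ∧ g • y = y' := by
  obtain ⟨w, hw, h1, h2⟩ := hΓ.thick.exists_adj_ne_ne x y y'
  obtain ⟨A, hA, h0, hA1⟩ := hΓ.exists_isApartment_of_adj hw
  obtain ⟨g, hg, e⟩ := hΓ.moufang A hA 0 y y' (by rwa [h0]) (by rw [zero_add, hA1]; exact h1.symm)
    (by rwa [h0]) (by rw [zero_add, hA1]; exact h2.symm)
  refine ⟨g, ?_, e⟩
  rw [← h0]
  exact smul_of_mem_rootGroup hA hg 0 (by decide)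

theorem exists_smul_eq_or {x₀ y₀ : P ⊕ L} (h : Γ.incidenceGraph.Adj x₀ y₀) (x : P ⊕ L) :
    ∃ g : Γ.Collineation, x = g • x₀ ∨ x = g • y₀ := by
  obtain ⟨p⟩ := hΓ.hexagon.connected.preconnected x x₀
  induction p with
  | nil => exact ⟨1, Or.inl (one_smul _ _).symm⟩
  | cons hxy _ ih =>
    rename_i x y _ _
    obtain ⟨g, hg⟩ := ih h
    have hxy' := (smul_adj g⁻¹).2 hxy.symm
    rcases hg with hg | hg
    · rw [hg, inv_smul_smul] at hxy'
      obtain ⟨k, -, hk⟩ := hΓ.exists_smul_eq_of_adj h hxy'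
      exact ⟨g * k, Or.inr (by rw [mul_smul, hk, smul_inv_smul])⟩
    · rw [hg, inv_smul_smul] at hxy'
      obtain ⟨k, -, hk⟩ := hΓ.exists_smul_eq_of_adj h.symm hxy'
      exact ⟨g * k, Or.inl (by rw [mul_smul, hk, smul_inv_smul])⟩

/-- The collineation group is transitive on the labelled apartments of a given type. -/
theorem exists_smul_eq (hA : Γ.IsApartment A) (hB : Γ.IsApartment B)
    (h : (A 7).isLeft = (B 7).isLeft) : ∃ g : Γ.Collineation, ∀ j, g • A j = B j := by
  have hA7 := (hA.2 6).symm
  have hB7 := (hB.2 6).symm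
  norm_num at hA7 hB7
  obtain ⟨g, hg⟩ := hΓ.exists_smul_eq_or hA7 (B 7)
  have hg' : B 7 = g • A 7 := by
    refine hg.resolve_right fun e => ?_
    have := isLeft_ne_of_adj hA7
    rw [h, e, isLeft_smul] at this
    exact this rfl
  have h6 := (smul_adj g).2 hA7
  rw [← hg'] at h6
  obtain ⟨k, hk7, hk6⟩ := hΓ.exists_smul_eq_of_adj h6 hB7
  obtain ⟨m, hm⟩ := hΓ.exists_smul_eq_of_flag (hA.smul (k * g)) hB
    (by rw [mul_smul, hk6]) (by rw [mul_smul, ← hg', hk7])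
  exact ⟨m * (k * g), fun j => by rw [mul_smul]; exact hm j⟩

end IsMoufangHexagon

end PointLineGeometry

namespace PointLineGeometry

variable {P : Type u} {L : Type v} {Γ : PointLineGeometry P L}

/-! ### Collineations fixing an ovoid pointwise -/

/-- `x` is a point outside the ovoid `O` and `N` is a line fixed by `g` that joins `x` to a point
of `O`. -/
def IsTangentFixed (Γ : PointLineGeometry P L) (O : Set P) (g : Γ.Collineation) (x N : P ⊕ L) :
    Prop :=
  ∃ o ∈ O, Γ.incidenceGraph.Adj N (.inl o) ∧ Γ.incidenceGraph.Adj N x ∧ x ≠ .inl o ∧ g • N = N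

/-- The point `y` is at distance 4 from `o`. Its nearest ovoid point `o'` is opposite `o`, so by
parity it is at distance exactly 2 from `y`. Then N, x, M, y, N', o' is a geodesic of length 5 with
fixed ends, hence fixed throughout, and N' is a fixed tangent for the next step. -/
theorem IsTangentFixed.step (hΓ : Γ.IsGeneralisedHexagon) {O : Set P} (hO : Γ.IsOvoid O)
    {g : Γ.Collineation} (hfix : ∀ p ∈ O, g • (Sum.inl p : P ⊕ L) = Sum.inl p) {x N M y : P ⊕ L}
    (h : IsTangentFixed Γ O g x N) (hM : Γ.incidenceGraph.Adj x M) (hMN : M ≠ N)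
    (hy : Γ.incidenceGraph.Adj M y) (hyx : y ≠ x) :
    g • x = x ∧ g • M = M ∧ g • y = y ∧ ∃ N', IsTangentFixed Γ O g y N' := by
  obtain ⟨o, ho, hNo, hNx, hxo, hgN⟩ := h
  have d1 : Γ.incidenceGraph.dist N (.inl o) = 1 := SimpleGraph.dist_eq_one_iff_adj.2 hNo
  have d2 := hΓ.dist_step hNo hNx hxo (y := .inl o) (by omega) (by simp [d1])
  have d3 := hΓ.dist_step hNx.symm hM hMN (y := .inl o) (by omega) (by omega)
  have d4 := hΓ.dist_step hM.symm hy hyx (y := .inl o) (by omega) (by omega)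
  obtain ⟨o', ho', hd⟩ := hO.2 y
  have hoo : o' ≠ o := by
    rintro rfl
    omega
  have d6 : Γ.incidenceGraph.dist (.inl o' : P ⊕ L) (.inl o) = 6 := hO.1 o' ho' o ho hoo
  have hyo : y ≠ .inl o' := by
    rintro rfl
    omega
  have tri := hΓ.connected.dist_triangle (u := (.inl o' : P ⊕ L)) (v := y) (w := .inl o)
  rw [SimpleGraph.dist_comm (v := y)] at tri
  have d2' : Γ.incidenceGraph.dist y (.inl o') = 2 := by
    have t1 := isLeft_ne_of_adj hNo
    have t2 := isLeft_ne_of_adj hNx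
    have t3 := isLeft_ne_of_adj hM
    have t4 := isLeft_ne_of_adj hy
    obtain ⟨p, hp⟩ := hΓ.connected.exists_walk_length_eq_dist y (.inl o')
    have := (Γ.typeColoring.even_length_iff_congr p).2 (by
      change y.isLeft = true ↔ true = true
      simp only [Sum.isLeft_inl] at t1
      cases hN : N.isLeft <;> cases hx : x.isLeft <;> cases hM : M.isLeft <;>
        cases hy : y.isLeft <;> simp_all)
    rw [hp] at this
    obtain ⟨k, hk⟩ := this
    omega
  obtain ⟨N', hyN', hdN'⟩ := hΓ.exists_proj hyo
  have dM : Γ.incidenceGraph.dist M (.inl o') ≠ 1 := by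
    intro h1
    have := hΓ.connected.dist_triangle (u := (.inl o' : P ⊕ L)) (v := M) (w := .inl o)
    rw [SimpleGraph.dist_comm (v := M)] at this
    omega
  have hMN' : M ≠ N' := by
    rintro rfl
    omega
  have e3 := hΓ.dist_step hyN' hy.symm hMN' (by omega) hdN'
  have e4 := hΓ.dist_step hy hM.symm hyx.symm (y := .inl o') (by omega) (by omega)
  have e5 := hΓ.dist_step hM hNx.symm hMN.symm (y := .inl o') (by omega) (by omega)
  have hgo := hfix o' ho'
  have gx := smul_proj hΓ hgN hgo hNx (by omega) (by omega)
  have gM := smul_proj hΓ gx hgo hM (by omega) (by omega)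
  have gy := smul_proj hΓ gM hgo hy (by omega) (by omega)
  have gN' := smul_proj hΓ gy hgo hyN' (by omega) (by omega)
  exact ⟨gx, gM, gy, N', o', ho', SimpleGraph.dist_eq_one_iff_adj.1 (by omega), hyN'.symm, hyo,
    gN'⟩

theorem IsTangentFixed.fixesNeighbours (hΓ : Γ.IsGeneralisedHexagon) (ht : Γ.IsThick) {O : Set P}
    (hO : Γ.IsOvoid O) {g : Γ.Collineation}
    (hfix : ∀ p ∈ O, g • (Sum.inl p : P ⊕ L) = Sum.inl p) {x N : P ⊕ L}
    (h : IsTangentFixed Γ O g x N) : FixesNeighbours g x := by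
  intro M hM
  by_cases hMN : M = N
  · obtain ⟨_, _, _, _, _, hgN⟩ := h
    rwa [hMN]
  · obtain ⟨y, hy, hyx, -⟩ := ht.exists_adj_ne_ne M x x
    exact (h.step hΓ hO hfix hM hMN hy hyx).2.1

theorem IsTangentFixed.fixesNeighbours' (hΓ : Γ.IsGeneralisedHexagon) (ht : Γ.IsThick) {O : Set P}
    (hO : Γ.IsOvoid O) {g : Γ.Collineation}
    (hfix : ∀ p ∈ O, g • (Sum.inl p : P ⊕ L) = Sum.inl p) {x N M : P ⊕ L}
    (h : IsTangentFixed Γ O g x N) (hM : Γ.incidenceGraph.Adj x M) (hMN : M ≠ N) :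
    FixesNeighbours g M := by
  intro y hy
  by_cases hyx : y = x
  · obtain ⟨y, hy, hyx', -⟩ := ht.exists_adj_ne_ne M x x
    rw [hyx]
    exact (h.step hΓ hO hfix hM hMN hy hyx').1
  · exact (h.step hΓ hO hfix hM hMN hy hyx).2.2.1

/-- A collineation that fixes every point of an ovoid and a line through one of these points is
trivial. -/
theorem eq_one_of_fixes_ovoid (hΓ : Γ.IsGeneralisedHexagon) (ht : Γ.IsThick) {O : Set P}
    (hO : Γ.IsOvoid O) {g : Γ.Collineation}
    (hfix : ∀ p ∈ O, g • (Sum.inl p : P ⊕ L) = Sum.inl p) {p : P} (hp : p ∈ O) {l : P ⊕ L}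
    (hl : Γ.incidenceGraph.Adj (.inl p) l) (hgl : g • l = l) : g = 1 := by
  obtain ⟨q, hq, hqp, -⟩ := ht.exists_adj_ne_ne l (.inl p) (.inl p)
  have T1 : IsTangentFixed Γ O g q l := ⟨p, hp, hl.symm, hq, hqp, hgl⟩
  obtain ⟨m₁, hm₁, hm₁l, -⟩ := ht.exists_adj_ne_ne q l l
  obtain ⟨r₁, hr₁, hr₁q, -⟩ := ht.exists_adj_ne_ne m₁ q q
  obtain ⟨fq, fm₁, fr₁, n₁, T2⟩ := T1.step hΓ hO hfix hm₁ hm₁l hr₁ hr₁q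
  -- The new line avoids `n₁` so that the tangent step applies again, and `m₁` so that the path does
  -- not backtrack. The path built this way has seven steps, and all neighbours of the five interior
  -- elements of its initial root are fixed.
  obtain ⟨m₂, hm₂, hm₂n, hm₂m⟩ := ht.exists_adj_ne_ne r₁ n₁ m₁
  obtain ⟨r₂, hr₂, hr₂r, -⟩ := ht.exists_adj_ne_ne m₂ r₁ r₁
  obtain ⟨-, fm₂, fr₂, n₂, T3⟩ := T2.step hΓ hO hfix hm₂ hm₂n hr₂ hr₂r
  obtain ⟨m₃, hm₃, hm₃n, hm₃m⟩ := ht.exists_adj_ne_ne r₂ n₂ m₂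
  obtain ⟨r₃, hr₃, hr₃r, -⟩ := ht.exists_adj_ne_ne m₃ r₂ r₂
  obtain ⟨-, fm₃, fr₃, -, -⟩ := T3.step hΓ hO hfix hm₃ hm₃n hr₃ hr₃r
  let c : ℕ → P ⊕ L := fun n => match n with
    | 0 => l | 1 => q | 2 => m₁ | 3 => r₁ | 4 => m₂ | 5 => r₂ | 6 => m₃ | _ => r₃
  obtain ⟨A, hA, hAc⟩ := hΓ.exists_isApartment_of_path (c := c)
    (by intro n hn; interval_cases n <;> assumption)
    (by
      intro n hn
      have : n ≤ 5 := by omega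
      interval_cases n <;> assumption)
  have hfixc : ∀ n : ℕ, n ≤ 7 → g • A n = A n := by
    intro n hn
    rw [hAc n hn]
    interval_cases n <;> assumption
  refine eq_one_of_root hΓ ht hA (forall_zmod12 0 fun k hk => ?_) 0 fun k h1 h5 => ?_
  · rw [zero_add]
    by_cases hk7 : k ≤ 7
    · exact hfixc k hk7
    · have h0 := hfixc 7 le_rfl
      have := hA.smul_eq_between hΓ (g := g) (i := (7 : ℕ)) (n := 5) le_rfl h0 (by
        rw [show ((7 : ℕ) : ZMod 12) + (5 : ℕ) = (0 : ℕ) by decide]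
        exact hfixc 0 (by omega)) (k - 7) (by omega)
      rwa [Nat.cast_sub (by omega), add_sub_cancel] at this
  · rw [zero_add, hAc k (by omega)]
    interval_cases k
    · exact T1.fixesNeighbours hΓ ht hO hfix
    · exact T1.fixesNeighbours' hΓ ht hO hfix hm₁ hm₁l
    · exact T2.fixesNeighbours hΓ ht hO hfix
    · exact T2.fixesNeighbours' hΓ ht hO hfix hm₂ hm₂n
    · exact T3.fixesNeighbours hΓ ht hO hfix

end PointLineGeometry

/-! ### Elementary identities in hexagonal systems -/

namespace HexagonalSystem

variable {F : Type w} {J : Type z} [Field F] [AddCommGroup J] [Module F J]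
  (S : HexagonalSystem F J)

theorem adj_neg (a : J) : S.adj (-a) = S.adj a := by
  simpa using S.adj_smul (-1) a

theorem norm_neg (a : J) : S.norm (-a) = -S.norm a := by
  have := S.norm_smul (-1) a
  rw [neg_one_smul] at this
  rw [this]
  ring

theorem adj_zero : S.adj 0 = 0 := by simpa using S.adj_smul 0 0

theorem norm_zero : S.norm 0 = 0 := (S.norm_eq_zero 0).2 rfl

theorem norm_ne_zero {a : J} (h : a ≠ 0) : S.norm a ≠ 0 := fun h' => h ((S.norm_eq_zero a).1 h')

theorem cross_self (a : J) : S.cross a a = (2 : F) • S.adj a := by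
  have h := S.adj_add a a
  rw [← two_smul F a, S.adj_smul] at h
  have h2 : S.cross a a = (2 ^ 2 : F) • S.adj a - S.adj a - S.adj a := by rw [h]; abel
  rw [h2]
  module

theorem norm_one : S.norm S.one = 1 := by
  have h := S.adj_adj S.one
  rw [S.adj_one, S.adj_one] at h
  have h2 : (S.norm S.one - 1) • S.one = 0 := by rw [sub_smul, ← h, one_smul, sub_self]
  rcases smul_eq_zero.1 h2 with h3 | h3
  · exact sub_eq_zero.1 h3
  · exact absurd h3 S.one_ne_zero

theorem norm_adj (a : J) : S.norm (S.adj a) = S.norm a ^ 2 := by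
  by_cases ha : a = 0
  · simp [ha, S.adj_zero, S.norm_zero]
  have hN := S.norm_ne_zero ha
  have h := S.adj_adj (S.adj a)
  rw [S.adj_adj a, S.adj_smul] at h
  have ha' : S.adj a ≠ 0 := by
    intro h0
    have := S.adj_adj a
    rw [h0, S.adj_zero] at this
    rcases smul_eq_zero.1 this.symm with h1 | h1
    exacts [hN h1, ha h1]
  have h2 : (S.norm (S.adj a) - S.norm a ^ 2) • S.adj a = 0 := by rw [sub_smul, ← h, sub_self]
  rcases smul_eq_zero.1 h2 with h3 | h3
  · exact sub_eq_zero.1 h3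
  · exact absurd h3 ha'

end HexagonalSystem

/-! ### Groups with hexagonal commutator relations -/

/-- Six families of elements of a group `H` that satisfy the commutator relations of the
hexagonal system `S`. -/
structure RootData {F : Type w} {J : Type z} [Field F] [AddCommGroup J] [Module F J]
    (S : HexagonalSystem F J) (H : Type*) [Group H] where
  x₁ : J → H
  x₂ : F → H
  x₃ : J → H
  x₄ : F → H
  x₅ : J → H
  x₆ : F → H
  add₁ : ∀ a b, x₁ (a + b) = x₁ a * x₁ b
  add₂ : ∀ a b, x₂ (a + b) = x₂ a * x₂ b
  add₃ : ∀ a b, x₃ (a + b) = x₃ a * x₃ b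
  add₄ : ∀ a b, x₄ (a + b) = x₄ a * x₄ b
  add₅ : ∀ a b, x₅ (a + b) = x₅ a * x₅ b
  add₆ : ∀ a b, x₆ (a + b) = x₆ a * x₆ b
  comm₁₂ : ∀ a t, groupComm (x₁ a) (x₂ t) = 1
  comm₁₃ : ∀ a b, groupComm (x₁ a) (x₃ b) = x₂ (S.tr a b)
  comm₁₄ : ∀ a t, groupComm (x₁ a) (x₄ t) = 1
  comm₁₅ : ∀ a b, groupComm (x₁ a) (x₅ b) =
    x₂ (-S.tr (S.adj a) b) * x₃ (S.cross a b) * x₄ (S.tr a (S.adj b))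
  comm₁₆ : ∀ a t, groupComm (x₁ a) (x₆ t) =
    x₂ (-(t * S.norm a)) * x₃ (t • S.adj a) * x₄ (t ^ 2 * S.norm a) * x₅ (-(t • a))
  comm₂₃ : ∀ t a, groupComm (x₂ t) (x₃ a) = 1
  comm₂₄ : ∀ t u, groupComm (x₂ t) (x₄ u) = 1
  comm₂₅ : ∀ t a, groupComm (x₂ t) (x₅ a) = 1
  comm₂₆ : ∀ t u, groupComm (x₂ t) (x₆ u) = x₄ (t * u)
  comm₃₄ : ∀ a t, groupComm (x₃ a) (x₄ t) = 1
  comm₃₅ : ∀ a b, groupComm (x₃ a) (x₅ b) = x₄ (S.tr a b)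
  comm₃₆ : ∀ a t, groupComm (x₃ a) (x₆ t) = 1
  comm₄₅ : ∀ t a, groupComm (x₄ t) (x₅ a) = 1
  comm₄₆ : ∀ t u, groupComm (x₄ t) (x₆ u) = 1
  comm₅₆ : ∀ a t, groupComm (x₅ a) (x₆ t) = 1

theorem mul_eq_of_groupComm {H : Type*} [Group H] {g h k : H} (e : groupComm g h = k) :
    h * g = g * h * k⁻¹ := by
  rw [← e, groupComm]
  group

theorem mul_eq_of_groupComm_one {H : Type*} [Group H] {g h : H} (e : groupComm g h = 1) :
    h * g = g * h := by
  rw [mul_eq_of_groupComm e, inv_one, mul_one]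

theorem conj_eq_of_groupComm {H : Type*} [Group H] {g h k : H} (e : groupComm g⁻¹ h = k) :
    g * h * g⁻¹ = h * k⁻¹ := by
  rw [← e, groupComm]
  group

theorem map_zero_of_map_add {H M : Type*} [Group H] [AddCommGroup M] {x : M → H}
    (h : ∀ a b, x (a + b) = x a * x b) : x 0 = 1 := by
  have := h 0 0
  rwa [add_zero, eq_comm, mul_eq_left] at this

theorem map_neg_of_map_add {H M : Type*} [Group H] [AddCommGroup M] {x : M → H}
    (h : ∀ a b, x (a + b) = x a * x b) (a : M) : x (-a) = (x a)⁻¹ := by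
  rw [eq_inv_iff_mul_eq_one, ← h, neg_add_cancel, map_zero_of_map_add h]

namespace RootData

variable {F : Type w} {J : Type z} [Field F] [AddCommGroup J] [Module F J]
  {S : HexagonalSystem F J} {H : Type*} [Group H] (D : RootData S H)

/-- The element of `U₂ U₃ U₄ U₅ U₆` with the given coordinates. -/
def W (t : F) (a : J) (r : F) (b : J) (u : F) : H :=
  D.x₂ t * D.x₃ a * D.x₄ r * D.x₅ b * D.x₆ u

theorem x₁_neg (a : J) : D.x₁ (-a) = (D.x₁ a)⁻¹ := map_neg_of_map_add D.add₁ a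
theorem x₂_neg (a : F) : D.x₂ (-a) = (D.x₂ a)⁻¹ := map_neg_of_map_add D.add₂ a
theorem x₃_neg (a : J) : D.x₃ (-a) = (D.x₃ a)⁻¹ := map_neg_of_map_add D.add₃ a
theorem x₄_neg (a : F) : D.x₄ (-a) = (D.x₄ a)⁻¹ := map_neg_of_map_add D.add₄ a
theorem x₅_neg (a : J) : D.x₅ (-a) = (D.x₅ a)⁻¹ := map_neg_of_map_add D.add₅ a
theorem x₆_neg (a : F) : D.x₆ (-a) = (D.x₆ a)⁻¹ := map_neg_of_map_add D.add₆ a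
theorem x₁_zero : D.x₁ 0 = 1 := map_zero_of_map_add D.add₁
theorem x₂_zero : D.x₂ 0 = 1 := map_zero_of_map_add D.add₂
theorem x₃_zero : D.x₃ 0 = 1 := map_zero_of_map_add D.add₃
theorem x₄_zero : D.x₄ 0 = 1 := map_zero_of_map_add D.add₄
theorem x₅_zero : D.x₅ 0 = 1 := map_zero_of_map_add D.add₅
theorem x₆_zero : D.x₆ 0 = 1 := map_zero_of_map_add D.add₆

theorem W_mul_x₆ (t : F) (a : J) (r : F) (b : J) (u u' : F) :
    D.W t a r b u * D.x₆ u' = D.W t a r b (u + u') := by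
  simp only [W, D.add₆, mul_assoc]

theorem W_mul_x₅ (t : F) (a : J) (r : F) (b : J) (u : F) (b' : J) :
    D.W t a r b u * D.x₅ b' = D.W t a r (b + b') u := by
  simp only [W, D.add₅, mul_assoc, mul_eq_of_groupComm_one (D.comm₅₆ b' u)]

theorem W_mul_x₄ (t : F) (a : J) (r : F) (b : J) (u r' : F) :
    D.W t a r b u * D.x₄ r' = D.W t a (r + r') b u := by
  simp only [W]
  rw [mul_assoc _ (D.x₆ u), mul_eq_of_groupComm_one (D.comm₄₆ r' u), ← mul_assoc,
    mul_assoc _ (D.x₅ b), mul_eq_of_groupComm_one (D.comm₄₅ r' b), ← mul_assoc,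
    mul_assoc _ (D.x₄ r), ← D.add₄]

theorem W_mul_x₃ (t : F) (a : J) (r : F) (b : J) (u : F) (a' : J) :
    D.W t a r b u * D.x₃ a' = D.W t (a + a') (r - S.tr a' b) b u := by
  have h : D.W t a r b u * D.x₃ a' = D.W t (a + a') r b u * D.x₄ (-S.tr a' b) := by
    simp only [W]
    rw [mul_assoc _ (D.x₆ u), mul_eq_of_groupComm_one (D.comm₃₆ a' u), ← mul_assoc,
      mul_assoc _ (D.x₅ b), mul_eq_of_groupComm (D.comm₃₅ a' b), ← mul_assoc, ← mul_assoc,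
      mul_assoc _ (D.x₄ r), mul_eq_of_groupComm_one (D.comm₃₄ a' r), ← mul_assoc,
      mul_assoc (D.x₂ t), ← D.add₃, ← D.x₄_neg, mul_assoc _ (D.x₆ u),
      mul_eq_of_groupComm_one (D.comm₄₆ _ u), ← mul_assoc]
  rw [h, W_mul_x₄, ← sub_eq_add_neg]

theorem W_mul_x₂ (t : F) (a : J) (r : F) (b : J) (u t' : F) :
    D.W t a r b u * D.x₂ t' = D.W (t + t') a (r - t' * u) b u := by
  have h : D.W t a r b u * D.x₂ t' = D.W (t + t') a r b u * D.x₄ (-(t' * u)) := by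
    simp only [W]
    rw [mul_assoc _ (D.x₆ u), mul_eq_of_groupComm (D.comm₂₆ t' u), ← mul_assoc, ← mul_assoc,
      mul_assoc _ (D.x₅ b), mul_eq_of_groupComm_one (D.comm₂₅ t' b), ← mul_assoc,
      mul_assoc _ (D.x₄ r), mul_eq_of_groupComm_one (D.comm₂₄ t' r), ← mul_assoc,
      mul_assoc _ (D.x₃ a), mul_eq_of_groupComm_one (D.comm₂₃ t' a), ← mul_assoc,
      ← D.add₂, ← D.x₄_neg]
  rw [h, W_mul_x₄, ← sub_eq_add_neg]

theorem W_mul (t : F) (a : J) (r : F) (b : J) (u : F) (t' : F) (a' : J) (r' : F) (b' : J)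
    (u' : F) : D.W t a r b u * D.W t' a' r' b' u' =
      D.W (t + t') (a + a') (r + r' - S.tr a' b - t' * u) (b + b') (u + u') := by
  conv_lhs => rw [W, W]
  simp only [← mul_assoc]
  change D.W t a r b u * _ * _ * _ * _ * _ = _
  rw [W_mul_x₂, W_mul_x₃, W_mul_x₄, W_mul_x₅, W_mul_x₆]
  congr 1
  ring

theorem x₂_eq (t : F) : D.x₂ t = D.W t 0 0 0 0 := by
  simp [W, x₃_zero, x₄_zero, x₅_zero, x₆_zero]
theorem x₃_eq (a : J) : D.x₃ a = D.W 0 a 0 0 0 := by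
  simp [W, x₂_zero, x₄_zero, x₅_zero, x₆_zero]
theorem x₄_eq (r : F) : D.x₄ r = D.W 0 0 r 0 0 := by
  simp [W, x₂_zero, x₃_zero, x₅_zero, x₆_zero]
theorem x₅_eq (b : J) : D.x₅ b = D.W 0 0 0 b 0 := by
  simp [W, x₂_zero, x₃_zero, x₄_zero, x₆_zero]
theorem x₆_eq (u : F) : D.x₆ u = D.W 0 0 0 0 u := by
  simp [W, x₂_zero, x₃_zero, x₄_zero, x₅_zero]

theorem conj₂ (c : J) (t : F) : D.x₁ c * D.x₂ t * (D.x₁ c)⁻¹ = D.W t 0 0 0 0 := by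
  rw [conj_eq_of_groupComm (k := 1) (by rw [← x₁_neg, comm₁₂]), inv_one, mul_one, x₂_eq]

theorem conj₄ (c : J) (t : F) : D.x₁ c * D.x₄ t * (D.x₁ c)⁻¹ = D.W 0 0 t 0 0 := by
  rw [conj_eq_of_groupComm (k := 1) (by rw [← x₁_neg, comm₁₄]), inv_one, mul_one, x₄_eq]

theorem conj₃ (c b : J) : D.x₁ c * D.x₃ b * (D.x₁ c)⁻¹ = D.W (S.tr c b) b 0 0 0 := by
  rw [conj_eq_of_groupComm (k := _) (by rw [← x₁_neg, comm₁₃]), ← x₂_neg, x₂_eq, x₃_eq, W_mul]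
  congr 1 <;> simp

theorem conj₅ (c b : J) : D.x₁ c * D.x₅ b * (D.x₁ c)⁻¹ =
    D.W (S.tr (S.adj c) b) (S.cross c b) (-S.tr c (S.adj b)) b 0 := by
  rw [conj_eq_of_groupComm (k := _) (by rw [← x₁_neg, comm₁₅]), mul_inv_rev, mul_inv_rev,
    ← x₂_neg, ← x₃_neg, ← x₄_neg, x₂_eq, x₃_eq, x₄_eq, x₅_eq, W_mul, W_mul, W_mul, S.adj_neg]
  -- Reordering x₃(c × b) past x₅(b) subtracts this from T(c, b^#), which explains the negative sign
  -- of the U₄ coordinate.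
  have h : S.tr (S.cross c b) b = 2 * S.tr c (S.adj b) := by
    rw [← S.tr_cross, S.cross_self, map_smul, smul_eq_mul]
  congr 1 <;> simp [h]
  ring

theorem conj₆ (c : J) (t : F) : D.x₁ c * D.x₆ t * (D.x₁ c)⁻¹ =
    D.W (-(t * S.norm c)) (-(t • S.adj c)) (-(t ^ 2 * S.norm c)) (-(t • c)) t := by
  rw [conj_eq_of_groupComm (k := _) (by rw [← x₁_neg, comm₁₆]), mul_inv_rev, mul_inv_rev,
    mul_inv_rev, ← x₂_neg, ← x₃_neg, ← x₄_neg, ← x₅_neg, x₂_eq, x₃_eq, x₄_eq, x₅_eq, x₆_eq,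
    W_mul, W_mul, W_mul, W_mul, S.adj_neg, S.norm_neg]
  -- The U₄ coordinate is t²N(c), changed by −3t²N(c) from x₃ passing x₅ and by t²N(c) from x₂
  -- passing x₆.
  have h : S.tr (S.adj c) c = 3 * S.norm c := by rw [S.tr_symm, S.tr_adj]
  congr 1 <;> simp [h]
  ring

/-- Conjugation by `x₁ c` on `U₂ U₃ U₄ U₅ U₆` stays in this group. -/
theorem exists_conj_W (c : J) (t : F) (a : J) (r : F) (b : J) (u : F) :
    ∃ t' a' r' b' u', D.x₁ c * D.W t a r b u * (D.x₁ c)⁻¹ = D.W t' a' r' b' u' := by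
  have : D.x₁ c * D.W t a r b u * (D.x₁ c)⁻¹ = (D.x₁ c * D.x₂ t * (D.x₁ c)⁻¹) *
      (D.x₁ c * D.x₃ a * (D.x₁ c)⁻¹) * (D.x₁ c * D.x₄ r * (D.x₁ c)⁻¹) *
      (D.x₁ c * D.x₅ b * (D.x₁ c)⁻¹) * (D.x₁ c * D.x₆ u * (D.x₁ c)⁻¹) := by
    rw [W]; group
  rw [this, conj₂, conj₃, conj₄, conj₅, conj₆, W_mul, W_mul, W_mul, W_mul]
  exact ⟨_, _, _, _, _, rfl⟩

/-- The subgroup generated by all the `xᵢ`. -/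
def unip : Subgroup H :=
  Subgroup.closure (Set.range D.x₁ ∪ Set.range D.x₂ ∪ Set.range D.x₃ ∪ Set.range D.x₄ ∪
    Set.range D.x₅ ∪ Set.range D.x₆)

theorem x₁_mem (a : J) : D.x₁ a ∈ D.unip := Subgroup.subset_closure (by simp)
theorem x₂_mem (a : F) : D.x₂ a ∈ D.unip := Subgroup.subset_closure (by simp)
theorem x₃_mem (a : J) : D.x₃ a ∈ D.unip := Subgroup.subset_closure (by simp)
theorem x₄_mem (a : F) : D.x₄ a ∈ D.unip := Subgroup.subset_closure (by simp)
theorem x₅_mem (a : J) : D.x₅ a ∈ D.unip := Subgroup.subset_closure (by simp)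
theorem x₆_mem (a : F) : D.x₆ a ∈ D.unip := Subgroup.subset_closure (by simp)

/-- The elements `W` are closed under multiplication and conjugation by `x₁ c` keeps them among
themselves, so every generator can be absorbed from the left. -/
theorem exists_normalForm {g : H} (hg : g ∈ D.unip) :
    ∃ a₁ t a r b u, g = D.x₁ a₁ * D.W t a r b u := by
  have key : ∀ t a r b u, ∀ g, (∃ a₁ t a r b u, g = D.x₁ a₁ * D.W t a r b u) →
      ∃ a₁ t' a' r' b' u', D.W t a r b u * g = D.x₁ a₁ * D.W t' a' r' b' u' := by
    rintro t a r b u _ ⟨a₁, t₂, a₂, r₂, b₂, u₂, rfl⟩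
    obtain ⟨t', a', r', b', u', h⟩ := D.exists_conj_W (-a₁) t a r b u
    rw [← mul_assoc, show D.W t a r b u * D.x₁ a₁ = D.x₁ a₁ * D.W t' a' r' b' u' by
      rw [← h, x₁_neg]; group, mul_assoc, W_mul]
    exact ⟨a₁, _, _, _, _, _, rfl⟩
  have gen : ∀ x ∈ Set.range D.x₁ ∪ Set.range D.x₂ ∪ Set.range D.x₃ ∪ Set.range D.x₄ ∪
      Set.range D.x₅ ∪ Set.range D.x₆, ∀ g, (∃ a₁ t a r b u, g = D.x₁ a₁ * D.W t a r b u) →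
      ∃ a₁ t' a' r' b' u', x * g = D.x₁ a₁ * D.W t' a' r' b' u' := by
    rintro _ (((((⟨c, rfl⟩ | ⟨c, rfl⟩) | ⟨c, rfl⟩) | ⟨c, rfl⟩) | ⟨c, rfl⟩) | ⟨c, rfl⟩) g hg
    · obtain ⟨a₁, t, a, r, b, u, rfl⟩ := hg
      exact ⟨c + a₁, t, a, r, b, u, by rw [D.add₁, mul_assoc]⟩
    · rw [x₂_eq]; exact key _ _ _ _ _ _ hg
    · rw [x₃_eq]; exact key _ _ _ _ _ _ hg
    · rw [x₄_eq]; exact key _ _ _ _ _ _ hg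
    · rw [x₅_eq]; exact key _ _ _ _ _ _ hg
    · rw [x₆_eq]; exact key _ _ _ _ _ _ hg
  induction hg using Subgroup.closure_induction_left with
  | one => exact ⟨0, 0, 0, 0, 0, 0, by rw [x₁_zero, ← x₂_eq, x₂_zero, one_mul]⟩
  | mul_left x hx y _ ih => exact gen x hx y ih
  | inv_mul_cancel x hx y _ ih =>
    refine gen _ ?_ y ih
    rcases hx with ((((⟨c, rfl⟩ | ⟨c, rfl⟩) | ⟨c, rfl⟩) | ⟨c, rfl⟩) | ⟨c, rfl⟩) | ⟨c, rfl⟩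
    · rw [← x₁_neg]; simp
    · rw [← x₂_neg]; simp
    · rw [← x₃_neg]; simp
    · rw [← x₄_neg]; simp
    · rw [← x₅_neg]; simp
    · rw [← x₆_neg]; simp

/-- Two families satisfying the commutator relations give one in the product group. -/
def prod {H' : Type*} [Group H'] (D' : RootData S H') : RootData S (H × H') where
  x₁ a := (D.x₁ a, D'.x₁ a)
  x₂ a := (D.x₂ a, D'.x₂ a)
  x₃ a := (D.x₃ a, D'.x₃ a)
  x₄ a := (D.x₄ a, D'.x₄ a)
  x₅ a := (D.x₅ a, D'.x₅ a)
  x₆ a := (D.x₆ a, D'.x₆ a)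
  add₁ a b := Prod.ext (D.add₁ a b) (D'.add₁ a b)
  add₂ a b := Prod.ext (D.add₂ a b) (D'.add₂ a b)
  add₃ a b := Prod.ext (D.add₃ a b) (D'.add₃ a b)
  add₄ a b := Prod.ext (D.add₄ a b) (D'.add₄ a b)
  add₅ a b := Prod.ext (D.add₅ a b) (D'.add₅ a b)
  add₆ a b := Prod.ext (D.add₆ a b) (D'.add₆ a b)
  comm₁₂ a b := Prod.ext (D.comm₁₂ a b) (D'.comm₁₂ a b)
  comm₁₃ a b := Prod.ext (D.comm₁₃ a b) (D'.comm₁₃ a b)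
  comm₁₄ a b := Prod.ext (D.comm₁₄ a b) (D'.comm₁₄ a b)
  comm₁₅ a b := Prod.ext (D.comm₁₅ a b) (D'.comm₁₅ a b)
  comm₁₆ a b := Prod.ext (D.comm₁₆ a b) (D'.comm₁₆ a b)
  comm₂₃ a b := Prod.ext (D.comm₂₃ a b) (D'.comm₂₃ a b)
  comm₂₄ a b := Prod.ext (D.comm₂₄ a b) (D'.comm₂₄ a b)
  comm₂₅ a b := Prod.ext (D.comm₂₅ a b) (D'.comm₂₅ a b)
  comm₂₆ a b := Prod.ext (D.comm₂₆ a b) (D'.comm₂₆ a b)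
  comm₃₄ a b := Prod.ext (D.comm₃₄ a b) (D'.comm₃₄ a b)
  comm₃₅ a b := Prod.ext (D.comm₃₅ a b) (D'.comm₃₅ a b)
  comm₃₆ a b := Prod.ext (D.comm₃₆ a b) (D'.comm₃₆ a b)
  comm₄₅ a b := Prod.ext (D.comm₄₅ a b) (D'.comm₄₅ a b)
  comm₄₆ a b := Prod.ext (D.comm₄₆ a b) (D'.comm₄₆ a b)
  comm₅₆ a b := Prod.ext (D.comm₅₆ a b) (D'.comm₅₆ a b)

theorem swap_mem_unip {H' : Type*} [Group H'] (D' : RootData S H') {g : H × H'}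
    (hg : g ∈ (D.prod D').unip) : g.swap ∈ (D'.prod D).unip := by
  induction hg using Subgroup.closure_induction with
  | mem x hx =>
    apply Subgroup.subset_closure
    rcases hx with ((((⟨c, rfl⟩ | ⟨c, rfl⟩) | ⟨c, rfl⟩) | ⟨c, rfl⟩) | ⟨c, rfl⟩) | ⟨c, rfl⟩
    · exact Or.inl (Or.inl (Or.inl (Or.inl (Or.inl ⟨c, rfl⟩))))
    · exact Or.inl (Or.inl (Or.inl (Or.inl (Or.inr ⟨c, rfl⟩))))
    · exact Or.inl (Or.inl (Or.inl (Or.inr ⟨c, rfl⟩)))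
    · exact Or.inl (Or.inl (Or.inr ⟨c, rfl⟩))
    · exact Or.inl (Or.inr ⟨c, rfl⟩)
    · exact Or.inr ⟨c, rfl⟩
  | one => exact Subgroup.one_mem _
  | mul x y _ _ hx hy => exact Subgroup.mul_mem _ hx hy
  | inv x _ hx => exact Subgroup.inv_mem _ hx

end RootData

open PointLineGeometry

/-! ### Coordinates as root data, and the free action of the root groups. -/

namespace HexagonCoordinates

variable {P : Type u} {L : Type v} {Γ : PointLineGeometry P L}
  {F : Type w} {J : Type z} [Field F] [AddCommGroup J] [Module F J]
  {S : HexagonalSystem F J} (X : HexagonCoordinates Γ S)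

/-- The root group elements of coordinates, as a family in the collineation group. -/
def rd : RootData S Γ.Collineation where
  x₁ := X.x₁
  x₂ := X.x₂
  x₃ := X.x₃
  x₄ := X.x₄
  x₅ := X.x₅
  x₆ := X.x₆
  add₁ := X.param₁.1
  add₂ := X.param₂.1
  add₃ := X.param₃.1
  add₄ := X.param₄.1
  add₅ := X.param₅.1
  add₆ := X.param₆.1
  comm₁₂ := X.comm₁₂
  comm₁₃ := X.comm₁₃
  comm₁₄ := X.comm₁₄
  comm₁₅ := X.comm₁₅
  comm₁₆ := X.comm₁₆
  comm₂₃ := X.comm₂₃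
  comm₂₄ := X.comm₂₄
  comm₂₅ := X.comm₂₅
  comm₂₆ := X.comm₂₆
  comm₃₄ := X.comm₃₄
  comm₃₅ := X.comm₃₅
  comm₃₆ := X.comm₃₆
  comm₄₅ := X.comm₄₅
  comm₄₆ := X.comm₄₆
  comm₅₆ := X.comm₅₆

theorem mem₁ (a : J) : X.rd.x₁ a ∈ Γ.rootGroup X.A 1 := by
  rw [← SetLike.mem_coe, ← X.param₁.2.2]; exact ⟨a, rfl⟩
theorem mem₂ (a : F) : X.rd.x₂ a ∈ Γ.rootGroup X.A 2 := by
  rw [← SetLike.mem_coe, ← X.param₂.2.2]; exact ⟨a, rfl⟩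
theorem mem₃ (a : J) : X.rd.x₃ a ∈ Γ.rootGroup X.A 3 := by
  rw [← SetLike.mem_coe, ← X.param₃.2.2]; exact ⟨a, rfl⟩
theorem mem₄ (a : F) : X.rd.x₄ a ∈ Γ.rootGroup X.A 4 := by
  rw [← SetLike.mem_coe, ← X.param₄.2.2]; exact ⟨a, rfl⟩
theorem mem₅ (a : J) : X.rd.x₅ a ∈ Γ.rootGroup X.A 5 := by
  rw [← SetLike.mem_coe, ← X.param₅.2.2]; exact ⟨a, rfl⟩
theorem mem₆ (a : F) : X.rd.x₆ a ∈ Γ.rootGroup X.A 6 := by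
  rw [← SetLike.mem_coe, ← X.param₆.2.2]; exact ⟨a, rfl⟩

theorem surj₁ {g : Γ.Collineation} (hg : g ∈ Γ.rootGroup X.A 1) : ∃ a, X.rd.x₁ a = g := by
  rwa [← SetLike.mem_coe, ← X.param₁.2.2] at hg
theorem surj₂ {g : Γ.Collineation} (hg : g ∈ Γ.rootGroup X.A 2) : ∃ a, X.rd.x₂ a = g := by
  rwa [← SetLike.mem_coe, ← X.param₂.2.2] at hg
theorem surj₃ {g : Γ.Collineation} (hg : g ∈ Γ.rootGroup X.A 3) : ∃ a, X.rd.x₃ a = g := by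
  rwa [← SetLike.mem_coe, ← X.param₃.2.2] at hg
theorem surj₄ {g : Γ.Collineation} (hg : g ∈ Γ.rootGroup X.A 4) : ∃ a, X.rd.x₄ a = g := by
  rwa [← SetLike.mem_coe, ← X.param₄.2.2] at hg
theorem surj₅ {g : Γ.Collineation} (hg : g ∈ Γ.rootGroup X.A 5) : ∃ a, X.rd.x₅ a = g := by
  rwa [← SetLike.mem_coe, ← X.param₅.2.2] at hg
theorem surj₆ {g : Γ.Collineation} (hg : g ∈ Γ.rootGroup X.A 6) : ∃ a, X.rd.x₆ a = g := by
  rwa [← SetLike.mem_coe, ← X.param₆.2.2] at hg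

theorem fix₁ (a : J) (j : ZMod 12) (hj : (j - 1).val ≤ 6 := by decide) :
    X.rd.x₁ a • X.A j = X.A j := smul_of_mem_rootGroup X.isApartment (X.mem₁ a) j hj
theorem fix₂ (a : F) (j : ZMod 12) (hj : (j - 2).val ≤ 6 := by decide) :
    X.rd.x₂ a • X.A j = X.A j := smul_of_mem_rootGroup X.isApartment (X.mem₂ a) j hj
theorem fix₃ (a : J) (j : ZMod 12) (hj : (j - 3).val ≤ 6 := by decide) :
    X.rd.x₃ a • X.A j = X.A j := smul_of_mem_rootGroup X.isApartment (X.mem₃ a) j hj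
theorem fix₄ (a : F) (j : ZMod 12) (hj : (j - 4).val ≤ 6 := by decide) :
    X.rd.x₄ a • X.A j = X.A j := smul_of_mem_rootGroup X.isApartment (X.mem₄ a) j hj
theorem fix₅ (a : J) (j : ZMod 12) (hj : (j - 5).val ≤ 6 := by decide) :
    X.rd.x₅ a • X.A j = X.A j := smul_of_mem_rootGroup X.isApartment (X.mem₅ a) j hj
theorem fix₆ (a : F) (j : ZMod 12) (hj : (j - 6).val ≤ 6 := by decide) :
    X.rd.x₆ a • X.A j = X.A j := smul_of_mem_rootGroup X.isApartment (X.mem₆ a) j hj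

section free

variable (hΓ : Γ.IsMoufangHexagon)
include hΓ

theorem free₁ {a : J} (h : X.rd.x₁ a • X.A 8 = X.A 8) : a = 0 :=
  X.param₁.2.1 ((eq_one_of_mem_rootGroup' hΓ.hexagon hΓ.thick X.isApartment (X.mem₁ a) h).trans
    X.rd.x₁_zero.symm)
theorem free₂ {a : F} (h : X.rd.x₂ a • X.A 9 = X.A 9) : a = 0 :=
  X.param₂.2.1 ((eq_one_of_mem_rootGroup' hΓ.hexagon hΓ.thick X.isApartment (X.mem₂ a) h).trans
    X.rd.x₂_zero.symm)
theorem free₃ {a : J} (h : X.rd.x₃ a • X.A 10 = X.A 10) : a = 0 :=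
  X.param₃.2.1 ((eq_one_of_mem_rootGroup' hΓ.hexagon hΓ.thick X.isApartment (X.mem₃ a) h).trans
    X.rd.x₃_zero.symm)
theorem free₄ {a : F} (h : X.rd.x₄ a • X.A 11 = X.A 11) : a = 0 :=
  X.param₄.2.1 ((eq_one_of_mem_rootGroup' hΓ.hexagon hΓ.thick X.isApartment (X.mem₄ a) h).trans
    X.rd.x₄_zero.symm)
theorem free₅ {a : J} (h : X.rd.x₅ a • X.A 0 = X.A 0) : a = 0 :=
  X.param₅.2.1 ((eq_one_of_mem_rootGroup' hΓ.hexagon hΓ.thick X.isApartment (X.mem₅ a) h).trans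
    X.rd.x₅_zero.symm)
theorem free₆ {a : F} (h : X.rd.x₆ a • X.A 1 = X.A 1) : a = 0 :=
  X.param₆.2.1 ((eq_one_of_mem_rootGroup' hΓ.hexagon hΓ.thick X.isApartment (X.mem₆ a) h).trans
    X.rd.x₆_zero.symm)
theorem free₂' {a : F} (h : X.rd.x₂ a • X.A 1 = X.A 1) : a = 0 :=
  X.param₂.2.1 ((eq_one_of_mem_rootGroup hΓ.hexagon hΓ.thick X.isApartment (X.mem₂ a) h).trans
    X.rd.x₂_zero.symm)
theorem free₃' {a : J} (h : X.rd.x₃ a • X.A 2 = X.A 2) : a = 0 :=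
  X.param₃.2.1 ((eq_one_of_mem_rootGroup hΓ.hexagon hΓ.thick X.isApartment (X.mem₃ a) h).trans
    X.rd.x₃_zero.symm)
theorem free₄' {a : F} (h : X.rd.x₄ a • X.A 3 = X.A 3) : a = 0 :=
  X.param₄.2.1 ((eq_one_of_mem_rootGroup hΓ.hexagon hΓ.thick X.isApartment (X.mem₄ a) h).trans
    X.rd.x₄_zero.symm)
theorem free₅' {a : J} (h : X.rd.x₅ a • X.A 4 = X.A 4) : a = 0 :=
  X.param₅.2.1 ((eq_one_of_mem_rootGroup hΓ.hexagon hΓ.thick X.isApartment (X.mem₅ a) h).trans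
    X.rd.x₅_zero.symm)
theorem free₆' {a : F} (h : X.rd.x₆ a • X.A 5 = X.A 5) : a = 0 :=
  X.param₆.2.1 ((eq_one_of_mem_rootGroup hΓ.hexagon hΓ.thick X.isApartment (X.mem₆ a) h).trans
    X.rd.x₆_zero.symm)

theorem x₁_smul_eq_iff {a b : J} : X.rd.x₁ a • X.A 8 = X.rd.x₁ b • X.A 8 ↔ a = b := by
  refine ⟨fun h => ?_, fun h => by rw [h]⟩
  rw [← sub_eq_zero]
  refine X.free₁ hΓ ?_
  rw [sub_eq_neg_add, X.rd.add₁, mul_smul, h, X.rd.x₁_neg, inv_smul_smul]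

end free

/-! ### Stabilisers of the elements of the apartment -/

section stab

variable {a₁ : J} {t : F} {a : J} {r : F} {b : J} {u : F}

theorem W_smul (j : ZMod 12) (hj : (j - 2).val ≤ 6 ∧ (j - 3).val ≤ 6 ∧ (j - 4).val ≤ 6 ∧
    (j - 5).val ≤ 6 ∧ (j - 6).val ≤ 6) : X.rd.W t a r b u • X.A j = X.A j := by
  simp only [RootData.W, mul_smul]
  rw [X.fix₆ u j hj.2.2.2.2, X.fix₅ b j hj.2.2.2.1, X.fix₄ r j hj.2.2.1, X.fix₃ a j hj.2.1,
    X.fix₂ t j hj.1]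

theorem W_smul_eight : X.rd.W t a r b u • X.A 8 = X.A 8 := X.W_smul 8 (by decide)

theorem W_smul_nine : X.rd.W t a r b u • X.A 9 = X.rd.x₂ t • X.A 9 := by
  simp only [RootData.W, mul_smul]
  rw [X.fix₆ u 9, X.fix₅ b 9, X.fix₄ r 9, X.fix₃ a 9]

theorem W_smul_ten : X.rd.W t a r b u • X.A 10 = X.rd.x₂ t • X.rd.x₃ a • X.A 10 := by
  simp only [RootData.W, mul_smul]
  rw [X.fix₆ u 10, X.fix₅ b 10, X.fix₄ r 10]

theorem W_smul_eleven :
    X.rd.W t a r b u • X.A 11 = X.rd.x₂ t • X.rd.x₃ a • X.rd.x₄ r • X.A 11 := by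
  simp only [RootData.W, mul_smul]
  rw [X.fix₆ u 11, X.fix₅ b 11]

theorem W_smul_zero :
    X.rd.W t a r b u • X.A 0 = X.rd.x₂ t • X.rd.x₃ a • X.rd.x₄ r • X.rd.x₅ b • X.A 0 := by
  simp only [RootData.W, mul_smul]
  rw [X.fix₆ u 0]

variable (hΓ : Γ.IsMoufangHexagon)
include hΓ

/-- Of the six factors only the last one moves `A 5`. In the same way each lemma below strips the
rightmost factor left, going down from `A 5` to `A 1`. -/
theorem eq_zero_of_smul_five (h : (X.rd.x₁ a₁ * X.rd.W t a r b u) • X.A 5 = X.A 5) : u = 0 := by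
  refine X.free₆' hΓ (smul_left_cancel (X.rd.x₁ a₁ * X.rd.W t a r b 0) ?_)
  rw [← mul_smul, mul_assoc, X.rd.W_mul_x₆, zero_add, h]
  simp only [RootData.W, mul_smul, X.rd.x₆_zero, one_smul]
  rw [X.fix₅ b 5, X.fix₄ r 5, X.fix₃ a 5, X.fix₂ t 5, X.fix₁ a₁ 5]

theorem eq_zero_of_smul_four (h : (X.rd.x₁ a₁ * X.rd.W t a r b 0) • X.A 4 = X.A 4) : b = 0 := by
  refine X.free₅' hΓ (smul_left_cancel (X.rd.x₁ a₁ * X.rd.W t a r 0 0) ?_)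
  rw [← mul_smul, mul_assoc, X.rd.W_mul_x₅, zero_add, h]
  simp only [RootData.W, mul_smul, X.rd.x₆_zero, X.rd.x₅_zero, one_smul]
  rw [X.fix₄ r 4, X.fix₃ a 4, X.fix₂ t 4, X.fix₁ a₁ 4]

theorem eq_zero_of_smul_three (h : (X.rd.x₁ a₁ * X.rd.W t a r 0 0) • X.A 3 = X.A 3) : r = 0 := by
  refine X.free₄' hΓ (smul_left_cancel (X.rd.x₁ a₁ * X.rd.W t a 0 0 0) ?_)
  rw [← mul_smul, mul_assoc, X.rd.W_mul_x₄, zero_add, h]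
  simp only [RootData.W, mul_smul, X.rd.x₆_zero, X.rd.x₅_zero, X.rd.x₄_zero, one_smul]
  rw [X.fix₃ a 3, X.fix₂ t 3, X.fix₁ a₁ 3]

theorem eq_zero_of_smul_two (h : (X.rd.x₁ a₁ * X.rd.W t a 0 0 0) • X.A 2 = X.A 2) : a = 0 := by
  refine X.free₃' hΓ (smul_left_cancel (X.rd.x₁ a₁ * X.rd.W t 0 0 0 0) ?_)
  rw [← mul_smul, mul_assoc, X.rd.W_mul_x₃, zero_add, map_zero, sub_zero, h]
  simp only [← X.rd.x₂_eq, mul_smul]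
  rw [X.fix₂ t 2, X.fix₁ a₁ 2]

theorem eq_zero_of_smul_one (h : (X.rd.x₁ a₁ * X.rd.W t 0 0 0 0) • X.A 1 = X.A 1) : t = 0 := by
  refine X.free₂' hΓ (smul_left_cancel (X.rd.x₁ a₁) ?_)
  rw [← mul_smul, X.rd.x₂_eq, h, X.fix₁ a₁ 1]

/-- `U₂ U₃ U₄ U₅ U₆` acts freely on the elements opposite to `A 7`. -/
theorem W_eq_zero (h : X.rd.W t a r b u • X.A 1 = X.A 1) :
    t = 0 ∧ a = 0 ∧ r = 0 ∧ b = 0 ∧ u = 0 := by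
  have hb := X.isApartment.smul_eq_between hΓ.hexagon (g := X.rd.W t a r b u) (i := 1) (n := 5)
    le_rfl h (X.W_smul _ (by decide))
  have e1 : ∀ t a r b u, X.rd.W t a r b u = X.rd.x₁ 0 * X.rd.W t a r b u := by
    intros; rw [X.rd.x₁_zero, one_mul]
  obtain rfl := X.eq_zero_of_smul_five hΓ (a₁ := 0) (by rw [← e1]; exact hb 4 (by omega))
  obtain rfl := X.eq_zero_of_smul_four hΓ (a₁ := 0) (by rw [← e1]; exact hb 3 (by omega))
  obtain rfl := X.eq_zero_of_smul_three hΓ (a₁ := 0) (by rw [← e1]; exact hb 2 (by omega))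
  obtain rfl := X.eq_zero_of_smul_two hΓ (a₁ := 0) (by rw [← e1]; exact hb 1 (by omega))
  obtain rfl := X.eq_zero_of_smul_one hΓ (a₁ := 0) (by rw [← e1]; exact h)
  simp

theorem W_smul_inj {t' : F} {a' : J} {r' : F} {b' : J} {u' : F}
    (h : X.rd.W t a r b u • X.A 1 = X.rd.W t' a' r' b' u' • X.A 1) :
    t = t' ∧ a = a' ∧ r = r' ∧ b = b' ∧ u = u' := by
  have e : X.rd.W t a r b u = X.rd.W t' a' r' b' u' *
      X.rd.W (t - t') (a - a') (r - r' + S.tr (a - a') b' + (t - t') * u') (b - b') (u - u') := by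
    rw [X.rd.W_mul]
    congr 1
    · ring
    · abel
    · ring
    · abel
    · ring
  rw [e, mul_smul] at h
  obtain ⟨h1, h2, h3, h4, h5⟩ := X.W_eq_zero hΓ (smul_left_cancel _ h)
  rw [sub_eq_zero] at h1 h2 h4 h5
  subst h1 h2 h4 h5
  refine ⟨rfl, rfl, ?_, rfl, rfl⟩
  simp only [sub_self, map_zero, LinearMap.zero_apply, zero_mul, add_zero] at h3
  exact sub_eq_zero.1 h3

theorem W_inj {t' : F} {a' : J} {r' : F} {b' : J} {u' : F}
    (h : X.rd.W t a r b u = X.rd.W t' a' r' b' u') :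
    t = t' ∧ a = a' ∧ r = r' ∧ b = b' ∧ u = u' :=
  X.W_smul_inj hΓ (by rw [h])

end stab

end HexagonCoordinates

/-! ### Comparison of two coordinate systems on one apartment. -/

namespace PointLineGeometry

variable {P : Type u} {L : Type v} {Γ : PointLineGeometry P L}

/-- A permutation of the elements that preserves types and incidence is a collineation. -/
theorem exists_collineation (e : P ⊕ L ≃ P ⊕ L) (he : ∀ x, (e x).isLeft = x.isLeft)
    (hadj : ∀ x y, Γ.incidenceGraph.Adj (e x) (e y) ↔ Γ.incidenceGraph.Adj x y) :
    ∃ g : Γ.Collineation, ∀ x, g • x = e x := by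
  have he' : ∀ x, (e.symm x).isLeft = x.isLeft := fun x => by
    rw [← he, e.apply_symm_apply]
  have hl : ∀ p : P, ∃ q : P, e (.inl p) = .inl q := fun p => by
    have := he (.inl p)
    rw [Sum.isLeft_inl, Sum.isLeft_iff] at this
    exact this
  have hl' : ∀ p : P, ∃ q : P, e.symm (.inl p) = .inl q := fun p => by
    have := he' (.inl p)
    rw [Sum.isLeft_inl, Sum.isLeft_iff] at this
    exact this
  have hr : ∀ p : L, ∃ q : L, e (.inr p) = .inr q := fun p => by
    have := he (.inr p)
    rw [Sum.isLeft_inr, Sum.isLeft_eq_false, Sum.isRight_iff] at this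
    exact this
  have hr' : ∀ p : L, ∃ q : L, e.symm (.inr p) = .inr q := fun p => by
    have := he' (.inr p)
    rw [Sum.isLeft_inr, Sum.isLeft_eq_false, Sum.isRight_iff] at this
    exact this
  choose f hf using hl
  choose f' hf' using hl'
  choose k hk using hr
  choose k' hk' using hr'
  let eP : Equiv.Perm P :=
    { toFun := f
      invFun := f'
      left_inv := fun p => Sum.inl_injective (β := L) (by rw [← hf', ← hf, e.symm_apply_apply])
      right_inv := fun p => Sum.inl_injective (β := L) (by rw [← hf, ← hf', e.apply_symm_apply]) }
  let eL : Equiv.Perm L :=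
    { toFun := k
      invFun := k'
      left_inv := fun p => Sum.inr_injective (α := P) (by rw [← hk', ← hk, e.symm_apply_apply])
      right_inv := fun p => Sum.inr_injective (α := P) (by rw [← hk, ← hk', e.apply_symm_apply]) }
  refine ⟨⟨(eP, eL), fun p l => ?_⟩, ?_⟩
  · have := hadj (.inl p) (.inr l)
    rw [hf, hk] at this
    exact this
  · rintro (p | l)
    · exact (hf p).symm
    · exact (hk l).symm

end PointLineGeometry

namespace HexagonCoordinates

variable {P : Type u} {L : Type v} {Γ : PointLineGeometry P L}
  {F : Type w} {J : Type z} [Field F] [AddCommGroup J] [Module F J]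
  {S : HexagonalSystem F J}

/-- Fixing `A j` means that certain coordinates vanish, and which ones depends on `j` alone: initial
factors x₁, x₂, … when `A j` is reached from `A 7` through `A 8`, final factors x₆, x₅, … when it is
reached from `A 6` through `A 5`. This condition does not see the coordinate system. -/
theorem smul_eq_of_smul_eq (hΓ : Γ.IsMoufangHexagon) (X X' : HexagonCoordinates Γ S)
    (hA : X.A = X'.A) {a₁ : J} {t : F} {a : J} {r : F} {b : J} {u : F} (j : ZMod 12)
    (h : (X.rd.x₁ a₁ * X.rd.W t a r b u) • X.A j = X.A j) :
    (X'.rd.x₁ a₁ * X'.rd.W t a r b u) • X.A j = X.A j := by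
  have z₁ := X'.rd.x₁_zero
  have z₂ := X'.rd.x₂_zero
  have z₃ := X'.rd.x₃_zero
  have z₄ := X'.rd.x₄_zero
  have z₅ := X'.rd.x₅_zero
  have z₆ := X'.rd.x₆_zero
  have h7 : (X.rd.x₁ a₁ * X.rd.W t a r b u) • X.A 7 = X.A 7 := by
    rw [mul_smul, X.W_smul 7 (by decide), X.fix₁ a₁ 7]
  have up := fun (n : ℕ) (hn : n ≤ 5)
      (h : (X.rd.x₁ a₁ * X.rd.W t a r b u) • X.A (7 + n) = X.A (7 + n)) =>
    X.isApartment.smul_eq_between hΓ.hexagon hn h7 h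
  have h6 : (X.rd.x₁ a₁ * X.rd.W t a r b u) • X.A 6 = X.A 6 := by
    rw [mul_smul, X.W_smul 6 (by decide), X.fix₁ a₁ 6]
  have dn := fun (j : ZMod 12) (n : ℕ) (hn : n ≤ 5) (hj : j + n = 6)
      (h : (X.rd.x₁ a₁ * X.rd.W t a r b u) • X.A j = X.A j) =>
    X.isApartment.smul_eq_between hΓ.hexagon hn h (by rw [hj]; exact h6)
  have u1 : (X.rd.x₁ a₁ * X.rd.W t a r b u) • X.A 8 = X.A 8 → a₁ = 0 := fun h =>
    X.free₁ hΓ (by rwa [mul_smul, X.W_smul_eight] at h)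
  have e1 : ∀ g : Γ.Collineation, X.rd.x₁ 0 * g = g := fun g => by rw [X.rd.x₁_zero, one_mul]
  have u2 : (X.rd.x₁ 0 * X.rd.W t a r b u) • X.A 9 = X.A 9 → t = 0 := fun h =>
    X.free₂ hΓ (by rwa [e1, X.W_smul_nine] at h)
  have u3 : (X.rd.x₁ 0 * X.rd.W 0 a r b u) • X.A 10 = X.A 10 → a = 0 := fun h =>
    X.free₃ hΓ (by rwa [e1, X.W_smul_ten, X.rd.x₂_zero, one_smul] at h)
  have u4 : (X.rd.x₁ 0 * X.rd.W 0 0 r b u) • X.A 11 = X.A 11 → r = 0 := fun h =>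
    X.free₄ hΓ (by
      rwa [e1, X.W_smul_eleven, X.rd.x₂_zero, one_smul, X.rd.x₃_zero, one_smul] at h)
  have u5 : (X.rd.x₁ 0 * X.rd.W 0 0 0 b u) • X.A 0 = X.A 0 → b = 0 := fun h =>
    X.free₅ hΓ (by
      rwa [e1, X.W_smul_zero, X.rd.x₂_zero, one_smul, X.rd.x₃_zero, one_smul, X.rd.x₄_zero,
        one_smul] at h)
  have hj : j = 0 ∨ j = 1 ∨ j = 2 ∨ j = 3 ∨ j = 4 ∨ j = 5 ∨ j = 6 ∨ j = 7 ∨ j = 8 ∨ j = 9 ∨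
      j = 10 ∨ j = 11 := by
    clear h
    revert j
    decide
  rcases hj with rfl | rfl | rfl | rfl | rfl | rfl | rfl | rfl | rfl | rfl | rfl | rfl
  · have H := up 5 (by omega) h
    obtain rfl := u1 (H 1 (by omega))
    obtain rfl := u2 (H 2 (by omega))
    obtain rfl := u3 (H 3 (by omega))
    obtain rfl := u4 (H 4 (by omega))
    obtain rfl := u5 (H 5 (by omega))
    rw [hA, z₁, one_mul, X'.W_smul_zero, z₂, z₃, z₄, z₅]
    simp only [one_smul]
  · have H := dn 1 5 (by omega) (by decide) h
    obtain rfl := X.eq_zero_of_smul_five hΓ (H 4 (by omega))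
    obtain rfl := X.eq_zero_of_smul_four hΓ (H 3 (by omega))
    obtain rfl := X.eq_zero_of_smul_three hΓ (H 2 (by omega))
    obtain rfl := X.eq_zero_of_smul_two hΓ (H 1 (by omega))
    obtain rfl := X.eq_zero_of_smul_one hΓ h
    rw [hA, ← X'.rd.x₂_eq, z₂, mul_one, X'.fix₁ a₁ 1]
  · have H := dn 2 4 (by omega) (by decide) h
    obtain rfl := X.eq_zero_of_smul_five hΓ (H 3 (by omega))
    obtain rfl := X.eq_zero_of_smul_four hΓ (H 2 (by omega))
    obtain rfl := X.eq_zero_of_smul_three hΓ (H 1 (by omega))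
    obtain rfl := X.eq_zero_of_smul_two hΓ h
    rw [hA, ← X'.rd.x₂_eq, mul_smul, X'.fix₂ t 2, X'.fix₁ a₁ 2]
  · have H := dn 3 3 (by omega) (by decide) h
    obtain rfl := X.eq_zero_of_smul_five hΓ (H 2 (by omega))
    obtain rfl := X.eq_zero_of_smul_four hΓ (H 1 (by omega))
    obtain rfl := X.eq_zero_of_smul_three hΓ h
    simp only [hA, RootData.W, z₄, z₅, z₆, mul_one, mul_smul]
    rw [X'.fix₃ a 3, X'.fix₂ t 3, X'.fix₁ a₁ 3]
  · have H := dn 4 2 (by omega) (by decide) h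
    obtain rfl := X.eq_zero_of_smul_five hΓ (H 1 (by omega))
    obtain rfl := X.eq_zero_of_smul_four hΓ h
    simp only [hA, RootData.W, z₅, z₆, mul_one, mul_smul]
    rw [X'.fix₄ r 4, X'.fix₃ a 4, X'.fix₂ t 4, X'.fix₁ a₁ 4]
  · obtain rfl := X.eq_zero_of_smul_five hΓ h
    simp only [hA, RootData.W, z₆, mul_one, mul_smul]
    rw [X'.fix₅ b 5, X'.fix₄ r 5, X'.fix₃ a 5, X'.fix₂ t 5, X'.fix₁ a₁ 5]
  · rw [hA, mul_smul, X'.W_smul 6 (by decide), X'.fix₁ a₁ 6]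
  · rw [hA, mul_smul, X'.W_smul 7 (by decide), X'.fix₁ a₁ 7]
  · obtain rfl := u1 h
    rw [hA, z₁, one_mul, X'.W_smul_eight]
  · have H := up 2 (by omega) h
    obtain rfl := u1 (H 1 (by omega))
    obtain rfl := u2 h
    rw [hA, z₁, one_mul, X'.W_smul_nine, z₂, one_smul]
  · have H := up 3 (by omega) h
    obtain rfl := u1 (H 1 (by omega))
    obtain rfl := u2 (H 2 (by omega))
    obtain rfl := u3 h
    rw [hA, z₁, one_mul, X'.W_smul_ten, z₂, z₃, one_smul, one_smul]
  · have H := up 4 (by omega) h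
    obtain rfl := u1 (H 1 (by omega))
    obtain rfl := u2 (H 2 (by omega))
    obtain rfl := u3 (H 3 (by omega))
    obtain rfl := u4 h
    rw [hA, z₁, one_mul, X'.W_smul_eleven, z₂, z₃, z₄, one_smul, one_smul, one_smul]

/-- The distances to `A 6` and `A 7` together tell the twelve elements of the apartment apart. -/
theorem eq_of_smul_eq (hΓ : Γ.IsMoufangHexagon) (X : HexagonCoordinates Γ S) {g : Γ.Collineation}
    (h6 : g • X.A 6 = X.A 6) (h7 : g • X.A 7 = X.A 7) {j k : ZMod 12}
    (h : g • X.A j = X.A k) : j = k := by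
  have d6 := smul_dist hΓ.hexagon g (X.A 6) (X.A j)
  have d7 := smul_dist hΓ.hexagon g (X.A 7) (X.A j)
  rw [h6, h, X.isApartment.dist_eq hΓ.hexagon, X.isApartment.dist_eq hΓ.hexagon] at d6
  rw [h7, h, X.isApartment.dist_eq hΓ.hexagon, X.isApartment.dist_eq hΓ.hexagon] at d7
  clear h
  revert j k
  decide

/-- Every `A j` is an end of a root whose root group is one of U₁, …, U₆, namely U_j or U_{j−6}, and
that group is transitive on all neighbours but one. Working in the product group keeps the matching
element for `X'` at hand. -/
theorem exists_adj_eq (hΓ : Γ.IsMoufangHexagon) (X X' : HexagonCoordinates Γ S) (j : ZMod 12)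
    {y : P ⊕ L} (hy : Γ.incidenceGraph.Adj (X.A j) y) :
    ∃ g ∈ (X.rd.prod X'.rd).unip, g.1 • X.A j = X.A j ∧
      (y = g.1 • X.A (j + 1) ∨ y = g.1 • X.A (j - 1)) := by
  have gen : ∀ i : ZMod 12, 1 ≤ i.val → i.val ≤ 6 → ∀ g ∈ Γ.rootGroup X.A i,
      ∃ u ∈ (X.rd.prod X'.rd).unip, u.1 = g := by
    intro i h1 h6 g hg
    have hi : i = 1 ∨ i = 2 ∨ i = 3 ∨ i = 4 ∨ i = 5 ∨ i = 6 := by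
      clear hg
      revert i
      decide
    rcases hi with rfl | rfl | rfl | rfl | rfl | rfl
    · obtain ⟨c, rfl⟩ := X.surj₁ hg
      exact ⟨_, (X.rd.prod X'.rd).x₁_mem c, rfl⟩
    · obtain ⟨c, rfl⟩ := X.surj₂ hg
      exact ⟨_, (X.rd.prod X'.rd).x₂_mem c, rfl⟩
    · obtain ⟨c, rfl⟩ := X.surj₃ hg
      exact ⟨_, (X.rd.prod X'.rd).x₃_mem c, rfl⟩
    · obtain ⟨c, rfl⟩ := X.surj₄ hg
      exact ⟨_, (X.rd.prod X'.rd).x₄_mem c, rfl⟩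
    · obtain ⟨c, rfl⟩ := X.surj₅ hg
      exact ⟨_, (X.rd.prod X'.rd).x₅_mem c, rfl⟩
    · obtain ⟨c, rfl⟩ := X.surj₆ hg
      exact ⟨_, (X.rd.prod X'.rd).x₆_mem c, rfl⟩
  have prev := X.isApartment.2 (j - 1)
  rw [sub_add_cancel] at prev
  have key : ∀ j : ZMod 12, (1 ≤ j.val ∧ j.val ≤ 6) ∨ (1 ≤ (j - 6).val ∧ (j - 6).val ≤ 6) := by
    decide
  rcases key j with ⟨h1, h6⟩ | ⟨h1, h6⟩
  · by_cases hne : y = X.A (j + 1)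
    · exact ⟨1, Subgroup.one_mem _, one_smul _ _, Or.inl (by rw [hne]; exact (one_smul _ _).symm)⟩
    · obtain ⟨g, hg, e⟩ := hΓ.moufang X.A X.isApartment j (X.A (j - 1)) y prev.symm (by
        have := X.isApartment.ne_add_two (j - 1)
        rw [show j - 1 + 2 = j + 1 by ring] at this
        exact this.symm) hy hne
      obtain ⟨u, hu, rfl⟩ := gen j h1 h6 g hg
      exact ⟨u, hu, smul_of_mem_rootGroup X.isApartment hg j (by simp), Or.inr e.symm⟩
  · by_cases hne : y = X.A (j - 1)
    · exact ⟨1, Subgroup.one_mem _, one_smul _ _, Or.inr (by rw [hne]; exact (one_smul _ _).symm)⟩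
    · obtain ⟨g, hg, e⟩ := hΓ.moufang' X.isApartment (j - 6) (x := X.A (j + 1)) (y := y)
        (by rw [sub_add_cancel]; exact X.isApartment.2 j) (by
          have := X.isApartment.ne_add_two (j - 1)
          rw [show j - 1 + 2 = j + 1 by ring] at this
          rwa [show j - 6 + 5 = j - 1 by ring])
        (by rwa [sub_add_cancel]) (by rwa [show j - 6 + 5 = j - 1 by ring])
      obtain ⟨u, hu, rfl⟩ := gen (j - 6) h1 h6 g hg
      exact ⟨u, hu, smul_of_mem_rootGroup X.isApartment hg j (by
        rw [sub_sub_cancel]; decide), Or.inl e.symm⟩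

theorem exists_eq_smul (hΓ : Γ.IsMoufangHexagon) (X X' : HexagonCoordinates Γ S) (x : P ⊕ L) :
    ∃ g ∈ (X.rd.prod X'.rd).unip, ∃ j, x = g.1 • X.A j := by
  obtain ⟨y, hy⟩ : ∃ y, y = X.A 0 := ⟨_, rfl⟩
  obtain ⟨p⟩ := hΓ.hexagon.connected.preconnected x y
  induction p with
  | nil => exact ⟨1, Subgroup.one_mem _, 0, by rw [hy]; exact (one_smul _ _).symm⟩
  | cons hxy _ ih =>
    obtain ⟨g, hg, j, rfl⟩ := ih hy
    rename_i x _ _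
    have hadj := (smul_adj g.1⁻¹).2 hxy.symm
    rw [inv_smul_smul] at hadj
    obtain ⟨u, hu, -, h | h⟩ := exists_adj_eq hΓ X X' j hadj
    · exact ⟨g * u, Subgroup.mul_mem _ hg hu, j + 1, by
        rw [Prod.fst_mul, mul_smul, ← h, smul_inv_smul]⟩
    · exact ⟨g * u, Subgroup.mul_mem _ hg hu, j - 1, by
        rw [Prod.fst_mul, mul_smul, ← h, smul_inv_smul]⟩

/-- The part of `exists_collineation_of_coordinates` that is not symmetric in `X` and `X'`. -/
theorem exists_map_of_coordinates (hΓ : Γ.IsMoufangHexagon) (X X' : HexagonCoordinates Γ S)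
    (hA : X.A = X'.A) :
    ∃ f : P ⊕ L → P ⊕ L, (∀ g ∈ (X.rd.prod X'.rd).unip, ∀ j, f (g.1 • X.A j) = g.2 • X.A j) ∧
      (∀ x, (f x).isLeft = x.isLeft) ∧
      ∀ x y, Γ.incidenceGraph.Adj x y → Γ.incidenceGraph.Adj (f x) (f y) := by
  -- This makes the assignment g.1 • A j ↦ g.2 • A j independent of the chosen representative.
  have wd : ∀ g ∈ (X.rd.prod X'.rd).unip, ∀ j k, g.1 • X.A j = X.A k → g.2 • X.A j = X.A k := by
    intro g hg j k h
    obtain ⟨a₁, t, a, r, b, u, rfl⟩ := (X.rd.prod X'.rd).exists_normalForm hg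
    change (X.rd.x₁ a₁ * X.rd.W t a r b u) • X.A j = X.A k at h
    change (X'.rd.x₁ a₁ * X'.rd.W t a r b u) • X.A j = X.A k
    obtain rfl := X.eq_of_smul_eq hΓ (by rw [mul_smul, X.W_smul 6 (by decide), X.fix₁ a₁ 6])
      (by rw [mul_smul, X.W_smul 7 (by decide), X.fix₁ a₁ 7]) h
    exact smul_eq_of_smul_eq hΓ X X' hA j h
  choose γ hγ ι hι using exists_eq_smul hΓ X X'
  have hf : ∀ g ∈ (X.rd.prod X'.rd).unip, ∀ j,
      (γ (g.1 • X.A j)).2 • X.A (ι (g.1 • X.A j)) = g.2 • X.A j := by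
    intro g hg j
    have := wd ((γ (g.1 • X.A j))⁻¹ * g) (Subgroup.mul_mem _ (Subgroup.inv_mem _ (hγ _)) hg) j
      (ι (g.1 • X.A j)) (by
        rw [Prod.fst_mul, mul_smul, Prod.fst_inv, inv_smul_eq_iff]
        exact hι (g.1 • X.A j))
    rw [← this, Prod.snd_mul, mul_smul, Prod.snd_inv, smul_inv_smul]
  refine ⟨fun x => (γ x).2 • X.A (ι x), hf, ?_, ?_⟩
  · intro x
    conv_rhs => rw [hι x]
    rw [isLeft_smul, isLeft_smul]
  · intro x y hxy
    obtain ⟨g, hg, j, rfl⟩ := exists_eq_smul hΓ X X' x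
    have hadj := (smul_adj g.1⁻¹).2 hxy
    rw [inv_smul_smul] at hadj
    obtain ⟨u, hu, hj, h⟩ := exists_adj_eq hΓ X X' j hadj
    have hgu := Subgroup.mul_mem _ hg hu
    have hx : g.1 • X.A j = (g * u).1 • X.A j := by rw [Prod.fst_mul, mul_smul, hj]
    rw [inv_smul_eq_iff, inv_smul_eq_iff, ← mul_smul, ← mul_smul, ← Prod.fst_mul] at h
    rw [hx]
    rcases h with rfl | rfl
    · simp only [hf _ hgu]
      exact (smul_adj _).2 (X.isApartment.2 j)
    · simp only [hf _ hgu]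
      have := X.isApartment.2 (j - 1)
      rw [sub_add_cancel] at this
      exact (smul_adj _).2 this.symm

/-- Two systems of coordinates on the same apartment differ by a collineation. -/
theorem exists_collineation_of_coordinates (hΓ : Γ.IsMoufangHexagon)
    (X X' : HexagonCoordinates Γ S) (hA : X.A = X'.A) :
    ∃ g : Γ.Collineation, (∀ j, g • X.A j = X.A j) ∧
      ∀ c j, g • X.rd.x₁ c • X.A j = X'.rd.x₁ c • X.A j := by
  obtain ⟨f, hf, hf1, hf2⟩ := exists_map_of_coordinates hΓ X X' hA
  obtain ⟨f', hf', -, hf2'⟩ := exists_map_of_coordinates hΓ X' X hA.symm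
  have left : ∀ x, f' (f x) = x := by
    intro x
    obtain ⟨g, hg, j, rfl⟩ := exists_eq_smul hΓ X X' x
    rw [hf g hg, hA]
    exact hf' _ (RootData.swap_mem_unip _ _ hg) j
  have right : ∀ x, f (f' x) = x := by
    intro x
    obtain ⟨g, hg, j, rfl⟩ := exists_eq_smul hΓ X' X x
    rw [hf' g hg, ← hA]
    exact hf _ (RootData.swap_mem_unip _ _ hg) j
  obtain ⟨g, hg⟩ := exists_collineation (Γ := Γ) ⟨f, f', left, right⟩ hf1 (fun x y =>
    ⟨fun h => by
      have := hf2' _ _ h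
      rwa [Equiv.coe_fn_mk, left, left] at this, hf2 x y⟩)
  refine ⟨g, fun j => ?_, fun c j => ?_⟩
  · rw [hg]
    have := hf 1 (Subgroup.one_mem _) j
    rw [Prod.fst_one, Prod.snd_one, one_smul] at this
    exact this
  · rw [hg]
    exact hf _ ((X.rd.prod X'.rd).x₁_mem c) j

end HexagonCoordinates

/-! ### Inverses in hexagonal systems. -/

namespace HexagonalSystem

variable {F : Type w} {J : Type z} [Field F] [AddCommGroup J] [Module F J]
  (S : HexagonalSystem F J)

theorem adj_ne_zero {a : J} (ha : a ≠ 0) : S.adj a ≠ 0 := fun h => by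
  have := S.norm_adj a
  rw [h, S.norm_zero] at this
  exact S.norm_ne_zero ha ((pow_eq_zero_iff two_ne_zero).1 this.symm)

theorem norm_inv {a : J} (ha : a ≠ 0) : S.norm (S.inv a) = (S.norm a)⁻¹ := by
  have := S.norm_ne_zero ha
  rw [inv, S.norm_smul, S.norm_adj]
  field_simp

theorem adj_inv {a : J} (ha : a ≠ 0) : S.adj (S.inv a) = (S.norm a)⁻¹ • a := by
  have := S.norm_ne_zero ha
  rw [inv, S.adj_smul, S.adj_adj, smul_smul]
  congr 1
  field_simp

theorem inv_inv {a : J} (ha : a ≠ 0) : S.inv (S.inv a) = a := by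
  have := S.norm_ne_zero ha
  rw [inv, S.norm_inv ha, S.adj_inv ha, smul_smul, _root_.inv_inv, mul_inv_cancel₀ this, one_smul]

theorem inv_ne_zero {a : J} (ha : a ≠ 0) : S.inv a ≠ 0 := fun h => by
  have := S.norm_inv ha
  rw [h, S.norm_zero] at this
  exact _root_.inv_ne_zero (S.norm_ne_zero ha) this.symm

theorem inv_one : S.inv S.one = S.one := by
  rw [inv, S.norm_one, S.adj_one, _root_.inv_one, one_smul]

theorem inv_neg (a : J) : S.inv (-a) = -S.inv a := by
  rw [inv, inv, S.norm_neg, S.adj_neg, _root_.inv_neg, neg_smul]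

end HexagonalSystem

/-! ### The opposite root group U₇ and the reflection s₁. -/

namespace HexagonCoordinates

variable {P : Type u} {L : Type v} {Γ : PointLineGeometry P L}
  {F : Type w} {J : Type z} [Field F] [AddCommGroup J] [Module F J]
  {S : HexagonalSystem F J} (X : HexagonCoordinates Γ S) (hΓ : Γ.IsMoufangHexagon)
include hΓ

omit hΓ in
theorem A_ne {i j : ZMod 12} (h : i ≠ j) : X.A i ≠ X.A j := fun e => h (X.isApartment.1 e)

omit hΓ in
theorem adj_seven_eight : Γ.incidenceGraph.Adj (X.A 7) (X.A 8) := X.isApartment.2 7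

omit hΓ in
theorem adj_seven_six : Γ.incidenceGraph.Adj (X.A 7) (X.A 6) := (X.isApartment.2 6).symm

theorem exists_x₁_smul {y : P ⊕ L} (h : Γ.incidenceGraph.Adj (X.A 7) y) (hy : y ≠ X.A 6) :
    ∃ a, X.rd.x₁ a • X.A 8 = y := by
  obtain ⟨g, hg, e⟩ := hΓ.moufang' X.isApartment 1 (x := X.A 8) (y := y) X.adj_seven_eight
    (X.A_ne (by decide)) h hy
  obtain ⟨a, rfl⟩ := X.surj₁ hg
  exact ⟨a, e⟩

/-- A collineation that maps `A 6` to `A 8` and fixes `A 1` reflects the path between them. -/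
theorem smul_flip {g : Γ.Collineation} (h6 : g • X.A 6 = X.A 8) (h1 : g • X.A 1 = X.A 1)
    {k : ℕ} (hk : k ≤ 5) : g • X.A (6 - k) = X.A (8 + k) := by
  have h := ((X.isApartment.smul g).reflect 14).eq_between X.isApartment hΓ.hexagon
    (i := 8) (n := 5) le_rfl h6 h1 k hk
  rw [← h]
  congr 2
  ring

theorem smul_flip' {g : Γ.Collineation} (h8 : g • X.A 8 = X.A 6) (h1 : g • X.A 1 = X.A 1)
    {k : ℕ} (hk : k ≤ 5) : g • X.A (8 + k) = X.A (6 - k) := by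
  have := X.smul_flip hΓ (g := g⁻¹) (inv_smul_eq_iff.2 h8.symm) (inv_smul_eq_iff.2 h1.symm) hk
  rw [← this, smul_inv_smul]

theorem smul_eq_of_reflection {g : Γ.Collineation} (h6 : g • X.A 6 = X.A 8)
    (h8 : g • X.A 8 = X.A 6) (h7 : g • X.A 7 = X.A 7) (h1 : g • X.A 1 = X.A 1) (j : ZMod 12) :
    g • X.A j = X.A (2 - j) := by
  have h12 : (12 : ZMod 12) = 0 := rfl
  revert j
  refine forall_zmod12 7 fun k hk => ?_
  by_cases hk0 : k = 0
  · subst hk0; exact h7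
  by_cases hk6 : k ≤ 6
  · have := X.smul_flip' hΓ h8 h1 (k := k - 1) (by omega)
    rw [Nat.cast_sub (by omega)] at this
    convert this using 2
    · congr 1; push_cast; ring
    · push_cast; linear_combination -h12
  · have := X.smul_flip hΓ h6 h1 (k := 11 - k) (by omega)
    rw [Nat.cast_sub (by omega)] at this
    convert this using 2
    · congr 1; push_cast; linear_combination h12
    · push_cast; linear_combination -2 * h12

omit hΓ in
theorem conj_mem_of_reflection {s g : Γ.Collineation} (hs : ∀ j, s • X.A j = X.A (2 - j))
    {i : ZMod 12} (i' : ZMod 12) (hi : i' = 8 - i) (hg : g ∈ Γ.rootGroup X.A i) :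
    s * g * s⁻¹ ∈ Γ.rootGroup X.A i' := by
  refine conj_mem_rootGroup hg fun k h1 h5 => ⟨6 - k, by omega, by omega, ?_⟩
  rw [hs, hi, Nat.cast_sub (by omega)]
  congr 1
  push_cast
  have h12 : (12 : ZMod 12) = 0 := rfl
  linear_combination h12

section opposite

variable {v : Γ.Collineation} (hv : v ∈ Γ.rootGroup X.A 7)
include hv

omit hΓ in
-- This element is a neighbour of `A 8`, an interior element of the root of U₇. The next two lemmas
-- use `A 9` and `A 0` in the same way; such fixed elements allow coordinates to be compared before
-- and after conjugation by `v`.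
theorem smul_x₂_nine (t : F) : v • X.rd.x₂ t • X.A 9 = X.rd.x₂ t • X.A 9 := by
  refine smul_of_mem_rootGroup_of_adj hv 8 (by decide) ?_
  have := (smul_adj (X.rd.x₂ t)).2 (X.isApartment.2 8)
  rwa [X.fix₂ t 8] at this

omit hΓ in
theorem smul_x₃_ten (a : J) : v • X.rd.x₃ a • X.A 10 = X.rd.x₃ a • X.A 10 := by
  refine smul_of_mem_rootGroup_of_adj hv 9 (by decide) ?_
  have := (smul_adj (X.rd.x₃ a)).2 (X.isApartment.2 9)
  rwa [X.fix₃ a 9] at this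

omit hΓ in
theorem smul_x₆_one (t : F) : v • X.rd.x₆ t • X.A 1 = X.rd.x₆ t • X.A 1 := by
  refine smul_of_mem_rootGroup_of_adj hv 0 (by decide) ?_
  have := (smul_adj (X.rd.x₆ t)).2 (X.isApartment.2 0)
  rwa [X.fix₆ t 0] at this

omit hv in
theorem x₂_smul_inj {t t' : F} (h : X.rd.x₂ t • X.A 9 = X.rd.x₂ t' • X.A 9) : t = t' := by
  rw [← sub_eq_zero]
  refine X.free₂ hΓ ?_
  rw [sub_eq_neg_add, X.rd.add₂, mul_smul, h, X.rd.x₂_neg, inv_smul_smul]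

omit hv in
theorem x₃_smul_inj {t t' : J} (h : X.rd.x₃ t • X.A 10 = X.rd.x₃ t' • X.A 10) : t = t' := by
  rw [← sub_eq_zero]
  refine X.free₃ hΓ ?_
  rw [sub_eq_neg_add, X.rd.add₃, mul_smul, h, X.rd.x₃_neg, inv_smul_smul]

omit hv in
theorem x₆_smul_inj {t t' : F} (h : X.rd.x₆ t • X.A 1 = X.rd.x₆ t' • X.A 1) : t = t' := by
  rw [← sub_eq_zero]
  refine X.free₆ hΓ ?_
  rw [sub_eq_neg_add, X.rd.add₆, mul_smul, h, X.rd.x₆_neg, inv_smul_smul]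

/-- Since x₁(e)⁻¹ v maps `A 6` to `A 8` and fixes `A 1`, it carries U₂ to U₆; the action on `A 9`
then determines the parameter. -/
theorem conj_x₂ {e : J} (he : v • X.A 6 = X.rd.x₁ e • X.A 8) (t : F) :
    ∃ τ, t = -(τ * S.norm e) ∧ v * X.rd.x₂ t * v⁻¹ = X.rd.x₁ e * X.rd.x₆ τ * (X.rd.x₁ e)⁻¹ := by
  have hvA : ∀ j : ZMod 12, (j - 7).val ≤ 6 → v • X.A j = X.A j :=
    smul_of_mem_rootGroup X.isApartment hv
  have hh : ((X.rd.x₁ e)⁻¹ * v) • X.A 6 = X.A 8 := by rw [mul_smul, he, inv_smul_smul]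
  have hh1 : ((X.rd.x₁ e)⁻¹ * v) • X.A 1 = X.A 1 := by
    rw [mul_smul, hvA 1 (by decide), inv_smul_eq_iff, X.fix₁ e 1]
  have hh7 : ((X.rd.x₁ e)⁻¹ * v) • X.A 7 = X.A 7 := by
    rw [mul_smul, hvA 7 (by decide), inv_smul_eq_iff, X.fix₁ e 7]
  have hf := fun k hk => X.smul_flip hΓ hh hh1 (k := k) hk
  have hm : ((X.rd.x₁ e)⁻¹ * v) * X.rd.x₂ t * ((X.rd.x₁ e)⁻¹ * v)⁻¹ ∈ Γ.rootGroup X.A 6 := by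
    refine conj_mem_rootGroup (X.mem₂ t) fun k h1 h5 => ⟨6 - k, by omega, by omega, ?_⟩
    interval_cases k
    · exact hh7.symm
    · exact hh.symm
    · exact (hf 1 (by omega)).symm
    · exact (hf 2 (by omega)).symm
    · exact (hf 3 (by omega)).symm
  obtain ⟨τ, hτ⟩ := X.surj₆ hm
  have h2 : v * X.rd.x₂ t * v⁻¹ = X.rd.x₁ e * X.rd.x₆ τ * (X.rd.x₁ e)⁻¹ := by rw [hτ]; group
  refine ⟨τ, X.x₂_smul_inj hΓ ?_, h2⟩
  have h3 : (v * X.rd.x₂ t * v⁻¹) • X.A 9 = X.rd.x₂ t • X.A 9 := by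
    rw [mul_smul, mul_smul, inv_smul_eq_iff.2 (hvA 9 (by decide)).symm, X.smul_x₂_nine hv]
  rw [← h3, h2, X.rd.conj₆, X.W_smul_nine]

theorem smul_x₂_x₃_ten {e : J} (he : v • X.A 6 = X.rd.x₁ e • X.A 8) (he0 : e ≠ 0) (b : J) :
    v • X.rd.x₂ 1 • X.rd.x₃ b • X.A 10 = X.rd.x₂ 1 • X.rd.x₃ (S.inv e + b) • X.A 10 := by
  have hN := S.norm_ne_zero he0
  obtain ⟨τ, h1, h2⟩ := X.conj_x₂ hΓ hv he 1
  have hτ : τ = -(S.norm e)⁻¹ := by field_simp; linear_combination h1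
  rw [← mul_smul v, show v * X.rd.x₂ 1 = v * X.rd.x₂ 1 * v⁻¹ * v by group, h2, X.rd.conj₆, ← h1,
    mul_smul, X.smul_x₃_ten hv, ← mul_smul, X.rd.W_mul_x₃, X.W_smul_ten, hτ, neg_smul, neg_neg]
  rfl

/-- Write v⁻¹ A 6 = x₁(e') A 8. On the elements x₂(1) x₃(b) A 10, `v` translates b by e⁻¹ and v⁻¹
translates it by e'⁻¹. Hence e'⁻¹ = −e⁻¹ and e' = −e. -/
theorem smul_x₁_eight {e : J} (he : v • X.A 6 = X.rd.x₁ e • X.A 8) (he0 : e ≠ 0) :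
    v • X.rd.x₁ (-e) • X.A 8 = X.A 6 := by
  have hv' := (Γ.rootGroup X.A 7).inv_mem hv
  have hv7 : v • X.A 7 = X.A 7 := smul_of_mem_rootGroup X.isApartment hv 7 (by decide)
  have hv8 : v • X.A 8 = X.A 8 := smul_of_mem_rootGroup X.isApartment hv 8 (by decide)
  have hne6 : v⁻¹ • X.A 6 ≠ X.A 6 := fun h => by
    rw [inv_smul_eq_iff, he] at h
    exact X.A_ne (show (6 : ZMod 12) ≠ 8 by decide)
      (smul_left_cancel _ ((X.fix₁ e 6).trans h))
  obtain ⟨e', he'⟩ := X.exists_x₁_smul hΓ (y := v⁻¹ • X.A 6)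
    (by have := (smul_adj v⁻¹).2 X.adj_seven_six
        rwa [inv_smul_eq_iff.2 hv7.symm] at this) hne6
  have he'0 : e' ≠ 0 := by
    rintro rfl
    rw [X.rd.x₁_zero, one_smul, eq_inv_smul_iff, hv8] at he'
    exact X.A_ne (show (8 : ZMod 12) ≠ 6 by decide) he'
  have h1 := X.smul_x₂_x₃_ten hΓ hv' he'.symm he'0 0
  rw [inv_smul_eq_iff, X.smul_x₂_x₃_ten hΓ hv he he0, add_zero] at h1
  have h2 := X.x₃_smul_inj hΓ (smul_left_cancel _ h1)
  have h3 : S.inv e' = S.inv (-e) := by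
    rw [S.inv_neg]; exact (neg_eq_of_add_eq_zero_right h2.symm).symm
  have h4 : e' = -e := by
    rw [← S.inv_inv he'0, h3, S.inv_inv (neg_ne_zero.2 he0)]
  rw [← h4, he', smul_inv_smul]

end opposite

end HexagonCoordinates

theorem map_groupComm {G H : Type*} [Group G] [Group H] (f : G →* H) (g h : G) :
    f (groupComm g h) = groupComm (f g) (f h) := by
  simp [groupComm]

theorem groupComm_inv {G : Type*} [Group G] (g h : G) : (groupComm g h)⁻¹ = groupComm h g := by
  simp [groupComm, mul_assoc]

namespace HexagonCoordinates

variable {P : Type u} {L : Type v} {Γ : PointLineGeometry P L}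
  {F : Type w} {J : Type z} [Field F] [AddCommGroup J] [Module F J]
  {S : HexagonalSystem F J} (X : HexagonCoordinates Γ S)

/-- The action of `s₁` on the root groups and on the lines through the base point. -/
structure IsReflection (s : Γ.Collineation) : Prop where
  smul : ∀ j, s • X.A j = X.A (2 - j)
  conj₂ : ∀ t, s * X.rd.x₂ t * s⁻¹ = X.rd.x₆ t
  conj₃ : ∀ a, s * X.rd.x₃ a * s⁻¹ = X.rd.x₅ a
  conj₄ : ∀ t, s * X.rd.x₄ t * s⁻¹ = X.rd.x₄ t
  conj₅ : ∀ a, s * X.rd.x₅ a * s⁻¹ = X.rd.x₃ (-a)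
  conj₆ : ∀ t, s * X.rd.x₆ t * s⁻¹ = X.rd.x₂ (-t)
  smul_x₁ : ∀ z, z ≠ 0 → s • X.rd.x₁ z • X.A 8 = X.rd.x₁ (-S.inv z) • X.A 8

variable (hΓ : Γ.IsMoufangHexagon)
include hΓ

omit hΓ in
/-- `[U₅, U₇] ≤ U₆`. -/
theorem exists_conj_x₅ {v : Γ.Collineation} (hv : v ∈ Γ.rootGroup X.A 7) (b : J) :
    ∃ ξ, v * X.rd.x₅ b * v⁻¹ = X.rd.x₆ ξ * X.rd.x₅ b := by
  suffices h : v * X.rd.x₅ b * v⁻¹ * (X.rd.x₅ b)⁻¹ ∈ Γ.rootGroup X.A 6 by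
    obtain ⟨ξ, hξ⟩ := X.surj₆ h
    exact ⟨ξ, by rw [hξ]; group⟩
  have hvA : ∀ j : ZMod 12, (j - 7).val ≤ 6 → v • X.A j = X.A j :=
    smul_of_mem_rootGroup X.isApartment hv
  -- The commutator is grouped in two ways: x₅(b) and its conjugate fix the neighbours of `A 7`, …,
  -- `A 10`, while `v` and its conjugate fix those of `A 11`.
  have e : v * X.rd.x₅ b * v⁻¹ * (X.rd.x₅ b)⁻¹ =
      v * (X.rd.x₅ b * v⁻¹ * (X.rd.x₅ b)⁻¹) := by group
  have hx := mem_rootGroup.1 ((Γ.rootGroup X.A 5).inv_mem (X.mem₅ b))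
  have hv' := mem_rootGroup.1 hv
  have h1 : ∀ n g : Γ.Collineation, ∀ j, FixesNeighbours g (X.A j) → n • X.A j = X.A j →
      FixesNeighbours (n * g * n⁻¹) (X.A j) := by
    intro n g j hg hn y hy
    have := hg (n⁻¹ • y) (by rw [← smul_adj n, hn, smul_inv_smul]; exact hy)
    rw [mul_smul, mul_smul, this, smul_inv_smul]
  rw [mem_rootGroup]
  intro k hk1 hk5
  by_cases hk : k ≤ 4
  · have a1 : FixesNeighbours (X.rd.x₅ b) (X.A (6 + k)) := fun y hy =>
      smul_of_mem_rootGroup_of_adj (X.mem₅ b) _ (by interval_cases k <;> decide) hy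
    have a2 := h1 v _ _ a1 (hvA _ (by interval_cases k <;> decide))
    intro y hy
    rw [mul_smul, inv_smul_eq_iff.2 (a1 y hy).symm, a2 y hy]
  · obtain rfl : k = 5 := by omega
    have a1 : FixesNeighbours v (X.A (6 + (5 : ℕ))) := fun y hy =>
      smul_of_mem_rootGroup_of_adj hv _ (by decide) hy
    have a3 : FixesNeighbours v⁻¹ (X.A (6 + (5 : ℕ))) := fun y hy =>
      inv_smul_eq_iff.2 (a1 y hy).symm
    have a2 := h1 (X.rd.x₅ b) _ _ a3 (X.fix₅ b _)
    intro y hy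
    rw [e, mul_smul, a2 y hy, a1 y hy]

/-- The element `s₁` exists, and its action is as expected. -/
theorem exists_isS₁ : ∃ s, X.IsS₁ s ∧ X.IsReflection s := by
  have h1 : -S.one ≠ 0 := neg_ne_zero.2 S.one_ne_zero
  -- With the parameter −1, the factor x₁(1) brings v A 6 back to A 8, so that v x₁(1) v maps A 6 to
  -- A 8.
  obtain ⟨v, hv, he⟩ := hΓ.moufang X.A X.isApartment 7 (X.A 6) (X.rd.x₁ (-S.one) • X.A 8)
    X.adj_seven_six (X.A_ne (show (6 : ZMod 12) ≠ 8 by decide))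
    (by have := (smul_adj (X.rd.x₁ (-S.one))).2 X.adj_seven_eight
        rwa [X.fix₁ _ 7] at this)
    (fun h => h1 (X.free₁ hΓ h))
  have he' : v • X.rd.x₁ S.one • X.A 8 = X.A 6 := by
    simpa using X.smul_x₁_eight hΓ hv he h1
  have hvA : ∀ j : ZMod 12, (j - 7).val ≤ 6 → v • X.A j = X.A j :=
    smul_of_mem_rootGroup X.isApartment hv
  have hviA : ∀ j : ZMod 12, (j - 7).val ≤ 6 → v⁻¹ • X.A j = X.A j := fun j hj =>
    inv_smul_eq_iff.2 (hvA j hj).symm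
  obtain ⟨s, hs⟩ : ∃ s, s = v * X.rd.x₁ S.one * v := ⟨_, rfl⟩
  have hs6 : s • X.A 6 = X.A 8 := by
    rw [hs, mul_smul, mul_smul, he, X.rd.x₁_neg, smul_inv_smul, hvA 8 (by decide)]
  have hs8 : s • X.A 8 = X.A 6 := by rw [hs, mul_smul, mul_smul, hvA 8 (by decide), he']
  have hs7 : s • X.A 7 = X.A 7 := by
    rw [hs, mul_smul, mul_smul, hvA 7 (by decide), X.fix₁ _ 7, hvA 7 (by decide)]
  have hs1 : s • X.A 1 = X.A 1 := by
    rw [hs, mul_smul, mul_smul, hvA 1 (by decide), X.fix₁ _ 1, hvA 1 (by decide)]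
  have hsA := X.smul_eq_of_reflection hΓ hs6 hs8 hs7 hs1
  have hconj : ∀ g : Γ.Collineation, s * g * s⁻¹ =
      v * (X.rd.x₁ S.one * (v * g * v⁻¹) * (X.rd.x₁ S.one)⁻¹) * v⁻¹ := by
    intro g; rw [hs]; group
  have h6 : ∀ t, v * X.rd.x₆ t * v⁻¹ = s * X.rd.x₂ t * s⁻¹ := by
    intro t
    obtain ⟨τ, e1, e2⟩ := X.conj_x₂ hΓ hv he t
    rw [S.norm_neg, S.norm_one, mul_neg, mul_one, neg_neg] at e1
    rw [hconj, e2, e1, X.rd.x₁_neg]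
    group
  have c2 : ∀ t, s * X.rd.x₂ t * s⁻¹ = X.rd.x₆ t := by
    intro t
    obtain ⟨q, hq⟩ := X.surj₆ (X.conj_mem_of_reflection hsA 6 (by decide) (X.mem₂ t))
    rw [← hq]
    congr 1
    refine X.x₆_smul_inj hΓ ?_
    rw [hq, ← h6, mul_smul, mul_smul, hviA 1 (by decide), X.smul_x₆_one hv]
  have c6 : ∀ t, s * X.rd.x₆ t * s⁻¹ = X.rd.x₂ (-t) := by
    intro t
    obtain ⟨q, hq⟩ := X.surj₂ (X.conj_mem_of_reflection hsA 2 (by decide) (X.mem₆ t))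
    rw [← hq]
    congr 1
    refine X.x₂_smul_inj hΓ ?_
    rw [hq, hconj, h6, c2, X.rd.conj₆, mul_smul, mul_smul, hviA 9 (by decide), X.W_smul_nine,
      X.smul_x₂_nine hv, S.norm_one, mul_one]
  have c4 : ∀ t, s * X.rd.x₄ t * s⁻¹ = X.rd.x₄ t := by
    intro t
    -- U₄ is reached through x₄(t) = [x₂(t), x₆(1)].
    have := map_groupComm (MulAut.conj s).toMonoidHom (X.rd.x₂ t) (X.rd.x₆ 1)
    rw [X.rd.comm₂₆, mul_one] at this
    simp only [MulEquiv.toMonoidHom_eq_coe, MonoidHom.coe_coe, MulAut.conj_apply] at this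
    rw [this, c2, c6, ← groupComm_inv, X.rd.comm₂₆, neg_mul, one_mul, X.rd.x₄_neg, inv_inv]
  have c5 : ∀ b, s * X.rd.x₅ b * s⁻¹ = X.rd.x₃ (-b) := by
    intro b
    obtain ⟨q, hq⟩ := X.surj₃ (X.conj_mem_of_reflection hsA 3 (by decide) (X.mem₅ b))
    -- The unknown ξ is determined by the action on `A 9` as T(1, b); the action on `A 10` then
    -- gives the U₃ coordinate, and the identity for 1 × b reduces it to −b.
    obtain ⟨ξ, hξ⟩ := X.exists_conj_x₅ hv b
    have e : s * X.rd.x₅ b * s⁻¹ = v * ((X.rd.x₁ S.one * X.rd.x₆ ξ * (X.rd.x₁ S.one)⁻¹) *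
        (X.rd.x₁ S.one * X.rd.x₅ b * (X.rd.x₁ S.one)⁻¹)) * v⁻¹ := by
      rw [hconj, hξ]; group
    rw [X.rd.conj₆, X.rd.conj₅, X.rd.W_mul, S.norm_one, S.adj_one, mul_one] at e
    have e9 := congrArg (· • X.A 9) (hq.trans e)
    have e10 := congrArg (· • X.A 10) (hq.trans e)
    simp only [mul_smul] at e9 e10
    rw [X.fix₃ _ 9, hviA 9 (by decide), X.W_smul_nine, X.smul_x₂_nine hv] at e9
    have hz := X.free₂ hΓ e9.symm
    rw [hviA 10 (by decide), X.W_smul_ten, hz, X.rd.x₂_zero, one_smul, X.smul_x₃_ten hv] at e10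
    have hq' := X.x₃_smul_inj hΓ e10
    have hb := S.one_cross b
    have hξ' : ξ = S.tr S.one b := by linear_combination -hz
    rw [← hq, hq', hξ', S.tr_symm]
    congr 1
    nth_rw 3 [hb]
    abel
  choose p hp using fun a => X.surj₅ (X.conj_mem_of_reflection hsA 5 (by decide) (X.mem₃ a))
  -- The element x₁(κ)⁻¹ s x₁(α) fixes `A 7`, …, `A 11`, so it normalises U₆. Comparing the
  -- conjugates of x₆(t) by x₁(κ) and by s x₁(α) yields κ = −α⁻¹ and the action of `s` on x₃ at
  -- multiples of α^#.
  have key : ∀ α, α ≠ 0 → s • X.rd.x₁ α • X.A 8 = X.rd.x₁ (-S.inv α) • X.A 8 ∧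
      ∀ t : F, p (-(t • S.adj α)) = -(t • S.adj α) := by
    intro α hα
    have hN := S.norm_ne_zero hα
    have hadj : Γ.incidenceGraph.Adj (X.A 7) (s • X.rd.x₁ α • X.A 8) := by
      have := (smul_adj s).2 ((smul_adj (X.rd.x₁ α)).2 X.adj_seven_eight)
      rwa [X.fix₁ _ 7, hs7] at this
    have hne : s • X.rd.x₁ α • X.A 8 ≠ X.A 6 := fun h =>
      hα (X.free₁ hΓ (smul_left_cancel s (h.trans hs8.symm)))
    obtain ⟨κ, hκ⟩ := X.exists_x₁_smul hΓ hadj hne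
    obtain ⟨k, hk⟩ : ∃ k, k = (X.rd.x₁ κ)⁻¹ * s * X.rd.x₁ α := ⟨_, rfl⟩
    have hk8 : k • X.A 8 = X.A 8 := by rw [hk, mul_smul, mul_smul, ← hκ, inv_smul_smul]
    have hk7 : k • X.A 7 = X.A 7 := by
      rw [hk, mul_smul, mul_smul, X.fix₁ _ 7, hs7, inv_smul_eq_iff, X.fix₁ _ 7]
    have hk1 : k • X.A 1 = X.A 1 := by
      rw [hk, mul_smul, mul_smul, X.fix₁ _ 1, hs1, inv_smul_eq_iff, X.fix₁ _ 1]
    have hkA := X.isApartment.smul_eq_between hΓ.hexagon (g := k) (i := 8) (n := 5) le_rfl hk8 hk1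
    have hkm : ∀ t, k * X.rd.x₆ t * k⁻¹ ∈ Γ.rootGroup X.A 6 := by
      refine fun t => conj_mem_rootGroup (X.mem₆ t) fun i h1 h5 => ⟨i, h1, h5, ?_⟩
      interval_cases i
      · exact hk7.symm
      · exact hk8.symm
      · exact (hkA 1 (by omega)).symm
      · exact (hkA 2 (by omega)).symm
      · exact (hkA 3 (by omega)).symm
    have hall : ∀ t : F, t = -(t * S.norm α) * S.norm κ ∧ t • α = (t * S.norm α) • S.adj κ ∧
        p (-(t • S.adj α)) = (t * S.norm α) • κ := by
      intro t
      obtain ⟨τ, hτ⟩ := X.surj₆ (hkm t)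
      have e1 : X.rd.x₁ κ * X.rd.x₆ τ * (X.rd.x₁ κ)⁻¹ =
          s * (X.rd.x₁ α * X.rd.x₆ t * (X.rd.x₁ α)⁻¹) * s⁻¹ := by rw [hτ, hk]; group
      have e2 : ∀ t a r b u, s * X.rd.W t a r b u * s⁻¹ = (s * X.rd.x₂ t * s⁻¹) *
          (s * X.rd.x₃ a * s⁻¹) * (s * X.rd.x₄ r * s⁻¹) * (s * X.rd.x₅ b * s⁻¹) *
          (s * X.rd.x₆ u * s⁻¹) := by
        intros; rw [RootData.W]; group
      rw [X.rd.conj₆, X.rd.conj₆, e2, c2, ← hp, c4, c5, c6, X.rd.x₂_eq, X.rd.x₃_eq, X.rd.x₄_eq,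
        X.rd.x₅_eq, X.rd.x₆_eq, X.rd.W_mul, X.rd.W_mul, X.rd.W_mul, X.rd.W_mul] at e1
      obtain ⟨f1, f2, -, f4, f5⟩ := X.W_inj hΓ e1
      simp only [zero_add, add_zero, neg_neg] at f1 f2 f4 f5
      subst f5
      refine ⟨by linear_combination f1, ?_, ?_⟩
      · rw [← f2, neg_smul, neg_neg]
      · rw [← f4, neg_smul, neg_neg]
    obtain ⟨h1, h2, -⟩ := hall 1
    have hNκ : S.norm κ = -(S.norm α)⁻¹ := by field_simp; linear_combination h1
    rw [one_smul, one_mul] at h2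
    have hκα : κ = -S.inv α := by
      rw [HexagonalSystem.inv]
      conv_rhs => rw [h2]
      have hN2 : S.norm (S.norm α • S.adj κ) = S.norm α := by rw [← h2]
      rw [hN2, S.adj_smul, S.adj_adj, hNκ, smul_smul, smul_smul, ← neg_smul]
      rw [show -((S.norm α)⁻¹ * S.norm α ^ 2 * -(S.norm α)⁻¹) = 1 by field_simp, one_smul]
    refine ⟨by rw [← hκ, hκα], fun t => ?_⟩
    rw [(hall t).2.2, hκα, HexagonalSystem.inv, smul_neg, smul_smul, mul_assoc,
      mul_inv_cancel₀ hN, mul_one]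
  refine ⟨s, ⟨⟨v, hv, hs⟩, hsA⟩, hsA, c2, fun a => ?_, c4, c5, c6, fun z hz => (key z hz).1⟩
  rw [← hp]
  congr 1
  by_cases ha : a = 0
  · subst ha
    have := (key S.one S.one_ne_zero).2 0
    simpa using this
  · have hN := S.norm_ne_zero ha
    -- Every nonzero a equals N(a)⁻¹ a^{##}, hence is a multiple of an adjoint.
    have h := (key (S.adj a) (S.adj_ne_zero ha)).2 (-(S.norm a)⁻¹)
    rwa [S.adj_adj, neg_smul, neg_neg, smul_smul, inv_mul_cancel₀ hN, one_smul] at h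

end HexagonCoordinates

theorem IsParametrisation.exists_conj {G M : Type*} [Group G] [AddCommGroup M] {x : M → G}
    {U : Subgroup G} (hx : IsParametrisation x U) {g : G} (hg : ∀ y ∈ U, g * y * g⁻¹ ∈ U)
    (hg' : ∀ y ∈ U, g⁻¹ * y * g ∈ U) : ∃ φ : M ≃+ M, ∀ a, g * x a * g⁻¹ = x (φ a) := by
  have mem : ∀ a, x a ∈ U := fun a => by rw [← SetLike.mem_coe, ← hx.2.2]; exact ⟨a, rfl⟩
  have surj : ∀ y ∈ U, ∃ a, x a = y := fun y hy => by
    rwa [← SetLike.mem_coe, ← hx.2.2] at hy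
  choose f hf using fun a => surj _ (hg _ (mem a))
  choose f' hf' using fun a => surj _ (hg' _ (mem a))
  refine ⟨⟨⟨f, f', fun a => hx.2.1 ?_, fun a => hx.2.1 ?_⟩, fun a b => hx.2.1 ?_⟩,
    fun a => (hf a).symm⟩
  · rw [hf', hf]; group
  · rw [hf, hf']; group
  · simp only [hf, hx.1]; group

/-! ### Collineations fixing the apartment and centralising U₄. -/

namespace HexagonalSystem

variable {F : Type w} {J : Type z} [Field F] [AddCommGroup J] [Module F J]

/-- Pairs of linear maps that preserve the structure of `S` up to the scalar `l`. -/
structure IsSimilitude (S : HexagonalSystem F J) (φ ψ : J ≃ₗ[F] J) (l : F) : Prop where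
  ne_zero : l ≠ 0
  norm : ∀ a, l ^ 2 * S.norm (φ a) = S.norm a
  adj : ∀ a, ψ (S.adj a) = l • S.adj (φ a)
  tr : ∀ a b, l * S.tr (φ a) (ψ b) = S.tr a b

namespace IsSimilitude

variable {S : HexagonalSystem F J} {φ ψ : J ≃ₗ[F] J} {l : F} (hg : S.IsSimilitude φ ψ l)
include hg

theorem cross (a b : J) : ψ (S.cross a b) = l • S.cross (φ a) (φ b) := by
  have h := hg.adj (a + b)
  rw [S.adj_add, map_add, map_add, hg.adj, hg.adj, map_add φ, S.adj_add, smul_add, smul_add] at h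
  exact add_left_cancel (add_right_cancel h)

/-- Apply the given relation to a^#, using that a is a multiple of a^{##}; the norm relation cancels
the scalars. -/
theorem adj' (a : J) : φ (S.adj a) = S.adj (ψ a) := by
  by_cases ha : a = 0
  · simp [ha, S.adj_zero]
  have hN := S.norm_ne_zero ha
  have hl := hg.ne_zero
  have h1 : ψ a = (S.norm a)⁻¹ • l • S.adj (φ (S.adj a)) := by
    rw [← hg.adj, S.adj_adj, map_smul, smul_smul, inv_mul_cancel₀ hN, one_smul]
  rw [h1, S.adj_smul, S.adj_smul, S.adj_adj, smul_smul, smul_smul]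
  have h2 := hg.norm (S.adj a)
  rw [S.norm_adj] at h2
  have h3 : (S.norm a)⁻¹ ^ 2 * (l ^ 2 * S.norm (φ (S.adj a))) = 1 := by
    rw [h2, inv_pow, inv_mul_cancel₀ (pow_ne_zero 2 hN)]
  rw [mul_assoc, h3, one_smul]

theorem cross' (a b : J) : φ (S.cross a b) = S.cross (ψ a) (ψ b) := by
  have h := hg.adj' (a + b)
  rw [S.adj_add, map_add, map_add, hg.adj', hg.adj', map_add ψ, S.adj_add] at h
  exact add_left_cancel (add_right_cancel h)


end IsSimilitude

end HexagonalSystem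

namespace HexagonCoordinates

variable {P : Type u} {L : Type v} {Γ : PointLineGeometry P L}
  {F : Type w} {J : Type z} [Field F] [AddCommGroup J] [Module F J]
  {S : HexagonalSystem F J} (X : HexagonCoordinates Γ S)

/-- `g` fixes the apartment and centralises `U₄`; its action on the root groups is given by
`φ`, `ψ` and `l`. -/
structure IsTorus (g : Γ.Collineation) (φ ψ : J ≃ₗ[F] J) (l : F) : Prop extends
    S.IsSimilitude φ ψ l where
  fix : ∀ j, g • X.A j = X.A j
  conj₁ : ∀ a, g * X.rd.x₁ a * g⁻¹ = X.rd.x₁ (φ a)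
  conj₂ : ∀ t, g * X.rd.x₂ t * g⁻¹ = X.rd.x₂ (l⁻¹ * t)
  conj₃ : ∀ a, g * X.rd.x₃ a * g⁻¹ = X.rd.x₃ (ψ a)
  conj₄ : ∀ t, g * X.rd.x₄ t * g⁻¹ = X.rd.x₄ t
  conj₅ : ∀ a, g * X.rd.x₅ a * g⁻¹ = X.rd.x₅ (l • φ a)
  conj₆ : ∀ t, g * X.rd.x₆ t * g⁻¹ = X.rd.x₆ (l * t)

/-- Conjugation induces an additive automorphism of each root group. Because U₄ is centralised, [U₂,
U₆] makes the maps on U₂ and U₆ reciprocal scalings, and [U₁, U₆] forces linearity and expresses the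
remaining maps by those on U₁ and U₃. -/
theorem exists_isTorus (hΓ : Γ.IsMoufangHexagon) {g : Γ.Collineation}
    (hg : ∀ j, g • X.A j = X.A j) (h4 : ∀ t, g * X.rd.x₄ t * g⁻¹ = X.rd.x₄ t) :
    ∃ φ ψ l, X.IsTorus g φ ψ l := by
  have hc : ∀ i, ∀ y ∈ Γ.rootGroup X.A i, g * y * g⁻¹ ∈ Γ.rootGroup X.A i := fun i y hy =>
    conj_mem_rootGroup hy fun k h1 h5 => ⟨k, h1, h5, (hg _).symm⟩
  have hc' : ∀ i, ∀ y ∈ Γ.rootGroup X.A i, g⁻¹ * y * g ∈ Γ.rootGroup X.A i := fun i y hy => by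
    have := conj_mem_rootGroup (B := X.A) (j := i) (n := g⁻¹) hy
      fun k h1 h5 => ⟨k, h1, h5, eq_inv_smul_iff.2 (hg _)⟩
    rwa [inv_inv] at this
  obtain ⟨f₁, e₁⟩ := X.param₁.exists_conj (hc 1) (hc' 1)
  obtain ⟨f₂, e₂⟩ := X.param₂.exists_conj (hc 2) (hc' 2)
  obtain ⟨f₃, e₃⟩ := X.param₃.exists_conj (hc 3) (hc' 3)
  obtain ⟨f₅, e₅⟩ := X.param₅.exists_conj (hc 5) (hc' 5)
  obtain ⟨f₆, e₆⟩ := X.param₆.exists_conj (hc 6) (hc' 6)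
  change ∀ a, g * X.rd.x₁ a * g⁻¹ = X.rd.x₁ (f₁ a) at e₁
  change ∀ a, g * X.rd.x₂ a * g⁻¹ = X.rd.x₂ (f₂ a) at e₂
  change ∀ a, g * X.rd.x₃ a * g⁻¹ = X.rd.x₃ (f₃ a) at e₃
  change ∀ a, g * X.rd.x₅ a * g⁻¹ = X.rd.x₅ (f₅ a) at e₅
  change ∀ a, g * X.rd.x₆ a * g⁻¹ = X.rd.x₆ (f₆ a) at e₆
  have hcomm : ∀ y z, g * groupComm y z * g⁻¹ = groupComm (g * y * g⁻¹) (g * z * g⁻¹) :=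
    fun y z => map_groupComm (MulAut.conj g).toMonoidHom y z
  have h26 : ∀ t u, f₂ t * f₆ u = t * u := by
    intro t u
    have := hcomm (X.rd.x₂ t) (X.rd.x₆ u)
    rw [e₂, e₆, X.rd.comm₂₆, X.rd.comm₂₆, h4] at this
    exact (X.param₄.2.1 this).symm
  have h13 : ∀ a b, f₂ (S.tr a b) = S.tr (f₁ a) (f₃ b) := by
    intro a b
    have := hcomm (X.rd.x₁ a) (X.rd.x₃ b)
    rw [e₁, e₃, X.rd.comm₁₃, X.rd.comm₁₃, e₂] at this
    exact X.param₂.2.1 this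
  have hl : f₂ 1 * f₆ 1 = 1 := by rw [h26, one_mul]
  have hl0 : f₆ 1 ≠ 0 := right_ne_zero_of_mul_eq_one hl
  have h2 : ∀ t, f₂ t = (f₆ 1)⁻¹ * t := fun t => by
    field_simp; rw [h26, mul_one]
  have h6 : ∀ t, f₆ t = f₆ 1 * t := fun t => by
    have h := h26 1 t
    rw [one_mul] at h
    linear_combination (-f₆ t) * hl + f₆ 1 * h
  have h16 : ∀ a t, f₂ (-(t * S.norm a)) = -(f₆ t * S.norm (f₁ a)) ∧
      f₃ (t • S.adj a) = f₆ t • S.adj (f₁ a) ∧ f₅ (-(t • a)) = -(f₆ t • f₁ a) := by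
    intro a t
    have := hcomm (X.rd.x₁ a) (X.rd.x₆ t)
    rw [e₁, e₆, X.rd.comm₁₆, X.rd.comm₁₆] at this
    have e : ∀ y₂ y₃ y₄ y₅ : Γ.Collineation, g * (y₂ * y₃ * y₄ * y₅) * g⁻¹ = (g * y₂ * g⁻¹) *
        (g * y₃ * g⁻¹) * (g * y₄ * g⁻¹) * (g * y₅ * g⁻¹) := by intros; group
    rw [e, e₂, e₃, e₅, h4] at this
    have hW : ∀ t a r b, X.rd.x₂ t * X.rd.x₃ a * X.rd.x₄ r * X.rd.x₅ b = X.rd.W t a r b 0 := by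
      intros; rw [RootData.W, X.rd.x₆_zero, mul_one]
    rw [hW, hW] at this
    obtain ⟨k1, k2, -, k3, -⟩ := X.W_inj hΓ this
    exact ⟨k1, k2, k3⟩
  have h5 : ∀ t a, f₅ (t • a) = (f₆ 1 * t) • f₁ a := fun t a => by
    have := (h16 a t).2.2
    rw [map_neg, neg_inj] at this
    rw [this, h6]
  have lin₁ : ∀ (t : F) a, f₁ (t • a) = t • f₁ a := by
    intro t a
    have h := h5 1 (t • a)
    rw [one_smul, mul_one, h5, mul_smul] at h
    exact (smul_right_injective J hl0 h).symm
  have hadj : ∀ a, f₃ (S.adj a) = f₆ 1 • S.adj (f₁ a) := fun a => by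
    have := (h16 a 1).2.1
    rwa [one_smul] at this
  have lin₃ : ∀ (t : F) a, f₃ (t • a) = t • f₃ a := by
    have h0 : ∀ (t : F) a, f₃ (t • S.adj a) = t • f₃ (S.adj a) := fun t a => by
      rw [hadj, (h16 a t).2.1, h6, smul_smul, mul_comm]
    intro t a
    by_cases ha : a = 0
    · subst ha; simp
    have hx : a = (S.norm a)⁻¹ • S.adj (S.adj a) := by
      rw [S.adj_adj, smul_smul, inv_mul_cancel₀ (S.norm_ne_zero ha), one_smul]
    conv_lhs => rw [hx, smul_smul, h0, mul_smul, ← h0, ← hx]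
  refine ⟨⟨⟨⟨f₁, f₁.map_add⟩, lin₁⟩, f₁.symm, f₁.left_inv, f₁.right_inv⟩,
    ⟨⟨⟨f₃, f₃.map_add⟩, lin₃⟩, f₃.symm, f₃.left_inv, f₃.right_inv⟩, f₆ 1,
    ⟨hl0, fun a => ?_, hadj, fun a b => ?_⟩, hg, e₁, fun t => by rw [e₂, h2], e₃, h4,
    fun a => ?_, fun t => by rw [e₆, h6 t]⟩
  · have := (h16 a 1).1
    rw [h2] at this
    field_simp at this
    change f₆ 1 ^ 2 * S.norm (f₁ a) = _
    linear_combination this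
  · have := h13 a b
    rw [h2] at this
    change f₆ 1 * S.tr (f₁ a) (f₃ b) = _
    rw [← this]
    field_simp
  · rw [e₅]
    have := h5 1 a
    rw [one_smul, mul_one] at this
    rw [this]
    rfl

end HexagonCoordinates

/-! ### Domestic collineations fixing an ovoid pointwise. -/

namespace PointLineGeometry

variable {P : Type u} {L : Type v} {Γ : PointLineGeometry P L}

/-- `θ` is a nontrivial point-domestic collineation that fixes the ovoid `O` pointwise. -/
structure IsDomesticFixing (Γ : PointLineGeometry P L) (θ : Γ.Collineation) (O : Set P) :
    Prop where
  ne_one : θ ≠ 1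
  domestic : Γ.IsPointDomestic θ
  ovoid : Γ.IsOvoid O
  smul : ∀ x ∈ Sum.inl '' O, θ • (x : P ⊕ L) = x

namespace IsDomesticFixing

variable {θ : Γ.Collineation} {O : Set P} (h : Γ.IsDomesticFixing θ O)
include h

theorem conj (hΓ : Γ.IsGeneralisedHexagon) (n : Γ.Collineation) :
    Γ.IsDomesticFixing (n * θ * n⁻¹) (n.1.1 '' O) := by
  have hn : ∀ p : P, n • (Sum.inl p : P ⊕ L) = Sum.inl (n.1.1 p) := fun _ => rfl
  have hd : ∀ x y : P ⊕ L, Γ.incidenceGraph.dist (n⁻¹ • x) y =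
      Γ.incidenceGraph.dist x (n • y) := fun x y => by
    rw [← smul_dist hΓ n, smul_inv_smul]
  refine ⟨fun e => h.ne_one ?_, fun p hp => ?_, ⟨?_, fun x => ?_⟩, ?_⟩
  · rwa [conj_eq_one_iff] at e
  · have hq : n⁻¹ • (Sum.inl p : P ⊕ L) = Sum.inl (n⁻¹.1.1 p) := rfl
    refine h.domestic (n⁻¹.1.1 p) ?_
    rw [← hq, Opposite, hd, ← mul_smul, ← mul_smul]
    exact hp
  · rintro _ ⟨p, hp, rfl⟩ _ ⟨q, hq, rfl⟩ hne
    rw [Opposite, ← hn, ← hn, smul_dist hΓ]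
    exact h.ovoid.1 p hp q hq fun e => hne (by rw [e])
  · obtain ⟨p, hp, hxp⟩ := h.ovoid.2 (n⁻¹ • x)
    exact ⟨_, ⟨p, hp, rfl⟩, by rwa [← hn, ← hd]⟩
  · rintro _ ⟨_, ⟨p, hp, rfl⟩, rfl⟩
    rw [← hn, mul_smul, mul_smul, inv_smul_smul, h.smul _ ⟨p, hp, rfl⟩]

theorem opposite {x y : P ⊕ L} (hx : x ∈ Sum.inl '' O) (hy : y ∈ Sum.inl '' O) (hne : x ≠ y) :
    Γ.incidenceGraph.dist x y = 6 := by
  obtain ⟨p, hp, rfl⟩ := hx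
  obtain ⟨q, hq, rfl⟩ := hy
  exact h.ovoid.1 p hp q hq fun e => hne (by rw [e])

theorem smul_ne (hΓ : Γ.IsMoufangHexagon) {x y : P ⊕ L} (hx : x ∈ Sum.inl '' O)
    (hxy : Γ.incidenceGraph.Adj x y) : θ • y ≠ y := by
  obtain ⟨p, hp, rfl⟩ := hx
  exact fun e => h.ne_one (eq_one_of_fixes_ovoid hΓ.hexagon hΓ.thick h.ovoid
    (fun q hq => h.smul _ ⟨q, hq, rfl⟩) hp hxy e)

theorem pow_three_eq_one (hΓ : Γ.IsMoufangHexagon) {x y : P ⊕ L} (hx : x ∈ Sum.inl '' O)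
    (hxy : Γ.incidenceGraph.Adj x y) (h3 : θ • θ • θ • y = y) : θ ^ 3 = 1 := by
  obtain ⟨p, hp, rfl⟩ := hx
  have e : ∀ x : P ⊕ L, θ ^ 3 • x = θ • θ • θ • x := fun x => by
    rw [pow_succ, pow_two, mul_smul, mul_smul]
  refine eq_one_of_fixes_ovoid hΓ.hexagon hΓ.thick h.ovoid (fun q hq => ?_) hp hxy
    ((e y).trans h3)
  have := h.smul _ ⟨q, hq, rfl⟩
  rw [e, this, this, this]

/-- There is an apartment through two points of the ovoid that `θ` folds. -/
theorem exists_isApartment (hΓ : Γ.IsMoufangHexagon) : ∃ A : ZMod 12 → P ⊕ L,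
    Γ.IsApartment A ∧ A 7 ∈ Sum.inl '' O ∧ A 1 ∈ Sum.inl '' O ∧ θ • A 8 = A 6 := by
  obtain ⟨x⟩ := hΓ.hexagon.nonempty
  obtain ⟨p, hp, -⟩ := h.ovoid.2 x
  obtain ⟨C, hC, ⟨i, hi⟩, -⟩ := hΓ.hexagon.exists_apartment (.inl p) (.inl p)
  -- An element opposite `p` produces a second ovoid point, since `p` itself is farther than 3 from
  -- it.
  obtain ⟨p', hp', hd⟩ := h.ovoid.2 (C (i + 6))
  have hpo : (Sum.inl p : P ⊕ L) ∈ Sum.inl '' O := ⟨p, hp, rfl⟩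
  have hpo' : (Sum.inl p' : P ⊕ L) ∈ Sum.inl '' O := ⟨p', hp', rfl⟩
  have hne : (Sum.inl p : P ⊕ L) ≠ Sum.inl p' := by
    intro e
    have := hC.dist_add hΓ.hexagon i 6 le_rfl
    rw [hi, e, SimpleGraph.dist_comm] at this
    have h6 : ((6 : ℕ) : ZMod 12) = 6 := rfl
    rw [h6] at this
    omega
  have h6 := h.opposite hpo hpo' hne
  obtain ⟨l, hl, -⟩ := hΓ.thick.exists_adj_ne_ne (.inl p) (.inl p) (.inl p)
  have hlθ := h.smul_ne hΓ hpo hl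
  have h5 := hΓ.hexagon.dist_eq_five hl h6
  -- an apartment through `l` and `p'`
  obtain ⟨D, hD, hDl, hDp⟩ : ∃ D, Γ.IsApartment D ∧ D 8 = l ∧ D 1 = .inl p' := by
    obtain ⟨D, hD, ⟨i, hi⟩, ⟨j, hj⟩⟩ := hΓ.hexagon.exists_apartment l (.inl p')
    rw [← hi, ← hj, hD.dist_eq hΓ.hexagon] at h5
    have key : ∀ i j : ZMod 12, min (j - i).val (i - j).val = 5 → 1 + (i - 8) = j ∨
        i + 8 - 1 = j := by decide
    rcases key i j h5 with e | e
    · refine ⟨_, hD.shift (i - 8), by simpa using hi, ?_⟩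
      rw [e, hj]
    · refine ⟨_, hD.reflect (i + 8), by simpa using hi, ?_⟩
      rw [e, hj]
  obtain ⟨A, hA, hA7, hA8, hA1⟩ : ∃ A, Γ.IsApartment A ∧ A 7 = .inl p ∧ A 8 = l ∧
      A 1 = .inl p' := by
    let c : ℕ → P ⊕ L := fun n => match n with
      | 0 => .inl p | 1 => D 8 | 2 => D 9 | 3 => D 10 | 4 => D 11 | 5 => D 0 | 6 => D 1 | _ => D 2
    obtain ⟨A, hA, hAc⟩ := hΓ.hexagon.exists_isApartment_of_path (c := c) (by
      intro n hn
      interval_cases n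
      · change Γ.incidenceGraph.Adj (.inl p) (D 8); rwa [hDl]
      · exact hD.2 8
      · exact hD.2 9
      · exact hD.2 10
      · exact hD.2 11
      · exact hD.2 0
      · exact hD.2 1) (by
      intro n hn
      have : n ≤ 5 := by omega
      interval_cases n
      · change D 9 ≠ .inl p
        intro e
        have := hD.dist_add hΓ.hexagon 9 4 (by omega)
        rw [e, show (9 : ZMod 12) + (4 : ℕ) = 1 by decide, hDp] at this
        omega
      · exact hD.ne_add_two 8
      · exact hD.ne_add_two 9
      · exact hD.ne_add_two 10
      · exact hD.ne_add_two 11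
      · exact hD.ne_add_two 0)
    exact ⟨_, hA.shift 5, hAc 0 (by omega), (hAc 1 (by omega)).trans hDl,
      (hAc 6 (by omega)).trans hDp⟩
  have hθ7 : θ • A 7 = A 7 := by rw [hA7, h.smul _ hpo]
  have hθ1 : θ • A 1 = A 1 := by rw [hA1, h.smul _ hpo']
  have hθ8 : θ • A 8 ≠ A 8 := by rwa [hA8]
  have hθ0 : θ • A 0 ≠ A 0 := fun e =>
    hθ8 (hA.smul_eq_between hΓ.hexagon (g := θ) (i := 7) (n := 5) le_rfl hθ7 e 1 (by omega))
  -- The half of `A` running from `A 7` to `A 1` through `A 8`, closed up by its image under θ.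
  -- There is no backtracking at the two ovoid points because θ moves `A 8` and `A 0`.
  let B : ZMod 12 → P ⊕ L := ![A 0, A 1, θ • A 0, θ • A 11, θ • A 10, θ • A 9, θ • A 8, A 7,
    A 8, A 9, A 10, A 11]
  have hθadj : ∀ i, Γ.incidenceGraph.Adj (θ • A (i + 1)) (θ • A i) := fun i =>
    ((smul_adj θ).2 (hA.2 i)).symm
  have hθne : ∀ i, θ • A i ≠ θ • A (i + 2) := fun i e =>
    hA.ne_add_two i (smul_left_cancel θ e).symm
  have hB : Γ.IsApartment B := by
    refine hΓ.hexagon.isApartment_of_circuit (fun i => ?_) (fun i => ?_)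
    · have h1 : Γ.incidenceGraph.Adj (A 1) (θ • A 0) := by
        have := hθadj 0; rwa [zero_add, hθ1] at this
      have h7 : Γ.incidenceGraph.Adj (θ • A 8) (A 7) := by
        have := hθadj 7; rwa [hθ7] at this
      fin_cases i
      exacts [hA.2 0, h1, hθadj 11, hθadj 10, hθadj 9, hθadj 8, h7, hA.2 7, hA.2 8, hA.2 9,
        hA.2 10, hA.2 11]
    · have h1 : θ • A 11 ≠ A 1 := by
        rw [← hθ1]; exact hθne 11
      have h5 : A 7 ≠ θ • A 9 := by
        rw [← hθ7]; exact hθne 7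
      fin_cases i
      exacts [hθ0, h1, hθne 10, hθne 9, hθne 8, h5, hθ8.symm, hA.ne_add_two 7, hA.ne_add_two 8,
        hA.ne_add_two 9, hA.ne_add_two 10, hA.ne_add_two 11]
  refine ⟨B, hB, ?_, ?_, rfl⟩
  · change A 7 ∈ _; rwa [hA7]
  · change A 1 ∈ _; rwa [hA1]

end IsDomesticFixing

end PointLineGeometry

namespace PointLineGeometry

variable {P : Type u} {L : Type v} {Γ : PointLineGeometry P L}

theorem IsGeneralisedHexagon.even_dist (hΓ : Γ.IsGeneralisedHexagon) {x y : P ⊕ L}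
    (h : x.isLeft = y.isLeft) : Even (Γ.incidenceGraph.dist x y) := by
  obtain ⟨p, hp⟩ := hΓ.connected.exists_walk_length_eq_dist x y
  rw [← hp, Γ.typeColoring.even_length_iff_congr p]
  change x.isLeft = true ↔ y.isLeft = true
  rw [h]

theorem IsApartment.isLeft_add_two {A : ZMod 12 → P ⊕ L} (hA : Γ.IsApartment A) (i : ZMod 12) :
    (A (i + 2)).isLeft = (A i).isLeft := by
  have h1 := isLeft_ne_of_adj (hA.2 i)
  have h2 := isLeft_ne_of_adj (hA.2 (i + 1))
  rw [show i + 1 + 1 = i + 2 by ring] at h2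
  revert h1 h2
  cases (A i).isLeft <;> cases (A (i + 1)).isLeft <;> cases (A (i + 2)).isLeft <;> simp

end PointLineGeometry

/-! ### The decomposition θ = g x₁(c) s₁ and the equations it satisfies. -/

namespace HexagonCoordinates

variable {P : Type u} {L : Type v} {Γ : PointLineGeometry P L}
  {F : Type w} {J : Type z} [Field F] [AddCommGroup J] [Module F J]
  {S : HexagonalSystem F J} (X : HexagonCoordinates Γ S)

/-- `θ` is a nontrivial point-domestic collineation that fixes the ovoid `O` pointwise, in
standard position with respect to the apartment `A`. -/
structure IsNormalised (θ : Γ.Collineation) (O : Set P) : Prop extends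
    Γ.IsDomesticFixing θ O where
  mem_seven : X.A 7 ∈ Sum.inl '' O
  mem_one : X.A 1 ∈ Sum.inl '' O
  smul_eight : θ • X.A 8 = X.A 6

variable (hΓ : Γ.IsMoufangHexagon)
include hΓ

theorem exists_isNormalised {θ : Γ.Collineation} {O : Set P} (h : Γ.IsDomesticFixing θ O) :
    ∃ n : Γ.Collineation, X.IsNormalised (n * θ * n⁻¹) (n.1.1 '' O) := by
  obtain ⟨B, hB, h7, h1, h8⟩ := h.exists_isApartment hΓ
  have hl : (B 7).isLeft = (X.A 7).isLeft := by
    obtain ⟨p, -, hp⟩ := h7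
    obtain ⟨q, hq⟩ := X.isPoint
    rw [← hp, hq]
    rfl
  obtain ⟨n, hn⟩ := hΓ.exists_smul_eq hB X.isApartment hl
  refine ⟨n, h.conj hΓ.hexagon n, ?_, ?_, ?_⟩
  · obtain ⟨p, hp, e⟩ := h7
    rw [← hn, ← e]
    exact ⟨_, ⟨p, hp, rfl⟩, rfl⟩
  · obtain ⟨p, hp, e⟩ := h1
    rw [← hn, ← e]
    exact ⟨_, ⟨p, hp, rfl⟩, rfl⟩
  · rw [mul_smul, mul_smul, ← hn 8, inv_smul_smul, h8, hn]

/-- The element x₄(r) fixes `A 4` and moves `A 3`, so the path from `A 1` to `A 4` and its image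
join to a path of length 6 without backtracking. -/
theorem dist_x₄_smul {r : F} (hr : r ≠ 0) :
    Γ.incidenceGraph.dist (X.rd.x₄ r • X.A 1) (X.A 1) = 6 := by
  let c : ℕ → P ⊕ L := fun n => match n with
    | 0 => X.A 1 | 1 => X.A 2 | 2 => X.A 3 | 3 => X.A 4 | 4 => X.rd.x₄ r • X.A 3
    | 5 => X.rd.x₄ r • X.A 2 | _ => X.rd.x₄ r • X.A 1
  have hadj : ∀ i, Γ.incidenceGraph.Adj (X.rd.x₄ r • X.A (i + 1)) (X.rd.x₄ r • X.A i) := fun i =>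
    ((smul_adj _).2 (X.isApartment.2 i)).symm
  have hne : ∀ i, X.rd.x₄ r • X.A i ≠ X.rd.x₄ r • X.A (i + 2) := fun i e =>
    X.isApartment.ne_add_two i (smul_left_cancel _ e).symm
  have h4 := X.fix₄ r 4
  refine hΓ.hexagon.dist_path (c := c) (N := 6) (fun n hn => ?_) (fun n hn => ?_) 0 6 le_rfl le_rfl
  · interval_cases n
    · exact X.isApartment.2 1
    · exact X.isApartment.2 2
    · exact X.isApartment.2 3
    · have := hadj 3
      rwa [show (3 : ZMod 12) + 1 = 4 by decide, h4] at this
    · exact hadj 2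
    · exact hadj 1
  · have : n ≤ 4 := by omega
    interval_cases n
    · exact X.isApartment.ne_add_two 1
    · exact X.isApartment.ne_add_two 2
    · exact fun e => hr (X.free₄' hΓ e)
    · have := hne 2
      rwa [show (2 : ZMod 12) + 2 = 4 by decide, h4] at this
    · exact hne 1

variable {X}
variable {θ : Γ.Collineation} {O : Set P} (h : X.IsNormalised θ O)
include h

omit hΓ in
theorem IsNormalised.dist_ne (y : Γ.Collineation) :
    Γ.incidenceGraph.dist (y • X.A 1) (θ • y • X.A 1) ≠ 6 := by
  obtain ⟨p, hp, hp1⟩ := h.mem_one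
  rw [← hp1]
  exact h.domestic (y.1.1 p)

omit hΓ in
theorem IsNormalised.smul_smul (y : Γ.Collineation) :
    θ • y • X.A 1 = (θ * y * θ⁻¹) • X.A 1 := by
  rw [mul_smul, mul_smul, inv_smul_eq_iff.2 (h.smul _ h.mem_one).symm]

/-- Since θ fixes `A 1`, it maps x₄(r) A 1 to x₄(r') A 1, which would be an opposite point if r' ≠
r. -/
theorem IsNormalised.conj_x₄ {r r' : F} (e : θ * X.rd.x₄ r * θ⁻¹ = X.rd.x₄ r') : r' = r := by
  by_contra hne
  refine h.dist_ne (X.rd.x₄ r) ?_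
  rw [h.smul_smul, e, show r' = r + (r' - r) by ring, X.rd.add₄, mul_smul,
    smul_dist hΓ.hexagon, SimpleGraph.dist_comm]
  exact X.dist_x₄_smul hΓ (sub_ne_zero.2 hne)

/-- The product θ s⁻¹ fixes `A 6`, `A 7` and `A 1`, and a factor from U₁ corrects its effect on `A
8`. As θ, s and U₁ all centralise U₄, so does the remaining factor g. -/
theorem IsNormalised.exists_eq_mul {s : Γ.Collineation} (hs : X.IsReflection s) :
    ∃ g c φ ψ l, θ = g * X.rd.x₁ c * s ∧ X.IsTorus g φ ψ l := by
  have hsi : ∀ j, s⁻¹ • X.A j = X.A (2 - j) := fun j => by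
    rw [inv_smul_eq_iff, hs.smul, sub_sub_cancel]
  obtain ⟨k, hk⟩ : ∃ k, k = θ * s⁻¹ := ⟨_, rfl⟩
  have hk6 : k • X.A 6 = X.A 6 := by
    rw [hk, mul_smul, hsi, show (2 - 6 : ZMod 12) = 8 by decide, h.smul_eight]
  have hk7 : k • X.A 7 = X.A 7 := by
    rw [hk, mul_smul, hsi, show (2 - 7 : ZMod 12) = 7 by decide, h.smul _ h.mem_seven]
  have hk1 : k • X.A 1 = X.A 1 := by
    rw [hk, mul_smul, hsi, show (2 - 1 : ZMod 12) = 1 by decide, h.smul _ h.mem_one]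
  obtain ⟨c, hc⟩ := X.exists_x₁_smul hΓ (y := k⁻¹ • X.A 8)
    (by have := (smul_adj k⁻¹).2 X.adj_seven_eight
        rwa [inv_smul_eq_iff.2 hk7.symm] at this)
    (fun e => X.A_ne (show (8 : ZMod 12) ≠ 6 by decide) (by
      rw [inv_smul_eq_iff, hk6] at e
      exact e))
  obtain ⟨g, hg⟩ : ∃ g, g = k * X.rd.x₁ c := ⟨_, rfl⟩
  have hgA : ∀ j : ZMod 12, (j - 1).val ≤ 6 → k • X.A j = X.A j → g • X.A j = X.A j := by
    intro j hj hkj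
    rw [hg, mul_smul, X.fix₁ c j hj, hkj]
  have hg8 : g • X.A 8 = X.A 8 := by rw [hg, mul_smul, hc, smul_inv_smul]
  have hg7 := hgA 7 (by decide) hk7
  have hg6 := hgA 6 (by decide) hk6
  have hg1 := hgA 1 (by decide) hk1
  have b1 := X.isApartment.smul_eq_between hΓ.hexagon (g := g) (i := 1) (n := 5) le_rfl hg1 hg6
  have b2 := X.isApartment.smul_eq_between hΓ.hexagon (g := g) (i := 8) (n := 5) le_rfl hg8 hg1
  have hfix : ∀ j, g • X.A j = X.A j := by
    refine forall_zmod12 1 fun k hk => ?_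
    by_cases hk5 : k ≤ 5
    · exact b1 k hk5
    by_cases hk6 : k = 6
    · subst hk6; exact hg7
    · have := b2 (k - 7) (by omega)
      rw [Nat.cast_sub (by omega), show (8 : ZMod 12) + (k - (7 : ℕ)) = 1 + k by
        push_cast; ring] at this
      exact this
  have hθ : θ = g * X.rd.x₁ (-c) * s := by rw [hg, hk, X.rd.x₁_neg]; group
  have hg4 : ∀ t, g * X.rd.x₄ t * g⁻¹ = X.rd.x₄ t := by
    intro t
    have hm : g * X.rd.x₄ t * g⁻¹ ∈ Γ.rootGroup X.A 4 :=
      conj_mem_rootGroup (X.mem₄ t) fun k h1 h5 => ⟨k, h1, h5, (hfix _).symm⟩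
    obtain ⟨r, hr⟩ := X.surj₄ hm
    rw [← hr]
    congr 1
    refine h.conj_x₄ hΓ ?_
    rw [hr, hθ]
    have e1 : ∀ y : Γ.Collineation, g * X.rd.x₁ (-c) * s * y * (g * X.rd.x₁ (-c) * s)⁻¹ =
        g * (X.rd.x₁ (-c) * (s * y * s⁻¹) * (X.rd.x₁ (-c))⁻¹) * g⁻¹ := by intro y; group
    rw [e1, hs.conj₄, X.rd.conj₄, ← X.rd.x₄_eq]
  obtain ⟨φ, ψ, l, ht⟩ := X.exists_isTorus hΓ hfix hg4
  exact ⟨g, -c, φ, ψ, l, hθ, ht⟩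

/-- Every point `x₆(u) x₅(b) A 3` is collinear with a point of the ovoid. -/
theorem IsNormalised.exists_mem (b : J) (u : F) : ∃ a t,
    X.rd.W t a (-S.tr a b - t * u) b u • X.A 1 ∈ Sum.inl '' O := by
  have hA := X.isApartment
  -- The nearest ovoid point is collinear with the translate of `A 3` by parity, and different from
  -- it because it is opposite `A 7`. The joining line leads away from `A 7`, so U₃ and then U₂
  -- reach the point from `A 1`.
  obtain ⟨p', hp', hd⟩ := h.ovoid.2 (X.rd.W 0 0 0 b u • X.A 3)
  obtain ⟨n, hn⟩ : ∃ n, n = X.rd.W 0 0 0 b u := ⟨_, rfl⟩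
  obtain ⟨q, hq⟩ : ∃ q : P ⊕ L, q = n⁻¹ • Sum.inl p' := ⟨_, rfl⟩
  have hnq : n • q = Sum.inl p' := by rw [hq, smul_inv_smul]
  rw [← hn, ← hnq, smul_dist hΓ.hexagon] at hd
  have hl : (X.A 3).isLeft = q.isLeft := by
    have h1 := hA.isLeft_add_two 1
    obtain ⟨p, -, hp⟩ := h.mem_one
    rw [show (1 : ZMod 12) + 2 = 3 by decide, ← hp] at h1
    rw [h1, hq, isLeft_smul]
    rfl
  have hn7 : n • X.A 7 = X.A 7 := by rw [hn]; exact X.W_smul 7 (by decide)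
  have h37 : Γ.incidenceGraph.dist (X.A 3) (X.A 7) = 4 := hA.dist_add hΓ.hexagon 3 4 (by omega)
  have hq7 : Γ.incidenceGraph.dist q (X.A 7) = 6 := by
    rw [← smul_dist hΓ.hexagon n, hn7, hnq]
    refine h.opposite ⟨p', hp', rfl⟩ h.mem_seven fun e => ?_
    rw [← hnq, ← hn7] at e
    rw [smul_left_cancel n e, h37] at hd
    omega
  have hq3 : q ≠ X.A 3 := by
    rintro e
    rw [e] at hq7
    omega
  have hd2 : Γ.incidenceGraph.dist (X.A 3) q = 2 := by
    obtain ⟨k, hk⟩ := hΓ.hexagon.even_dist hl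
    have : Γ.incidenceGraph.dist (X.A 3) q ≠ 0 := fun e =>
      hq3 ((hΓ.hexagon.connected.dist_eq_zero_iff).1 e).symm
    omega
  obtain ⟨m, hm, hm1⟩ := hΓ.hexagon.exists_proj hq3.symm
  have hmq : Γ.incidenceGraph.Adj m q := SimpleGraph.dist_eq_one_iff_adj.1 (by omega)
  have hm4 : m ≠ X.A 4 := by
    rintro rfl
    have h5 := hΓ.hexagon.dist_eq_five hmq.symm hq7
    have : Γ.incidenceGraph.dist (X.A 4) (X.A 7) = 3 := hA.dist_add hΓ.hexagon 4 3 (by omega)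
    omega
  obtain ⟨y₃, hy₃, e₃⟩ := hΓ.moufang X.A hA 3 (X.A 2) m (hA.2 2).symm
    (X.A_ne (show (2 : ZMod 12) ≠ 4 by decide)) hm hm4
  obtain ⟨a, rfl⟩ := X.surj₃ hy₃
  have hy2 : Γ.incidenceGraph.Adj (X.A 2) ((X.rd.x₃ a)⁻¹ • q) := by
    rw [← smul_adj (X.rd.x₃ a), e₃, smul_inv_smul]
    exact hmq
  obtain ⟨y₂, hy₂, e₂⟩ := hΓ.moufang X.A hA 2 (X.A 1) ((X.rd.x₃ a)⁻¹ • q) (hA.2 1).symm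
    (X.A_ne (show (1 : ZMod 12) ≠ 3 by decide)) hy2 (fun e => hq3 (by
      rw [inv_smul_eq_iff, show (2 : ZMod 12) + 1 = 3 by decide, X.fix₃ a 3] at e
      exact e))
  obtain ⟨t, rfl⟩ := X.surj₂ hy₂
  refine ⟨a, t, p', hp', ?_⟩
  rw [← hnq, ← eq_inv_smul_iff.1 e₂, ← mul_smul, ← mul_smul, hn, X.rd.W_mul_x₃, X.rd.W_mul_x₂,
    zero_add, zero_add, zero_sub]

omit hΓ h in
/-- Conjugation by `θ = g x₁(c) s` on `U₂ U₃ U₄ U₅ U₆`. -/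
theorem conj_W_of_eq_mul {s g : Γ.Collineation} {c : J} {φ ψ : J ≃ₗ[F] J} {l : F}
    (hs : X.IsReflection s) (hg : X.IsTorus g φ ψ l) (hθ : θ = g * X.rd.x₁ c * s)
    (a : J) (t : F) (b : J) (u : F) :
    θ * X.rd.W t a (-S.tr a b - t * u) b u * θ⁻¹ =
      X.rd.W (l⁻¹ * (-u - S.tr c b + S.tr (S.adj c) a - t * S.norm c))
        (-ψ b + ψ (S.cross c a) - t • ψ (S.adj c))
        (-S.tr c (S.adj a) - t ^ 2 * S.norm c + t * l * S.tr (ψ (S.adj c)) (φ a))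
        (l • φ (a - t • c)) (l * t) := by
  have hw : X.rd.W t a (-S.tr a b - t * u) b u =
      X.rd.x₆ u * X.rd.x₅ b * X.rd.x₃ a * X.rd.x₂ t := by
    rw [X.rd.x₆_eq, X.rd.W_mul_x₅, X.rd.W_mul_x₃, X.rd.W_mul_x₂, zero_add, zero_add, zero_sub,
      zero_add]
  have e1 : ∀ y₁ y₂ y₃ y₄ : Γ.Collineation, θ * (y₁ * y₂ * y₃ * y₄) * θ⁻¹ =
      g * ((X.rd.x₁ c * (s * y₁ * s⁻¹) * (X.rd.x₁ c)⁻¹) *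
        (X.rd.x₁ c * (s * y₂ * s⁻¹) * (X.rd.x₁ c)⁻¹) *
        (X.rd.x₁ c * (s * y₃ * s⁻¹) * (X.rd.x₁ c)⁻¹) *
        (X.rd.x₁ c * (s * y₄ * s⁻¹) * (X.rd.x₁ c)⁻¹)) * g⁻¹ := by
    intros; rw [hθ]; group
  have e2 : ∀ t a r b u, g * X.rd.W t a r b u * g⁻¹ =
      X.rd.W (l⁻¹ * t) (ψ a) r (l • φ b) (l * u) := by
    intro t a r b u
    rw [RootData.W, RootData.W, ← hg.conj₂, ← hg.conj₃, ← hg.conj₅, ← hg.conj₆]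
    conv_rhs => rw [← hg.conj₄ r]
    group
  rw [hw, e1, hs.conj₂, hs.conj₃, hs.conj₅, hs.conj₆, X.rd.conj₂, X.rd.conj₃, X.rd.conj₅,
    X.rd.conj₆, X.rd.W_mul, X.rd.W_mul, X.rd.W_mul, e2]
  have hl := hg.ne_zero
  have htr : t * l * S.tr (ψ (S.adj c)) (φ a) = S.tr (t • S.adj c) a := by
    rw [S.tr_symm, mul_assoc, hg.tr, S.tr_symm, map_smul, LinearMap.smul_apply, smul_eq_mul]
  rw [htr]
  congr 1
  · simp only [map_neg]; ring
  · simp only [map_neg, map_smul, map_add, map_zero]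
    module
  · simp only [map_neg, map_zero, LinearMap.neg_apply, map_add]
    ring
  · simp only [map_neg, map_smul, map_add, map_sub, map_zero]
    module
  · ring

/-- The points of the ovoid opposite to `A 7` are parametrised by `a` and `t`, and `θ` fixes each
of them. -/
theorem IsNormalised.equations {s g : Γ.Collineation} {c : J} {φ ψ : J ≃ₗ[F] J} {l : F}
    (hs : X.IsReflection s) (hg : X.IsTorus g φ ψ l) (hθ : θ = g * X.rd.x₁ c * s)
    (a : J) (t : F) {b : J} (hb : b = l • φ (a - t • c)) :
    X.rd.W t a (-S.tr a b - t * (l * t)) b (l * t) • X.A 1 ∈ Sum.inl '' O ∧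
    l * t = -(l * t) - S.tr c b + S.tr (S.adj c) a - t * S.norm c ∧
    a = -ψ b + ψ (S.cross c a) - t • ψ (S.adj c) ∧
    -S.tr a b - t * (l * t) =
      -S.tr c (S.adj a) - t ^ 2 * S.norm c + t * l * S.tr (ψ (S.adj c)) (φ a) := by
  have hl := hg.ne_zero
  -- The parameters of x₅ and x₆ are chosen so that the fixed-point equations in U₅ and U₆ return
  -- exactly the prescribed a and t.
  obtain ⟨a', t', hm⟩ := h.exists_mem hΓ b (l * t)
  have hfix := h.smul _ hm
  rw [h.smul_smul, conj_W_of_eq_mul hs hg hθ] at hfix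
  obtain ⟨k1, k2, k3, k4, k5⟩ := X.W_smul_inj hΓ hfix
  obtain rfl : t' = t := mul_left_cancel₀ hl k5
  have ha : a' = a := by
    rw [hb] at k4
    exact sub_left_injective (φ.injective (smul_right_injective J hl k4))
  subst ha
  refine ⟨hm, ?_, k2.symm, k3.symm⟩
  field_simp at k1
  linear_combination -k1

end HexagonCoordinates

/-- The algebraic description of a collineation in standard position. -/
structure HexagonalSystem.IsFolding {F : Type w} {J : Type z} [Field F] [AddCommGroup J]
    [Module F J] (S : HexagonalSystem F J) (φ ψ : J ≃ₗ[F] J) (l : F) (c : J) : Prop extends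
    S.IsSimilitude φ ψ l where
  c_ne_zero : c ≠ 0
  norm_c : S.norm c = l
  map_c : l • φ c = S.adj c
  add_eq : ∀ a, a + l • ψ (φ a) = ψ (S.cross c a)
  tr_c_adj : ∀ a, S.tr c (S.adj a) = l * S.tr a (φ a)
  map_ne : ∀ z, z ≠ 0 → φ (c - S.inv z) ≠ z

namespace HexagonCoordinates

variable {P : Type u} {L : Type v} {Γ : PointLineGeometry P L}
  {F : Type w} {J : Type z} [Field F] [AddCommGroup J] [Module F J]
  {S : HexagonalSystem F J} {X : HexagonCoordinates Γ S}
  {θ s g : Γ.Collineation} {c : J} {φ ψ : J ≃ₗ[F] J} {l : F}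

theorem smul_x₁_of_eq_mul (hs : X.IsReflection s) (hg : X.IsTorus g φ ψ l)
    (hθ : θ = g * X.rd.x₁ c * s) {z : J} (hz : z ≠ 0) :
    θ • X.rd.x₁ z • X.A 8 = X.rd.x₁ (φ (c - S.inv z)) • X.A 8 := by
  rw [hθ, mul_smul, hs.smul_x₁ z hz, mul_smul, ← mul_smul (X.rd.x₁ c), ← X.rd.add₁,
    ← sub_eq_add_neg, ← hg.conj₁, mul_smul, mul_smul, inv_smul_eq_iff.2 (hg.fix 8).symm]

theorem smul_six_of_eq_mul (hs : X.IsReflection s) (hg : X.IsTorus g φ ψ l)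
    (hθ : θ = g * X.rd.x₁ c * s) : θ • X.A 6 = X.rd.x₁ (φ c) • X.A 8 := by
  rw [hθ, mul_smul, hs.smul, show (2 - 6 : ZMod 12) = 8 by decide, ← hg.conj₁, mul_smul, mul_smul,
    mul_smul, inv_smul_eq_iff.2 (hg.fix 8).symm]

variable (hΓ : Γ.IsMoufangHexagon)
include hΓ

variable {O : Set P} (h : X.IsNormalised θ O)
include h

/-- If c = 0, the equation for (a, t) = (0, 1) gives characteristic 2. With b = lφ(1), θ then maps
x₃(1) A 1 to x₅(b) A 1. Since −b = b, their distance is that of x₅(b) x₃(1) A 1 from A 1, both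
distinct points of the ovoid, so it is 6 and contradicts domesticity. -/
theorem IsNormalised.ne_zero (hs : X.IsReflection s) (hg : X.IsTorus g φ ψ l)
    (hθ : θ = g * X.rd.x₁ c * s) : c ≠ 0 := by
  rintro rfl
  have hl := hg.ne_zero
  obtain ⟨-, h2, -, -⟩ := h.equations hΓ hs hg hθ 0 1 rfl
  simp only [S.norm_zero, S.adj_zero, map_zero, mul_one, smul_zero,
    sub_zero, add_zero] at h2
  have h2 : (2 : F) = 0 := by
    have : l * 2 = 0 := by linear_combination h2
    exact (mul_eq_zero.1 this).resolve_left hl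
  obtain ⟨b, hb⟩ : ∃ b, b = l • φ S.one := ⟨_, rfl⟩
  have hnb : -b = b := by
    have : (2 : F) • b = 0 := by rw [h2, zero_smul]
    rw [two_smul] at this
    exact neg_eq_of_add_eq_zero_right this
  obtain ⟨hm, -, -, -⟩ := h.equations hΓ hs hg hθ S.one 0 (b := b) (by rw [zero_smul, sub_zero, hb])
  simp only [mul_zero, sub_zero] at hm
  have hd := h.opposite hm h.mem_one fun e => S.one_ne_zero (X.W_eq_zero hΓ e).2.1
  refine h.dist_ne (X.rd.x₃ S.one) ?_
  have hc := conj_W_of_eq_mul hs hg hθ S.one 0 0 0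
  simp only [S.norm_zero, S.adj_zero, map_zero, LinearMap.zero_apply, mul_zero, smul_zero, neg_zero,
    sub_zero, add_zero, zero_mul, ← X.rd.x₃_eq, ← hb, ← X.rd.x₅_eq] at hc
  rw [h.smul_smul, hc, ← smul_dist hΓ.hexagon (X.rd.x₅ b)⁻¹, inv_smul_smul, ← X.rd.x₅_neg, hnb,
    ← mul_smul, ← hd, X.rd.x₅_eq, X.rd.W_mul_x₃, zero_add, zero_sub]

/-- The pair (a, t) = (0, 1) yields the norm and the image of c, the pairs (a, 0) yield the
identities in a, and the last condition says that no line x₁(z) A 8 with z ≠ 0 is fixed. -/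
theorem IsNormalised.isFolding (hs : X.IsReflection s) (hg : X.IsTorus g φ ψ l)
    (hθ : θ = g * X.rd.x₁ c * s) : S.IsFolding φ ψ l c := by
  have hc := h.ne_zero hΓ hs hg hθ
  obtain ⟨-, -, h2, h3⟩ := h.equations hΓ hs hg hθ 0 1 rfl
  simp only [map_zero, zero_sub, one_smul, map_neg, smul_neg, neg_neg, add_zero, map_smul,
    S.adj_zero, LinearMap.zero_apply, mul_zero, neg_zero, one_mul, mul_one, one_pow] at h2 h3
  have hall := fun a => h.equations hΓ hs hg hθ a 0 rfl
  simp only [zero_smul, sub_zero, mul_zero, neg_zero, zero_sub, zero_mul, map_smul,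
    smul_eq_mul, add_zero, ne_eq, OfNat.ofNat_ne_zero, not_false_eq_true, zero_pow] at hall
  refine ⟨hg.toIsSimilitude, hc, by linear_combination h3, ?_, fun a => ?_, fun a => ?_,
    fun z hz e => ?_⟩
  · refine ψ.injective ?_
    rw [map_smul]
    exact sub_eq_zero.1 h2.symm
  · have := (hall a).2.2.1
    nth_rw 1 [this]
    abel
  · linear_combination (hall a).2.2.2
  · have := smul_x₁_of_eq_mul hs hg hθ hz
    rw [e] at this
    refine h.smul_ne hΓ h.mem_seven ?_ this
    have := (smul_adj (X.rd.x₁ z)).2 X.adj_seven_eight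
    rwa [X.fix₁ z 7] at this

omit hΓ h in
theorem _root_.HexagonalSystem.IsFolding.map_c_eq_inv (hf : S.IsFolding φ ψ l c) :
    φ c = S.inv c := by
  rw [HexagonalSystem.inv, hf.norm_c, ← hf.map_c, smul_smul, inv_mul_cancel₀ hf.ne_zero, one_smul]

/-- The lines A 8, A 6 and x₁(c⁻¹) A 8 are permuted cyclically, so θ³ fixes a line through an ovoid
point. -/
theorem IsNormalised.orderOf_eq (hs : X.IsReflection s) (hg : X.IsTorus g φ ψ l)
    (hθ : θ = g * X.rd.x₁ c * s) : orderOf θ = 3 := by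
  have hf := h.isFolding hΓ hs hg hθ
  refine orderOf_eq_prime (h.pow_three_eq_one hΓ h.mem_seven X.adj_seven_eight ?_) h.ne_one
  rw [h.smul_eight, smul_six_of_eq_mul hs hg hθ, hf.map_c_eq_inv,
    smul_x₁_of_eq_mul hs hg hθ (S.inv_ne_zero hf.c_ne_zero), S.inv_inv hf.c_ne_zero, sub_self,
    map_zero, X.rd.x₁_zero, one_smul]

end HexagonCoordinates

/-! ### Foldings exist only in dimension at most three. -/

namespace HexagonalSystem

variable {F : Type w} {J : Type z} [Field F] [AddCommGroup J] [Module F J]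
  (S : HexagonalSystem F J)

theorem tr_one_one : S.tr S.one S.one = 3 := by
  have := S.tr_adj S.one
  rwa [S.adj_one, S.norm_one, mul_one] at this

theorem tr_adj' (a : J) : S.tr (S.adj a) a = 3 * S.norm a := by rw [S.tr_symm, S.tr_adj]

/-- The trace form is nondegenerate in characteristic different from `3`. -/
theorem eq_zero_of_tr_eq_zero (h3 : (3 : F) ≠ 0) {x : J} (hx : ∀ y, S.tr x y = 0) : x = 0 := by
  by_contra hne
  -- The radical absorbs cross products, so x^# × (1 × x) = N(x)1 + T(x^#, 1)x lies in it; its trace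
  -- is 3N(x).
  have h1 : ∀ y b, (∀ z, S.tr y z = 0) → ∀ z, S.tr (S.cross b y) z = 0 := by
    intro y b hy z
    rw [S.cross_symm, ← S.tr_cross, hy]
  have h2 := h1 _ (S.adj x) (h1 x S.one hx) S.one
  rw [S.cross_symm S.one x, S.adj_cross, map_add, map_smul, map_smul, LinearMap.add_apply,
    LinearMap.smul_apply, LinearMap.smul_apply, hx, S.tr_one_one, smul_zero, add_zero,
    smul_eq_mul] at h2
  exact mul_ne_zero (S.norm_ne_zero hne) h3 h2

theorem tr_cross_self (a b : J) : S.tr a (S.cross a b) = 2 * S.tr (S.adj a) b := by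
  rw [S.tr_cross, S.cross_self, map_smul, LinearMap.smul_apply, smul_eq_mul]

/-- The linearisation of `adj_cross_adj` in its second argument. -/
theorem adj_cross_cross (a b b' : J) : S.cross (S.cross a b) (S.cross a b') =
    S.tr (S.adj a) b • b' + S.tr (S.adj a) b' • b + S.tr a (S.cross b b') • a -
      S.cross (S.adj a) (S.cross b b') := by
  have h0 := S.adj_cross_adj a (b + b')
  have h1 := S.adj_cross_adj a b
  have h2 := S.adj_cross_adj a b'
  rw [S.adj_add b b', map_add (S.cross a), S.adj_add] at h0
  simp only [map_add] at h0
  linear_combination (norm := module) h0 - h1 - h2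

/-- The first two hypotheses imply a × b' = a' × b. Hence (a × a') × (a × b') and (a' × a) × (a' ×
b) agree, and expanding both with `adj_cross_cross` leaves only the b and b' terms. It is applied to
the orbits of two trace-zero elements under σ = lψφ. -/
theorem smul_eq_smul_of_cross (h3 : (3 : F) ≠ 0) {a b a' b' : J}
    (hm : S.cross a b + S.cross a' b' + S.cross (-a - a') (-b - b') = 0)
    (hn : S.cross a b' + S.cross a' (-b - b') + S.cross (-a - a') b = 0)
    (hN : S.norm a' = S.norm a) (t1 : S.tr (S.adj a') b = S.tr (S.adj a) (-b - b'))
    (t2 : S.tr (S.adj a') (-b - b') = S.tr (S.adj a) b')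
    (t3 : S.tr (S.adj a') a = S.tr (S.adj a) (-a - a')) :
    S.tr (S.adj a) a' • b' = S.tr (S.adj a) (-a - a') • b := by
  have e1 : S.cross a b' = S.cross a' b := by
    have : (3 : F) • (S.cross a b' - S.cross a' b) = 0 := by
      simp only [map_sub, map_neg, LinearMap.sub_apply, LinearMap.neg_apply] at hm hn
      linear_combination (norm := module) hm + (2 : F) • hn
    exact sub_eq_zero.1 ((smul_eq_zero.1 this).resolve_left h3)
  have e2 : S.cross a' b' = -S.cross a b - S.cross a b' := by
    simp only [map_sub, map_neg, LinearMap.sub_apply, LinearMap.neg_apply] at hn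
    linear_combination (norm := module) -hn + (2 : F) • e1
  have e3 : S.cross a b = S.cross a' (-b - b') := by
    rw [map_sub, map_neg, e2, ← e1]; abel
  have H1 := S.adj_cross_cross a a' b'
  have H2 := S.adj_cross_cross a' a b
  rw [e2, map_sub, map_neg, map_sub, map_neg, S.adj_cross, S.adj_cross, S.tr_cross_self,
    S.tr_cross_self] at H1
  rw [e3, S.tr_cross_self, S.adj_cross, hN, t1, t2, t3, S.cross_symm a' a, ← e1, H1] at H2
  simp only [map_sub, map_neg] at H2 ⊢
  linear_combination (norm := module) H2

namespace IsFolding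

variable {S} {φ ψ : J ≃ₗ[F] J} {l : F} {c : J} (hf : S.IsFolding φ ψ l c)
include hf

/-- As φ(c) = c⁻¹, a root k would make z = kc⁻¹ a solution of φ(c − z⁻¹) = z. -/
theorem ne_zero_of_sq {k : F} : k ^ 2 - k + 1 ≠ 0 := by
  intro hk
  have hk0 : k ≠ 0 := by rintro rfl; simp at hk
  have hd := S.inv_ne_zero hf.c_ne_zero
  refine hf.map_ne (k • S.inv c) (smul_ne_zero hk0 hd) ?_
  have : S.inv (k • S.inv c) = k⁻¹ • c := by
    have h := S.inv_inv hf.c_ne_zero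
    rw [inv] at h ⊢
    rw [S.norm_smul, S.adj_smul, smul_smul]
    conv_rhs => rw [← h, smul_smul]
    congr 1
    have := S.norm_ne_zero hd
    field_simp
  rw [this, map_sub, map_smul, hf.map_c_eq_inv, ← sub_eq_zero]
  have : S.inv c - k⁻¹ • S.inv c - k • S.inv c = (1 - k⁻¹ - k) • S.inv c := by module
  rw [this, show 1 - k⁻¹ - k = 0 by field_simp; linear_combination -hk, zero_smul]

theorem three_ne_zero : (3 : F) ≠ 0 := by
  have := hf.ne_zero_of_sq (k := -1)
  intro h
  apply this
  linear_combination h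

theorem map_c_eq : l • ψ (φ c) = c := by
  have h := hf.add_eq c
  rw [S.cross_self, map_smul, ← hf.map_c, map_smul, two_smul] at h
  exact (add_right_cancel h).symm

theorem cross_map (a : J) : S.cross (S.adj c) (φ a) = a + l • ψ (φ a) := by
  rw [hf.add_eq, hf.cross, ← hf.map_c, map_smul, LinearMap.smul_apply]

/-- In the composites σ = lψφ and τ = lφψ the multiplier cancels: together they preserve T, σ
preserves N, and # and × turn σ into τ. Moreover σ fixes c and τ fixes c^#. -/
theorem tr_map_map (a b : J) : S.tr (l • ψ (φ a)) (l • φ (ψ b)) = S.tr a b := by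
  rw [map_smul, map_smul, LinearMap.smul_apply, S.tr_symm, smul_eq_mul, smul_eq_mul, hf.tr,
    S.tr_symm, hf.tr]

theorem map_adj_c : l • φ (ψ (S.adj c)) = S.adj c := by
  rw [← hf.map_c, map_smul, hf.map_c_eq]

theorem adj_map (a : J) : S.adj (l • ψ (φ a)) = l • φ (ψ (S.adj a)) := by
  rw [S.adj_smul, ← hf.adj', hf.adj, map_smul, smul_smul, pow_two]

theorem cross_map_map (a b : J) :
    S.cross (l • ψ (φ a)) (l • ψ (φ b)) = l • φ (ψ (S.cross a b)) := by
  rw [map_smul, map_smul, LinearMap.smul_apply, ← hf.cross', hf.cross, map_smul]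

theorem tr_adj_c_map (a : J) : S.tr (S.adj c) (l • ψ (φ a)) = S.tr (S.adj c) a := by
  rw [S.tr_symm]
  nth_rw 1 [← hf.map_adj_c]
  rw [hf.tr_map_map, S.tr_symm]

theorem norm_map (a : J) : S.norm (l • ψ (φ a)) = S.norm a := by
  have hψ : ∀ x, l * S.norm (ψ x) = S.norm x := by
    intro x
    by_cases hx : x = 0
    · simp [hx, S.norm_zero]
    have hN := S.norm_ne_zero hx
    have hl := hf.ne_zero
    have h1 : S.norm (ψ (S.norm x • x)) = l ^ 3 * S.norm (φ (S.adj x)) ^ 2 := by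
      rw [← S.adj_adj, hf.adj, S.norm_smul, S.norm_adj]
    have h2 := hf.norm (S.adj x)
    rw [S.norm_adj] at h2
    rw [map_smul, S.norm_smul] at h1
    have h3 : S.norm x ^ 3 * (l * S.norm (ψ x)) = S.norm x ^ 3 * S.norm x := by
      linear_combination l * h1 + (l ^ 2 * S.norm (φ (S.adj x)) + S.norm x ^ 2) * h2
    exact mul_left_cancel₀ (pow_ne_zero 3 hN) h3
  rw [S.norm_smul, ← hf.norm a, ← hψ (φ a)]
  ring

/-- With b = σa, evaluate c^# × (c × b) twice: by the hexagonal identity as lb + T(c^#, b)c, and by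
the folding equation as l(1 + σ)(a + σa). -/
theorem sum_eq (a : J) : a + l • ψ (φ a) + l • ψ (φ (l • ψ (φ a))) =
    (l⁻¹ * S.tr (S.adj c) a) • c := by
  have hl := hf.ne_zero
  set b := l • ψ (φ a) with hb
  have h1 : S.cross c b = φ (l • (a + b)) := by
    apply ψ.injective
    rw [← hf.add_eq]
    simp only [map_add, map_smul, smul_add, ← hb]
  have h2 := S.adj_cross c b
  rw [h1, hf.cross_map, hf.norm_c, hb, hf.tr_adj_c_map, ← hb] at h2
  simp only [map_add, map_smul, smul_add] at h2
  have h3 : l • (a + b + l • ψ (φ b)) = S.tr (S.adj c) a • c := by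
    simp only [smul_add]
    rw [← sub_eq_zero] at h2 ⊢
    rw [← h2]
    have e1 : ψ (φ a) = l⁻¹ • b := by rw [hb, smul_smul, inv_mul_cancel₀ hl, one_smul]
    rw [e1]
    match_scalars <;> field_simp
    ring
  rw [mul_smul, ← h3, smul_smul, inv_mul_cancel₀ hl, one_smul]

/-- T(c^#, ·) is invariant under σ, so the sums for a and σa coincide and their difference is σ³a −
a. -/
theorem map_map_map (a : J) : l • ψ (φ (l • ψ (φ (l • ψ (φ a))))) = a := by
  have h1 := hf.sum_eq a
  have h2 := hf.sum_eq (l • ψ (φ a))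
  rw [hf.tr_adj_c_map] at h2
  linear_combination (norm := module) h2 - h1

/-- The trace formula for σ transported to τ through the trace form, which is nondegenerate because
3 ≠ 0. -/
theorem dual_sum_eq (m : J) : m + l • φ (ψ m) + l • φ (ψ (l • φ (ψ m))) =
    (l⁻¹ * S.tr c m) • S.adj c := by
  rw [← sub_eq_zero]
  refine S.eq_zero_of_tr_eq_zero hf.three_ne_zero fun y => ?_
  rw [S.tr_symm]
  set p := l • ψ (φ y) with hp
  have hy := hf.map_map_map y
  rw [← hp] at hy
  set q := l • ψ (φ p) with hq
  have e1 : S.tr y (l • φ (ψ m)) = S.tr q m := by rw [← hy, hf.tr_map_map]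
  have e2 : S.tr y (l • φ (ψ (l • φ (ψ m)))) = S.tr p m := by
    rw [← hy, hf.tr_map_map, hq, hf.tr_map_map]
  have h := congrArg (fun x => S.tr x m) (hf.sum_eq y)
  simp only [← hp, ← hq, map_add, LinearMap.add_apply, map_smul, LinearMap.smul_apply,
    smul_eq_mul] at h
  rw [map_sub, map_add, map_add, e1, e2, map_smul (S.tr y), smul_eq_mul, S.tr_symm y (S.adj c)]
  linear_combination h

/-- Elements of trace zero whose products with `a ≠ 0` have trace zero vanish. -/
theorem eq_zero_of_tr {a b : J} (ha0 : a ≠ 0) (ha : S.tr (S.adj c) a = 0)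
    (hb : S.tr (S.adj c) b = 0) (h1 : S.tr c (S.cross a b) = 0)
    (h2 : S.tr c (S.cross a (l • ψ (φ b))) = 0) : b = 0 := by
  have h3 := hf.three_ne_zero
  have sa := hf.sum_eq a
  have sb := hf.sum_eq b
  rw [ha, mul_zero, zero_smul] at sa
  rw [hb, mul_zero, zero_smul] at sb
  have dm := hf.dual_sum_eq (S.cross a b)
  have dn := hf.dual_sum_eq (S.cross a (l • ψ (φ b)))
  rw [h1, mul_zero, zero_smul] at dm
  rw [h2, mul_zero, zero_smul] at dn
  simp only [← hf.cross_map_map] at dm dn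
  have tr := fun x => hf.tr_map_map x (S.adj a)
  simp only [← hf.adj_map] at tr
  have t1 := tr (l • ψ (φ (l • ψ (φ b))))
  have t2 := tr (l • ψ (φ b))
  have t3 := tr (l • ψ (φ (l • ψ (φ a))))
  rw [hf.map_map_map] at t1 t3 dn
  have hN := hf.norm_map a
  obtain ⟨a', ha'⟩ : ∃ x, x = l • ψ (φ a) := ⟨_, rfl⟩
  obtain ⟨b', hb'⟩ : ∃ x, x = l • ψ (φ b) := ⟨_, rfl⟩
  rw [← ha'] at sa dm dn t1 t2 t3 hN
  rw [← hb'] at sb dm dn t1 t2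
  have ea : l • ψ (φ a') = -a - a' := by linear_combination (norm := module) sa
  have eb : l • ψ (φ b') = -b - b' := by linear_combination (norm := module) sb
  rw [ea] at dm dn t3
  rw [eb] at dm dn t1 t2
  rw [S.tr_symm, S.tr_symm _ (S.adj a)] at t1 t2 t3
  have key := S.smul_eq_smul_of_cross h3 dm dn hN t1 t2 t3
  by_contra hb0
  have hsum : S.tr (S.adj a) (-a - a') = -(3 * S.norm a) - S.tr (S.adj a) a' := by
    rw [map_sub, map_neg, S.tr_adj']
  -- If T(a^#, a') = 0, the other coefficient is −3N(a) ≠ 0 and b vanishes. Otherwise b is an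
  -- eigenvector of σ for some k, and trace zero gives k² + k + 1 = 0, which `ne_zero_of_sq`
  -- excludes.
  by_cases hB : S.tr (S.adj a) a' = 0
  · rw [hsum, hB, zero_smul, sub_zero] at key
    rcases smul_eq_zero.1 key.symm with h | h
    · exact mul_ne_zero h3 (S.norm_ne_zero ha0) (neg_eq_zero.1 h)
    · exact hb0 h
  · obtain ⟨k, hk⟩ : ∃ k : F, b' = k • b :=
      ⟨(S.tr (S.adj a) a')⁻¹ * S.tr (S.adj a) (-a - a'), by
        rw [mul_smul, ← key, smul_smul, inv_mul_cancel₀ hB, one_smul]⟩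
    have e : l • ψ (φ b') = k • b' := by
      rw [hk, map_smul, map_smul, smul_comm, ← hb', hk]
    rw [e, hk] at eb
    have : (k ^ 2 + k + 1) • b = 0 := by linear_combination (norm := module) eb
    rcases smul_eq_zero.1 this with h | h
    · exact hf.ne_zero_of_sq (k := -k) (by linear_combination h)
    · exact hb0 h

/-- A folding can only exist in dimension at most three. -/
theorem finrank_le : Module.Finite F J ∧ Module.finrank F J ≤ 3 := by
  obtain ⟨f, hinj⟩ : ∃ f : J →ₗ[F] (Fin 3 → F), Function.Injective f := by
    by_cases h : ∃ a, a ≠ 0 ∧ S.tr (S.adj c) a = 0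
    · obtain ⟨a, ha0, ha⟩ := h
      -- The three functionals are those occurring in `eq_zero_of_tr`. Without a nonzero trace-zero
      -- element, T(c^#, ·) alone is already injective.
      refine ⟨LinearMap.pi ![S.tr (S.adj c), (S.tr c).comp (S.cross a),
        (S.tr c).comp ((S.cross a).comp (l • (ψ.toLinearMap.comp φ.toLinearMap)))], ?_⟩
      rw [← LinearMap.ker_eq_bot, LinearMap.ker_eq_bot']
      intro b hb
      exact hf.eq_zero_of_tr ha0 ha (congrFun hb 0) (congrFun hb 1) (congrFun hb 2)
    · refine ⟨LinearMap.pi fun _ => S.tr (S.adj c), ?_⟩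
      rw [← LinearMap.ker_eq_bot, LinearMap.ker_eq_bot']
      intro b hb
      by_contra hb0
      exact h ⟨b, hb0, congrFun hb 0⟩
  have := Module.Finite.of_injective f hinj
  refine ⟨this, ?_⟩
  have := LinearMap.finrank_le_finrank_of_injective hinj
  rwa [Module.finrank_fin_fun] at this

end IsFolding

end HexagonalSystem

/-! ### Isotopies moving 1 to a given element in dimension at most three. -/

namespace HexagonalSystem

variable {F : Type w} {J : Type z} [Field F] [AddCommGroup J] [Module F J]
  (S : HexagonalSystem F J)

theorem cross_one (a : J) : S.cross S.one a = S.tr a S.one • S.one - a := by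
  have h := S.one_cross a
  linear_combination (norm := module) h

theorem tr_eq (a b : J) :
    S.tr a b = S.tr a S.one * S.tr b S.one - S.tr (S.cross a b) S.one := by
  have h : S.tr (S.tr a S.one • S.one - S.cross S.one a) b = S.tr a b := by rw [← S.one_cross]
  rw [← h, map_sub, map_smul, LinearMap.sub_apply, LinearMap.smul_apply, smul_eq_mul,
    S.tr_symm S.one b, ← S.tr_cross, S.tr_symm S.one]

theorem cross_adj_self (d : J) : S.cross d (S.adj d) =
    (S.tr d S.one * S.tr (S.adj d) S.one - S.norm d) • S.one - S.tr (S.adj d) S.one • d -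
      S.tr d S.one • S.adj d := by
  have h := S.adj_cross d S.one
  rw [S.cross_symm d S.one, S.cross_one, map_sub, map_smul, S.cross_symm _ S.one, S.cross_one,
    S.cross_symm _ d] at h
  linear_combination (norm := module) -h

theorem tr_self (d : J) : S.tr d d = S.tr d S.one ^ 2 - 2 * S.tr (S.adj d) S.one := by
  rw [S.tr_eq d d, S.cross_self, map_smul, LinearMap.smul_apply, smul_eq_mul]
  ring

theorem adj_comb (d : J) (p q r : F) : S.adj (p • S.one + q • d + r • S.adj d) =
    (p ^ 2 + p * q * S.tr d S.one + p * r * S.tr (S.adj d) S.one +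
      q * r * (S.tr d S.one * S.tr (S.adj d) S.one - S.norm d)) • S.one +
    (r ^ 2 * S.norm d - p * q - q * r * S.tr (S.adj d) S.one) • d +
    (q ^ 2 - p * r - q * r * S.tr d S.one) • S.adj d := by
  simp only [S.adj_add, S.adj_smul, map_add, map_smul, LinearMap.add_apply, LinearMap.smul_apply,
    S.adj_one, S.cross_one, S.adj_adj, S.cross_adj_self]
  module

/-- Norm similarities with multiplier `ν`. -/
structure IsIsotopy (M M' : J ≃ₗ[F] J) (ν : F) : Prop where
  ne_zero : ν ≠ 0
  adj : ∀ a, M' (S.adj a) = S.adj (M a)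
  norm : ∀ a, S.norm (M a) = ν * S.norm a
  tr : ∀ a b, S.tr (M a) (M' b) = ν * S.tr a b

/-- If d^# = α1 + βd, then (β1 + d)^# is a multiple of 1. As β1 + d is a multiple of its double
adjoint, d would be a multiple of 1. -/
theorem linearIndependent_of_notMem {d : J} (hd : ∀ k : F, d ≠ k • S.one) :
    LinearIndependent F ![S.one, d, S.adj d] := by
  rw [Fintype.linearIndependent_iff]
  intro k hk
  rw [Fin.sum_univ_three] at hk
  simp only [Matrix.cons_val_zero, Matrix.cons_val_one, Matrix.cons_val] at hk
  have h2 : k 2 = 0 := by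
    by_contra h2
    obtain ⟨α, β, e⟩ : ∃ α β : F, S.adj d = α • S.one + β • d := by
      refine ⟨-(k 2)⁻¹ * k 0, -(k 2)⁻¹ * k 1, ?_⟩
      have : S.adj d = (k 2)⁻¹ • k 2 • S.adj d := by
        rw [smul_smul, inv_mul_cancel₀ h2, one_smul]
      rw [this]
      linear_combination (norm := module) (k 2)⁻¹ • hk
    have h := S.adj_comb d β 1 0
    rw [one_smul, zero_smul, add_zero, e] at h
    have h1 : S.adj (β • S.one + d) = (β ^ 2 + β * S.tr d S.one + α) • S.one := by
      rw [h]; module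
    have hne : β • S.one + d ≠ 0 := fun h0 => hd (-β) (by
      linear_combination (norm := module) h0)
    have h3 := S.adj_adj (β • S.one + d)
    rw [h1, S.adj_smul, S.adj_one] at h3
    have hN := S.norm_ne_zero hne
    refine hd ((S.norm (β • S.one + d))⁻¹ * (β ^ 2 + β * S.tr d S.one + α) ^ 2 - β) ?_
    rw [sub_smul, mul_smul, h3, smul_smul, inv_mul_cancel₀ hN]
    module
  rw [h2, zero_smul, add_zero] at hk
  have h1 : k 1 = 0 := by
    by_contra h1
    refine hd (-(k 1)⁻¹ * k 0) ?_
    have : d = (k 1)⁻¹ • k 1 • d := by rw [smul_smul, inv_mul_cancel₀ h1, one_smul]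
    rw [this]
    linear_combination (norm := module) (k 1)⁻¹ • hk
  rw [h1, zero_smul, add_zero] at hk
  have h0 := (smul_eq_zero.1 hk).resolve_right S.one_ne_zero
  intro i
  fin_cases i
  exacts [h0, h1, h2]

theorem exists_isIsotopy_of_scalar {k : F} (hk : k ≠ 0) :
    ∃ M M' ν, S.IsIsotopy M M' ν ∧ M S.one = k • S.one := by
  refine ⟨LinearEquiv.smulOfNeZero F J k hk, LinearEquiv.smulOfNeZero F J (k ^ 2) (pow_ne_zero 2 hk),
    k ^ 3, ⟨pow_ne_zero 3 hk, fun a => ?_, fun a => ?_, fun a b => ?_⟩, rfl⟩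
  · exact (S.adj_smul k a).symm
  · exact S.norm_smul k a
  · change S.tr (k • a) (k ^ 2 • b) = _
    rw [map_smul, map_smul, LinearMap.smul_apply, smul_eq_mul, smul_eq_mul]
    ring

/-- Read J as the cubic algebra F[d] with d^# = d² − T(d)d + T(d^#). Then `m` is multiplication by d
and `m'` multiplication by d^#, both written out on the basis 1, d, d^#. -/
theorem exists_isIsotopy_of_basis {d : J} (hd : d ≠ 0) (b : Module.Basis (Fin 3) F J)
    (hb : ⇑b = ![S.one, d, S.adj d]) : ∃ M M' ν, S.IsIsotopy M M' ν ∧ M S.one = d := by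
  have hN := S.norm_ne_zero hd
  obtain ⟨N, hNd⟩ : ∃ N, N = S.norm d := ⟨_, rfl⟩
  obtain ⟨T, hT⟩ : ∃ T, T = S.tr d S.one := ⟨_, rfl⟩
  obtain ⟨R, hR⟩ : ∃ R, R = S.tr (S.adj d) S.one := ⟨_, rfl⟩
  rw [← hNd] at hN
  have b0 : b 0 = S.one := by rw [hb]; rfl
  have b1 : b 1 = d := by rw [hb]; rfl
  have b2 : b 2 = S.adj d := by rw [hb]; rfl
  have span : ∀ a, ∃ p q r : F, a = p • S.one + q • d + r • S.adj d := fun a =>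
    ⟨b.repr a 0, b.repr a 1, b.repr a 2, by
      nth_rw 1 [← b.sum_repr a]
      rw [Fin.sum_univ_three, b0, b1, b2]⟩
  let m : J →ₗ[F] J := b.constr F ![d, S.adj d + T • d - R • S.one, N • S.one]
  let m' : J →ₗ[F] J := b.constr F ![S.adj d, N • S.one, R • S.adj d - (N * T) • S.one + N • d]
  have m0 : m S.one = d := by rw [← b0]; exact b.constr_basis _ _ _
  have m1 : m d = S.adj d + T • d - R • S.one := by
    nth_rw 1 [← b1]; exact b.constr_basis _ _ _
  have m2 : m (S.adj d) = N • S.one := by nth_rw 1 [← b2]; exact b.constr_basis _ _ _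
  have m0' : m' S.one = S.adj d := by rw [← b0]; exact b.constr_basis _ _ _
  have m1' : m' d = N • S.one := by nth_rw 1 [← b1]; exact b.constr_basis _ _ _
  have m2' : m' (S.adj d) = R • S.adj d - (N * T) • S.one + N • d := by
    nth_rw 1 [← b2]; exact b.constr_basis _ _ _
  have mm' : ∀ a, m (m' a) = N • a := fun a => by
    obtain ⟨p, q, r, rfl⟩ := span a
    simp only [map_add, map_smul, map_sub, m0', m1', m2', m0, m1, m2]
    module
  have mm : ∀ a, m' (m a) = N • a := fun a => by
    obtain ⟨p, q, r, rfl⟩ := span a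
    simp only [map_add, map_smul, map_sub, m0', m1', m2', m0, m1, m2]
    module
  have hadj : ∀ a, m' (S.adj a) = S.adj (m a) := fun a => by
    obtain ⟨p, q, r, rfl⟩ := span a
    have e : m (p • S.one + q • d + r • S.adj d) =
        (r * N - q * R) • S.one + (p + q * T) • d + q • S.adj d := by
      simp only [map_add, map_smul, m0, m1, m2]
      module
    rw [e, S.adj_comb, S.adj_comb, ← hNd, ← hT, ← hR]
    simp only [map_add, map_smul, m0', m1', m2']
    module
  have hnorm : ∀ a, S.norm (m a) = N * S.norm a := fun a => by
    by_cases ha : a = 0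
    · simp [ha, S.norm_zero]
    have hma : m a ≠ 0 := fun h => by
      have := mm a
      rw [h, map_zero, eq_comm, smul_eq_zero] at this
      exact this.elim hN ha
    -- The left side is also (ma)^{##} = N(ma)·ma, so comparison with the right side gives the norm
    -- of ma.
    have e1 : S.adj (m' (S.adj a)) = N • m (S.adj (S.adj a)) := by
      obtain ⟨x, hx⟩ : ∃ x, x = N⁻¹ • m' (S.adj a) := ⟨_, rfl⟩
      have hx1 : m' (S.adj a) = N • x := by rw [hx, smul_smul, mul_inv_cancel₀ hN, one_smul]
      have hx2 : S.adj a = m x := by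
        rw [hx, map_smul, mm', smul_smul, inv_mul_cancel₀ hN, one_smul]
      rw [hx1, S.adj_smul, hx2, ← hadj, mm', smul_smul, pow_two]
    rw [hadj, S.adj_adj, S.adj_adj, map_smul, smul_smul] at e1
    exact smul_left_injective F hma e1
  have hself : ∀ a x, S.tr (m a) x = S.tr a (m x) := by
    have t00 := S.tr_one_one
    have t11 := S.tr_self d
    have t12 := S.tr_adj d
    have t21 := S.tr_adj' d
    have t22 := S.tr_self (S.adj d)
    rw [S.adj_adj, map_smul, LinearMap.smul_apply, smul_eq_mul] at t22
    intro a x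
    obtain ⟨p, q, r, rfl⟩ := span a
    obtain ⟨p', q', r', rfl⟩ := span x
    simp only [map_add, map_smul, map_sub, m0, m1, m2, LinearMap.add_apply, LinearMap.smul_apply,
      LinearMap.sub_apply, smul_eq_mul, S.tr_symm S.one d, S.tr_symm S.one (S.adj d), t00, t11,
      t12, t21, t22, ← hNd, ← hT, ← hR]
    ring
  have inv1 : ∀ a, N⁻¹ • m' (m a) = a := fun a => by
    rw [mm, smul_smul, inv_mul_cancel₀ hN, one_smul]
  have inv2 : ∀ a, m (N⁻¹ • m' a) = a := fun a => by
    rw [map_smul, mm', smul_smul, inv_mul_cancel₀ hN, one_smul]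
  have inv3 : ∀ a, m' (N⁻¹ • m a) = a := fun a => by rw [map_smul]; exact inv1 a
  have inv4 : ∀ a, N⁻¹ • m (m' a) = a := fun a => by rw [← map_smul]; exact inv2 a
  refine ⟨⟨m, fun a => N⁻¹ • m' a, inv1, inv2⟩, ⟨m', fun a => N⁻¹ • m a, inv4, inv3⟩, N,
    ⟨hN, hadj, hnorm, fun a x => ?_⟩, m0⟩
  change S.tr (m a) (m' x) = _
  rw [hself, mm', map_smul, smul_eq_mul]

/-- In dimension at most three every nonzero element is the image of `1` under an isotopy. -/
theorem exists_isIsotopy [Module.Finite F J] (h : Module.finrank F J ≤ 3) {d : J} (hd : d ≠ 0) :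
    ∃ M M' ν, S.IsIsotopy M M' ν ∧ M S.one = d := by
  by_cases hk : ∃ k : F, d = k • S.one
  · obtain ⟨k, rfl⟩ := hk
    exact S.exists_isIsotopy_of_scalar (fun h0 => hd (by rw [h0, zero_smul]))
  · have hli := S.linearIndependent_of_notMem (d := d) fun k e => hk ⟨k, e⟩
    have hcard := hli.fintype_card_le_finrank
    rw [Fintype.card_fin] at hcard
    exact S.exists_isIsotopy_of_basis hd
      (basisOfLinearIndependentOfCardEqFinrank hli (by rw [Fintype.card_fin]; omega))
      (coe_basisOfLinearIndependentOfCardEqFinrank _ _)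

end HexagonalSystem

theorem IsParametrisation.comp {G M : Type*} [Group G] [AddCommGroup M] {x : M → G}
    {U : Subgroup G} (hx : IsParametrisation x U) {f : M → M} (hadd : ∀ a b, f (a + b) = f a + f b)
    (hf : Function.Bijective f) : IsParametrisation (fun a => x (f a)) U := by
  refine ⟨fun a b => by simp only [hadd, hx.1], hx.2.1.comp hf.1, ?_⟩
  rw [← hx.2.2]
  exact hf.2.range_comp x

namespace HexagonalSystem.IsIsotopy

variable {F : Type w} {J : Type z} [Field F] [AddCommGroup J] [Module F J]
  {S : HexagonalSystem F J} {M M' : J ≃ₗ[F] J} {ν : F} (hM : S.IsIsotopy M M' ν)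
include hM

theorem cross (a b : J) : M' (S.cross a b) = S.cross (M a) (M b) := by
  have h := hM.adj (a + b)
  rw [S.adj_add, map_add, map_add, hM.adj, hM.adj, map_add M, S.adj_add] at h
  exact add_left_cancel (add_right_cancel h)

theorem tr' (a b : J) : S.tr (M' a) (M b) = ν * S.tr a b := by
  rw [S.tr_symm, hM.tr, S.tr_symm]

end HexagonalSystem.IsIsotopy

/-! ### Normalisation of c to 1. -/

namespace HexagonCoordinates

variable {P : Type u} {L : Type v} {Γ : PointLineGeometry P L}
  {F : Type w} {J : Type z} [Field F] [AddCommGroup J] [Module F J]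
  {S : HexagonalSystem F J} (X : HexagonCoordinates Γ S)

/-- Coordinates twisted by an isotopy. -/
def twist {M M' : J ≃ₗ[F] J} {ν : F} (hM : S.IsIsotopy M M' ν) : HexagonCoordinates Γ S where
  A := X.A
  isApartment := X.isApartment
  isPoint := X.isPoint
  x₁ a := X.x₁ (M a)
  x₂ t := X.x₂ (ν * t)
  x₃ a := X.x₃ (M' a)
  x₄ t := X.x₄ (ν * t)
  x₅ a := X.x₅ (M a)
  x₆ t := X.x₆ t
  param₁ := X.param₁.comp (map_add M) M.bijective
  param₂ := X.param₂.comp (mul_add ν) (mulLeft_bijective₀ ν hM.ne_zero)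
  param₃ := X.param₃.comp (map_add M') M'.bijective
  param₄ := X.param₄.comp (mul_add ν) (mulLeft_bijective₀ ν hM.ne_zero)
  param₅ := X.param₅.comp (map_add M) M.bijective
  param₆ := X.param₆
  comm₁₂ _ _ := X.comm₁₂ _ _
  comm₁₃ _ _ := by rw [X.comm₁₃, hM.tr]
  comm₁₄ _ _ := X.comm₁₄ _ _
  comm₁₅ _ _ := by
    rw [X.comm₁₅, ← hM.adj, ← hM.adj, hM.tr', hM.tr, hM.cross, mul_neg]
  comm₁₆ a t := by
    rw [X.comm₁₆, ← hM.adj, hM.norm, map_smul, map_neg, map_smul,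
      show -(t * (ν * S.norm a)) = ν * -(t * S.norm a) by ring,
      show t ^ 2 * (ν * S.norm a) = ν * (t ^ 2 * S.norm a) by ring]
  comm₂₃ _ _ := X.comm₂₃ _ _
  comm₂₄ _ _ := X.comm₂₄ _ _
  comm₂₅ _ _ := X.comm₂₅ _ _
  comm₂₆ _ _ := by rw [X.comm₂₆, mul_assoc]
  comm₃₄ _ _ := X.comm₃₄ _ _
  comm₃₅ _ _ := by rw [X.comm₃₅, hM.tr']
  comm₃₆ _ _ := X.comm₃₆ _ _
  comm₄₅ _ _ := X.comm₄₅ _ _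
  comm₄₆ _ _ := X.comm₄₆ _ _
  comm₅₆ _ _ := X.comm₅₆ _ _

variable (hΓ : Γ.IsMoufangHexagon)
include hΓ

omit hΓ in
theorem IsNormalised.conj {X : HexagonCoordinates Γ S} {θ n : Γ.Collineation} {O : Set P}
    (hΓ : Γ.IsMoufangHexagon) (h : X.IsNormalised θ O) (hn : ∀ j, n • X.A j = X.A j) :
    X.IsNormalised (n * θ * n⁻¹) (n.1.1 '' O) := by
  refine ⟨h.toIsDomesticFixing.conj hΓ.hexagon n, ?_, ?_, ?_⟩
  · obtain ⟨p, hp, e⟩ := h.mem_seven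
    exact ⟨_, ⟨p, hp, rfl⟩, by rw [← hn 7, ← e]; rfl⟩
  · obtain ⟨p, hp, e⟩ := h.mem_one
    exact ⟨_, ⟨p, hp, rfl⟩, by rw [← hn 1, ← e]; rfl⟩
  · rw [mul_smul, mul_smul, inv_smul_eq_iff.2 (hn 8).symm, h.smul_eight, hn]

/-- After conjugation by an element fixing the apartment, `θ = g x₁(1) s`. -/
theorem exists_isNormalised_one {θ s : Γ.Collineation} {O : Set P} (hs : X.IsReflection s)
    (h : X.IsNormalised θ O) : ∃ n O' g φ ψ, X.IsNormalised (n * θ * n⁻¹) O' ∧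
      n * θ * n⁻¹ = g * X.rd.x₁ S.one * s ∧ X.IsTorus g φ ψ 1 ∧ S.IsFolding φ ψ 1 S.one := by
  obtain ⟨g, c, φ, ψ, l, hθ, hg⟩ := h.exists_eq_mul hΓ hs
  have hf := h.isFolding hΓ hs hg hθ
  obtain ⟨hfin, hrank⟩ := hf.finrank_le
  -- The target is c⁻¹ because θ A 6 = x₁(c⁻¹) A 8. After conjugation by m⁻¹ the image of A 6 is
  -- x₁(1) A 8; decomposing the conjugate afresh then gives c'⁻¹ = 1 and l' = N(1) = 1.
  obtain ⟨M, M', ν, hM, hM1⟩ := S.exists_isIsotopy hrank (S.inv_ne_zero hf.c_ne_zero)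
  obtain ⟨m, hmA, hm⟩ := exists_collineation_of_coordinates hΓ X (X.twist hM) rfl
  have hm8 : m • X.rd.x₁ S.one • X.A 8 = X.rd.x₁ (S.inv c) • X.A 8 := by
    rw [hm, ← hM1]
    rfl
  have hmA' : ∀ j, m⁻¹ • X.A j = X.A j := fun j => inv_smul_eq_iff.2 (hmA j).symm
  have h' := h.conj hΓ hmA'
  obtain ⟨g', c', φ', ψ', l', hθ', hg'⟩ := h'.exists_eq_mul hΓ hs
  have hf' := h'.isFolding hΓ hs hg' hθ'
  have h6 := smul_six_of_eq_mul hs hg' hθ'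
  rw [inv_inv, mul_smul, mul_smul, hmA, smul_six_of_eq_mul hs hg hθ, hf.map_c_eq_inv, ← hm8,
    inv_smul_smul, hf'.map_c_eq_inv, X.x₁_smul_eq_iff hΓ] at h6
  obtain rfl : c' = S.one := by
    rw [← S.inv_inv hf'.c_ne_zero, ← h6, S.inv_one]
  obtain rfl : l' = 1 := by rw [← hf'.norm_c, S.norm_one]
  exact ⟨m⁻¹, _, g', φ', ψ', h', hθ', hg', hf'⟩

end HexagonCoordinates

/-! ### Foldings with c = 1. -/

namespace HexagonalSystem.IsFolding

variable {F : Type w} {J : Type z} [Field F] [AddCommGroup J] [Module F J]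
  {S : HexagonalSystem F J} {φ ψ : J ≃ₗ[F] J} (hf : S.IsFolding φ ψ 1 S.one)
include hf

theorem map_one : φ S.one = S.one := by rw [hf.map_c_eq_inv, S.inv_one]

/-- Both maps fix 1 and φ preserves the trace, so applying ψ to 1 × a = T(a)1 − a identifies them.
-/
theorem eq_of_one : ψ = φ := by
  have hψ1 : ψ S.one = S.one := by
    rw [← S.adj_one, hf.adj, one_smul, hf.map_one]
  have htr : ∀ a, S.tr (φ a) S.one = S.tr a S.one := fun a => by
    have := hf.tr a S.one
    rwa [one_mul, hψ1] at this
  ext a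
  have h := hf.cross S.one a
  rw [one_smul, hf.map_one, S.cross_one, S.cross_one, htr, map_sub, map_smul, hψ1] at h
  exact sub_right_injective h

theorem isAutomorphism : S.IsAutomorphism φ := fun a => by
  have := hf.adj a
  rwa [hf.eq_of_one, one_smul] at this

/-- For c = 1 the folding equation reads a + φ²(a) = φ(1 × a) = T(a)1 − φ(a). -/
theorem trace_smul_one (a : J) : S.trace a • S.one = a + φ a + φ (φ a) := by
  have h := hf.add_eq a
  rw [hf.eq_of_one, one_smul, S.cross_one, map_sub, map_smul, hf.map_one] at h
  rw [trace]
  linear_combination (norm := module) -h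

theorem pow_three : φ ^ 3 = 1 := by
  ext a
  have h1 := hf.trace_smul_one a
  have h2 := congrArg φ h1
  rw [map_smul, hf.map_one, h1, map_add, map_add] at h2
  change φ (φ (φ a)) = a
  linear_combination (norm := module) -h2

theorem trace_adj (a : J) : S.trace (S.adj a) = S.tr a (φ a) := by
  have := hf.tr_c_adj a
  rwa [one_mul, S.tr_symm] at this

theorem ne_one_sub (z : J) (hz : z ≠ 0) : z ≠ S.one - φ (S.inv z) := by
  have := hf.map_ne z hz
  rw [map_sub, hf.map_one] at this
  exact this.symm

end HexagonalSystem.IsFolding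

theorem mainTheorem4 {P : Type u} {L : Type v} {F : Type w} {J : Type z}
    [Field F] [AddCommGroup J] [Module F J]
    (Γ : PointLineGeometry P L) (hΓ : Γ.IsMoufangHexagon)
    (S : HexagonalSystem F J) (X : HexagonCoordinates Γ S)
    (θ : Γ.Collineation) (hθ : θ ≠ 1) (hdom : Γ.IsPointDomestic θ)
    (O : Set P) (hO : Γ.IsOvoid O)
    (hfix : ∀ p ∈ O, θ • (Sum.inl p : P ⊕ L) = Sum.inl p) :
    ∃ (h : J ≃ₗ[F] J) (η s₁ : Γ.Collineation),
      S.IsAutomorphism h ∧ X.IsInducedBy η h ∧ X.IsS₁ s₁ ∧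
      IsConj θ (η * X.x₁ S.one * s₁) ∧
      h ^ 3 = 1 ∧ orderOf θ = 3 ∧
      (∀ a : J, S.trace a • S.one = a + h a + h (h a)) ∧
      (∀ a : J, S.trace (S.adj a) = S.tr a (h a)) ∧
      ∀ z : J, z ≠ 0 → z ≠ S.one - h (S.inv z) := by
  obtain ⟨s, hs₁, hs⟩ := X.exists_isS₁ hΓ
  have hdf : Γ.IsDomesticFixing θ O := ⟨hθ, hdom, hO, by
    rintro _ ⟨p, hp, rfl⟩
    exact hfix p hp⟩
  obtain ⟨n, hn⟩ := X.exists_isNormalised hΓ hdf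
  obtain ⟨m, O', η, φ, ψ, hN, e, hη, hf⟩ := X.exists_isNormalised_one hΓ hs hn
  have hconj : IsConj θ (η * X.x₁ S.one * s) := by
    rw [isConj_iff]
    exact ⟨m * n, by rw [mul_inv_rev, ← mul_assoc, mul_assoc m, mul_assoc m]; exact e⟩
  refine ⟨φ, η, s, hf.isAutomorphism, ⟨hη.fix, hη.conj₁, fun t => ?_, fun a => ?_, hη.conj₄,
    fun a => ?_, fun t => ?_⟩, hs₁, hconj, hf.pow_three, ?_, hf.trace_smul_one, hf.trace_adj,
    hf.ne_one_sub⟩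
  · have := hη.conj₂ t
    rwa [inv_one, one_mul] at this
  · have := hη.conj₃ a
    rwa [hf.eq_of_one] at this
  · have := hη.conj₅ a
    rwa [one_smul] at this
  · have := hη.conj₆ t
    rwa [one_mul] at this
  · have h3 := hN.orderOf_eq hΓ hs hη e
    obtain ⟨c, hc⟩ := isConj_iff.1 hconj
    rw [e] at h3
    rw [← h3]
    refine orderOf_eq_orderOf_iff.2 fun k => ?_
    change _ ↔ (η * X.x₁ S.one * s) ^ k = 1
    rw [← hc, conj_pow, conj_eq_one_iff]
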